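/- Let $(\mathbb C,\otimes,I)$ be a monoidal category (associators and unitors of $\mathbb C$ are suppressed in the formulas below). The category $\mathbf{Mctx}\,\mathbb C$ of monoidal contexts has as objects pairs $X=(X,X')$ of objects of $\mathbb C$; the set of morphisms from $A=(A,A')$ to $X=(X,X')$ is the coend $$\mathbf{Mctx}(A;X)=\int^{M,N\in\mathbb C}\mathbb C(A;M\otimes X\otimes N)\times\mathbb C(M\otimes X'\otimes N;A'),$$ whose elements are written $f⨾(\mathrm{id}_M\otimes\blacksquare\otimes\mathrm{id}_N)⨾g$; composition plugs the second context in the hole of the first, and the identity of $A$ is $\mathrm{id}_A⨾\blacksquare⨾\mathrm{id}_{A'}$. Its sequential splits, parallel splits and units are the profunctors $$\mathbf{Mctx}(A;X\triangleleft Y)=\int^{M,N,K,L}\mathbb C(A;M\otimes X\otimes N)\times\mathbb C(M\otimes X'\otimes N;K\otimes Y\otimes L)\times\mathbb C(K\otimes Y'\otimes L;A'),$$ $$\mathbf{Mctx}(A;X\otimes Y)=\int^{M,N,O}\mathbb C(A;M\otimes X\otimes N\otimes Y\otimes O)\times\mathbb C(M\otimes X'\otimes N\otimes Y'\otimes O;A'),$$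 $$\mathbf{Mctx}(A;I)=\mathbf{Mctx}(A;N)=\mathbb C(A;A'),$$ where contexts act by plugging in the holes and by plugging into the hole of a context. A promonoidal structure on a category $\mathbb V$ consists of profunctors $\mathbb V(\bullet;\bullet\triangleleft\bullet)\colon\mathbb V^{op}\times\mathbb V\times\mathbb V\to\mathbf{Set}$ and $\mathbb V(\bullet;N)\colon\mathbb V^{op}\to\mathbf{Set}$ with isomorphisms, natural in all arguments, $\int^U\mathbb V(A;U\triangleleft Z)\times\mathbb V(U;X\triangleleft Y)\cong\int^U\mathbb V(A;X\triangleleft U)\times\mathbb V(U;Y\triangleleft Z)$, $\int^U\mathbb V(A;U\triangleleft X)\times\mathbb V(U;N)\cong\mathbb V(A;X)$ and $\int^U\mathbb V(A;X\triangleleft U)\times\mathbb V(U;N)\cong\mathbb V(A;X)$, that satisfy the pentagon and triangle equations. A produoidal category is a category $\mathbb V$ with two promonoidal structures $(\otimes,I)$ and $(\triangleleft,N)$ and natural transformations $$\psi_2\colon\mathbb V(\bullet;(X\triangleleft Y)\otimes(Z\triangleleft W))\to\mathbb V(\bullet;(X\otimes Z)\triangleleft(Y\otimes W)),\quad \psi_0\colon\mathbb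 V(\bullet;I)\to\mathbb V(\bullet;I\triangleleft I),$$ $$\varphi_2\colon\mathbb V(\bullet;N\otimes N)\to\mathbb V(\bullet;N),\quad \varphi_0\colon\mathbb V(\bullet;I)\to\mathbb V(\bullet;N)$$ (nested expressions denote coends over $\mathbb V$), subject to the coherence equations of a duoidal category: compatibility of $\psi_2$ with both associators and with the unitors of both structures, $(N,\varphi_2,\varphi_0)$ is a monoid for $\otimes$, and $(I,\psi_0,\varphi_0)$ is a comonoid for $\triangleleft$. It is normal if $\varphi_0$ is an isomorphism. **Proposition.** $\mathbf{Mctx}\,\mathbb C$, with the splits and units above, carries the structure of a normal produoidal category whose structure maps are given on representatives as follows (the holes named in brackets are filled by the morphisms shown, and equalities of splits with several holes are equalities in the corresponding coends over $\mathbb C$, that is, up to dinaturality in all the side objects). 1. Sequential associator: $(f_0⨾[U]⨾f_1⨾[Z]⨾f_2\mid U\colon g_0⨾[X]⨾g_1⨾[Y]⨾g_2)$ is sent to $(h_0⨾[X]⨾h_1⨾[U']⨾h_2\mid U'\colon k_0⨾[Y]⨾k_1⨾[Z]⨾k_2)$ if and only if $f_0⨾(\mathrm{id}\otimes g_0\otimes\mathrm{id})⨾[X]⨾(\mathrm{id}\otimes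 g_1\otimes\mathrm{id})⨾[Y]⨾(\mathrm{id}\otimes g_2\otimes\mathrm{id})⨾f_1⨾[Z]⨾f_2$ equals $h_0⨾[X]⨾h_1⨾(\mathrm{id}\otimes k_0\otimes\mathrm{id})⨾[Y]⨾(\mathrm{id}\otimes k_1\otimes\mathrm{id})⨾[Z]⨾(\mathrm{id}\otimes k_2\otimes\mathrm{id})⨾h_2$ in $\int^{M,N,K,L,P,Q}\mathbb C(A;M\otimes X\otimes N)\times\mathbb C(M\otimes X'\otimes N;K\otimes Y\otimes L)\times\mathbb C(K\otimes Y'\otimes L;P\otimes Z\otimes Q)\times\mathbb C(P\otimes Z'\otimes Q;A')$. 2. Sequential unitors: $(f_0⨾[U]⨾f_1⨾[X]⨾f_2\mid n\colon U\to U')\mapsto (f_0⨾(\mathrm{id}\otimes n\otimes\mathrm{id})⨾f_1)⨾[X]⨾f_2$ and $(f_0⨾[X]⨾f_1⨾[U]⨾f_2\mid n)\mapsto f_0⨾[X]⨾(f_1⨾(\mathrm{id}\otimes n\otimes\mathrm{id})⨾f_2)$. 3. Parallel associator: $(f_0⨾[U\otimes Z]⨾f_1\mid U\colon g_0⨾[X\otimes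 Y]⨾g_1)$ is sent to $(h_0⨾[X\otimes U']⨾h_1\mid U'\colon k_0⨾[Y\otimes Z]⨾k_1)$ if and only if the three-hole parallel splits obtained by substituting $g_0,g_1$ for the hole $U$ of the first and $k_0,k_1$ for the hole $U'$ of the second are equal in $\int^{M,N,O,P}\mathbb C(A;M\otimes X\otimes N\otimes Y\otimes O\otimes Z\otimes P)\times\mathbb C(M\otimes X'\otimes N\otimes Y'\otimes O\otimes Z'\otimes P;A')$. 4. Parallel unitors: for $f_0\colon A\to M\otimes U\otimes N\otimes X\otimes O$, $f_1\colon M\otimes U'\otimes N\otimes X'\otimes O\to A'$ and $n\colon U\to U'$, the left unitor gives $f_0⨾(\mathrm{id}_M\otimes n\otimes\mathrm{id}_{N\otimes X\otimes O})⨾(\mathrm{id}_{M\otimes U'\otimes N}\otimes\blacksquare\otimes\mathrm{id}_O)⨾f_1$; the right unitor, symmetrically, fills the second hole. 5. $\psi_2$ sends $(f_0⨾[U\otimes V]⨾f_1\mid U\colon g_0⨾[X]⨾g_1⨾[Y]⨾g_2\mid V\colon h_0⨾[Z]⨾h_1⨾[W]⨾h_2)$ to $(j_0⨾[P]⨾j_1⨾[Q]⨾j_2\mid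 P\colon k_0⨾[X\otimes Z]⨾k_1\mid Q\colon l_0⨾[Y\otimes W]⨾l_1)$ if and only if $f_0⨾(\mathrm{id}\otimes g_0\otimes\mathrm{id}\otimes h_0\otimes\mathrm{id})⨾[X\otimes Z]⨾(\mathrm{id}\otimes g_1\otimes\mathrm{id}\otimes h_1\otimes\mathrm{id})⨾[Y\otimes W]⨾(\mathrm{id}\otimes g_2\otimes\mathrm{id}\otimes h_2\otimes\mathrm{id})⨾f_1$ equals $j_0⨾(\mathrm{id}\otimes k_0\otimes\mathrm{id})⨾[X\otimes Z]⨾((\mathrm{id}\otimes k_1\otimes\mathrm{id})⨾j_1⨾(\mathrm{id}\otimes l_0\otimes\mathrm{id}))⨾[Y\otimes W]⨾(\mathrm{id}\otimes l_1\otimes\mathrm{id})⨾j_2$ in $\int^{M,N,O,K,L,R}\mathbb C(A;M\otimes X\otimes N\otimes Z\otimes O)\times\mathbb C(M\otimes X'\otimes N\otimes Z'\otimes O;K\otimes Y\otimes L\otimes W\otimes R)\times\mathbb C(K\otimes Y'\otimes L\otimes W'\otimes R;A')$. 6. $\psi_0(f)=(j_0⨾[U]⨾j_1⨾[V]⨾j_2\mid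 g\mid h)$ if and only if $f=j_0⨾(\mathrm{id}\otimes g\otimes\mathrm{id})⨾j_1⨾(\mathrm{id}\otimes h\otimes\mathrm{id})⨾j_2$; $\varphi_2(f_0⨾[U\otimes V]⨾f_1\mid g\mid h)=f_0⨾(\mathrm{id}\otimes g\otimes\mathrm{id}\otimes h\otimes\mathrm{id})⨾f_1$; and $\varphi_0=\mathrm{id}$. Moreover $\psi_0$, $\varphi_2$ and $\varphi_0$ are isomorphisms. -/

import Mathlib

open CategoryTheory MonoidalCategory Opposite

universe v u w

namespace Produoidal

section Coends

variable {V : Type u} [Category.{w} V]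

/-- Presheaves on `V`, with values in types large enough to contain coends over `V`. -/
abbrev Presheaf (V : Type u) [Category.{w} V] := Vᵒᵖ ⥤ Type (max u w)

/-- A profunctor `V × V ⇸ V`, that is, a functor `Vᵒᵖ × V × V → Set` (curried):
`((T.obj X).obj Y).obj (op A)` is the set `𝕍(A; X ◁ Y)`, and `(T.obj X).obj Y` is `𝕍(•; X ◁ Y)`. -/
abbrev Protensor (V : Type u) [Category.{w} V] := V ⥤ V ⥤ Presheaf V

section

variable (T : Protensor V)

/-- The natural transformation `𝕍(•; X ◁ Y) → 𝕍(•; X' ◁ Y')` induced by `f` and `g`. -/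
def postHom {X X' Y Y' : V} (f : X ⟶ X') (g : Y ⟶ Y') :
    (T.obj X).obj Y ⟶ (T.obj X').obj Y' :=
  (T.map f).app Y ≫ (T.obj X').map g

/-- The action of `f` and `g` on the covariant arguments of an element of `𝕍(A; X ◁ Y)`. -/
def post {A : Vᵒᵖ} {X X' Y Y' : V} (f : X ⟶ X') (g : Y ⟶ Y')
    (t : ((T.obj X).obj Y).obj A) : ((T.obj X').obj Y').obj A :=
  (postHom T f g).app A t

lemma post_id {A : Vᵒᵖ} {X Y : V} (t : ((T.obj X).obj Y).obj A) :
    post T (𝟙 X) (𝟙 Y) t = t := by simp [post, postHom]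

lemma post_post {A : Vᵒᵖ} {X X' X'' Y Y' Y'' : V} (f : X ⟶ X') (g : Y ⟶ Y')
    (f' : X' ⟶ X'') (g' : Y' ⟶ Y'') (t : ((T.obj X).obj Y).obj A) :
    post T f' g' (post T f g t) = post T (f ≫ f') (g ≫ g') t := by
  have h : (T.obj X').map g ≫ (T.map f').app Y' = (T.map f').app Y ≫ (T.obj X'').map g :=
    (T.map f').naturality g
  have h2 := types_congr_hom (NatTrans.congr_app h A) (((T.map f).app Y).app A t)
  simp only [NatTrans.comp_app, types_comp_apply] at h2
  simp [post, postHom, h2]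

lemma map_post {A A' : Vᵒᵖ} {X X' Y Y' : V} (a : A ⟶ A') (f : X ⟶ X') (g : Y ⟶ Y')
    (t : ((T.obj X).obj Y).obj A) :
    ((T.obj X').obj Y').map a (post T f g t) = post T f g (((T.obj X).obj Y).map a t) :=
  ((postHom T f g).naturality_apply a t).symm

/-! ### The composite `𝕍(A; P ◁ Z) = ∫^U 𝕍(A; U ◁ Z) × P(U)`

As a coproduct over `U`, quotiented by the equivalence relation generated by dinaturality. For
`P = 𝕍(•; X ◁ Y)` this is `𝕍(A; (X ◁ Y) ◁ Z)`. -/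

/-- Representatives of elements of the coend. -/
structure NestLRep (P : Presheaf V) (Z : V) (A : Vᵒᵖ) where
  mid : V
  split : ((T.obj mid).obj Z).obj A
  arg : P.obj (op mid)

/-- Generating dinaturality relation of the coend. -/
inductive NestLRel (P : Presheaf V) (Z : V) (A : Vᵒᵖ) :
    NestLRep T P Z A → NestLRep T P Z A → Prop
  | dinat {U U' : V} (f : U ⟶ U') (t : ((T.obj U).obj Z).obj A) (p : P.obj (op U')) :
      NestLRel P Z A ⟨U', post T f (𝟙 Z) t, p⟩ ⟨U, t, P.map f.op p⟩

/-- The presheaf `𝕍(•; P ◁ Z)`. -/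
def nestL (P : Presheaf V) (Z : V) : Presheaf V where
  obj A := Quot (NestLRel T P Z A)
  map a := ↾Quot.map (fun r => ⟨r.mid, ((T.obj r.mid).obj Z).map a r.split, r.arg⟩) (by
    rintro _ _ ⟨f, t, p⟩
    simp only [map_post]
    exact NestLRel.dinat f _ p)
  map_id A := by ext ⟨r⟩; simp [Quot.map]
  map_comp a b := by ext ⟨r⟩; simp [Quot.map]

/-- The class of a pair `(t, p)` in `∫^U 𝕍(A; U ◁ Z) × P(U)`. -/
def nestLMk {P : Presheaf V} {Z U : V} {A : Vᵒᵖ} (t : ((T.obj U).obj Z).obj A)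
    (p : P.obj (op U)) : (nestL T P Z).obj A := Quot.mk _ ⟨U, t, p⟩

lemma nestLMk_dinat {P : Presheaf V} {Z U U' : V} {A : Vᵒᵖ} (f : U ⟶ U')
    (t : ((T.obj U).obj Z).obj A) (p : P.obj (op U')) :
    nestLMk T (post T f (𝟙 Z) t) p = nestLMk T t (P.map f.op p) :=
  Quot.sound (NestLRel.dinat f t p)

/-- Functoriality of `𝕍(•; P ◁ Z)` in `P` and `Z`. -/
def nestLMap {P P' : Presheaf V} {Z Z' : V} (φ : P ⟶ P') (h : Z ⟶ Z') :
    nestL T P Z ⟶ nestL T P' Z' where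
  app A := ↾Quot.map (fun r => ⟨r.mid, post T (𝟙 _) h r.split, φ.app _ r.arg⟩) (by
    rintro _ _ ⟨f, t, p⟩
    have := NestLRel.dinat (T := T) f (post T (𝟙 _) h t) (φ.app _ p)
    simpa [post_post, NatTrans.naturality_apply] using this)
  naturality A B a := by
    ext ⟨r⟩
    exact congr_arg (Quot.mk _) (by simp [map_post])

/-! ### The composite `𝕍(A; X ◁ Q) = ∫^W 𝕍(A; X ◁ W) × Q(W)` -/

/-- Representatives of elements of the coend. -/
structure NestRRep (X : V) (Q : Presheaf V) (A : Vᵒᵖ) where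
  mid : V
  split : ((T.obj X).obj mid).obj A
  arg : Q.obj (op mid)

/-- Generating dinaturality relation of the coend. -/
inductive NestRRel (X : V) (Q : Presheaf V) (A : Vᵒᵖ) :
    NestRRep T X Q A → NestRRep T X Q A → Prop
  | dinat {W W' : V} (g : W ⟶ W') (t : ((T.obj X).obj W).obj A) (q : Q.obj (op W')) :
      NestRRel X Q A ⟨W', post T (𝟙 X) g t, q⟩ ⟨W, t, Q.map g.op q⟩

/-- The presheaf `𝕍(•; X ◁ Q)`. -/
def nestR (X : V) (Q : Presheaf V) : Presheaf V where
  obj A := Quot (NestRRel T X Q A)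
  map a := ↾Quot.map (fun r => ⟨r.mid, ((T.obj X).obj r.mid).map a r.split, r.arg⟩) (by
    rintro _ _ ⟨g, t, q⟩
    simp only [map_post]
    exact NestRRel.dinat g _ q)
  map_id A := by ext ⟨r⟩; simp [Quot.map]
  map_comp a b := by ext ⟨r⟩; simp [Quot.map]

/-- The class of a pair `(t, q)` in `∫^W 𝕍(A; X ◁ W) × Q(W)`. -/
def nestRMk {X : V} {Q : Presheaf V} {W : V} {A : Vᵒᵖ} (t : ((T.obj X).obj W).obj A)
    (q : Q.obj (op W)) : (nestR T X Q).obj A := Quot.mk _ ⟨W, t, q⟩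

lemma nestRMk_dinat {X : V} {Q : Presheaf V} {W W' : V} {A : Vᵒᵖ} (g : W ⟶ W')
    (t : ((T.obj X).obj W).obj A) (q : Q.obj (op W')) :
    nestRMk T (post T (𝟙 X) g t) q = nestRMk T t (Q.map g.op q) :=
  Quot.sound (NestRRel.dinat g t q)

/-- Functoriality of `𝕍(•; X ◁ Q)` in `X` and `Q`. -/
def nestRMap {X X' : V} {Q Q' : Presheaf V} (f : X ⟶ X') (χ : Q ⟶ Q') :
    nestR T X Q ⟶ nestR T X' Q' where
  app A := ↾Quot.map (fun r => ⟨r.mid, post T f (𝟙 _) r.split, χ.app _ r.arg⟩) (by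
    rintro _ _ ⟨g, t, q⟩
    have := NestRRel.dinat (T := T) g (post T f (𝟙 _) t) (χ.app _ q)
    simpa [post_post, NatTrans.naturality_apply] using this)
  naturality A B a := by
    ext ⟨r⟩
    exact congr_arg (Quot.mk _) (by simp [map_post])

/-! ### The composite `𝕍(A; P ◁ Q) = ∫^{U,W} 𝕍(A; U ◁ W) × P(U) × Q(W)`

For `P = 𝕍(•; X ◁' Y)` and `Q = 𝕍(•; Z ◁' W)` this is the nested virtual structure
`𝕍(A; (X ◁' Y) ◁ (Z ◁' W))`. -/

/-- Representatives of elements of the coend. -/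
structure ConvRep (P Q : Presheaf V) (A : Vᵒᵖ) where
  left : V
  right : V
  split : ((T.obj left).obj right).obj A
  fst : P.obj (op left)
  snd : Q.obj (op right)

/-- Generating dinaturality relation of the coend. -/
inductive ConvRel (P Q : Presheaf V) (A : Vᵒᵖ) : ConvRep T P Q A → ConvRep T P Q A → Prop
  | dinat {U U' W W' : V} (f : U ⟶ U') (g : W ⟶ W') (t : ((T.obj U).obj W).obj A)
      (p : P.obj (op U')) (q : Q.obj (op W')) :
      ConvRel P Q A ⟨U', W', post T f g t, p, q⟩ ⟨U, W, t, P.map f.op p, Q.map g.op q⟩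

/-- The presheaf `𝕍(•; P ◁ Q)`. -/
def conv (P Q : Presheaf V) : Presheaf V where
  obj A := Quot (ConvRel T P Q A)
  map a := ↾Quot.map
    (fun r => ⟨r.left, r.right, ((T.obj r.left).obj r.right).map a r.split, r.fst, r.snd⟩) (by
      rintro _ _ ⟨f, g, t, p, q⟩
      simp only [map_post]
      exact ConvRel.dinat f g _ p q)
  map_id A := by ext ⟨r⟩; simp [Quot.map]
  map_comp a b := by ext ⟨r⟩; simp [Quot.map]

/-- The class of a triple `(t, p, q)` in `∫^{U,W} 𝕍(A; U ◁ W) × P(U) × Q(W)`. -/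
def convMk {P Q : Presheaf V} {U W : V} {A : Vᵒᵖ} (t : ((T.obj U).obj W).obj A)
    (p : P.obj (op U)) (q : Q.obj (op W)) : (conv T P Q).obj A := Quot.mk _ ⟨U, W, t, p, q⟩

lemma convMk_dinat {P Q : Presheaf V} {U U' W W' : V} {A : Vᵒᵖ} (f : U ⟶ U') (g : W ⟶ W')
    (t : ((T.obj U).obj W).obj A) (p : P.obj (op U')) (q : Q.obj (op W')) :
    convMk T (post T f g t) p q = convMk T t (P.map f.op p) (Q.map g.op q) :=
  Quot.sound (ConvRel.dinat f g t p q)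

lemma convMk_dinat_left {P Q : Presheaf V} {U U' W : V} {A : Vᵒᵖ} (f : U ⟶ U')
    (t : ((T.obj U).obj W).obj A) (p : P.obj (op U')) (q : Q.obj (op W)) :
    convMk T (post T f (𝟙 W) t) p q = convMk T t (P.map f.op p) q := by
  simpa using convMk_dinat T f (𝟙 W) t p q

lemma convMk_dinat_right {P Q : Presheaf V} {U W W' : V} {A : Vᵒᵖ} (g : W ⟶ W')
    (t : ((T.obj U).obj W).obj A) (p : P.obj (op U)) (q : Q.obj (op W')) :
    convMk T (post T (𝟙 U) g t) p q = convMk T t p (Q.map g.op q) := by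
  simpa using convMk_dinat T (𝟙 U) g t p q

lemma map_convMk {P Q : Presheaf V} {U W : V} {A B : Vᵒᵖ} (a : A ⟶ B)
    (t : ((T.obj U).obj W).obj A) (p : P.obj (op U)) (q : Q.obj (op W)) :
    (conv T P Q).map a (convMk T t p q) = convMk T (((T.obj U).obj W).map a t) p q := rfl

/-- Functoriality of `𝕍(•; P ◁ Q)` in `P` and `Q`. -/
def convMap {P P' Q Q' : Presheaf V} (φ : P ⟶ P') (χ : Q ⟶ Q') :
    conv T P Q ⟶ conv T P' Q' where
  app A := ↾Quot.map
    (fun r => ⟨r.left, r.right, r.split, φ.app _ r.fst, χ.app _ r.snd⟩) (by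
      rintro _ _ ⟨f, g, t, p, q⟩
      simpa [NatTrans.naturality_apply] using
        ConvRel.dinat (T := T) f g t (φ.app _ p) (χ.app _ q))
  naturality A B a := by ext ⟨r⟩; rfl

end

/-! ### Promonoidal categories -/

/-- The data of a promonoidal structure on `V` with split profunctor `T` and unit profunctor `N`:
natural isomorphisms
`α : 𝕍(•; (X ◁ Y) ◁ Z) ≅ 𝕍(•; X ◁ (Y ◁ Z))`, `λ : 𝕍(•; N ◁ Y) ≅ 𝕍(•; Y)`,
`ρ : 𝕍(•; X ◁ N) ≅ 𝕍(•; X)`. -/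
structure PromonoidalData (T : Protensor V) (N : Presheaf V) where
  assoc (X Y Z : V) : nestL T ((T.obj X).obj Y) Z ≅ nestR T X ((T.obj Y).obj Z)
  assoc_natural {X X' Y Y' Z Z' : V} (f : X ⟶ X') (g : Y ⟶ Y') (h : Z ⟶ Z') :
    nestLMap T (postHom T f g) h ≫ (assoc X' Y' Z').hom =
      (assoc X Y Z).hom ≫ nestRMap T f (postHom T g h)
  leftUnitor (Y : V) : nestL T N Y ≅ uliftYoneda.{u}.obj Y
  leftUnitor_natural {Y Y' : V} (g : Y ⟶ Y') :
    nestLMap T (𝟙 N) g ≫ (leftUnitor Y').hom = (leftUnitor Y).hom ≫ uliftYoneda.{u}.map g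
  rightUnitor (X : V) : nestR T X N ≅ uliftYoneda.{u}.obj X
  rightUnitor_natural {X X' : V} (f : X ⟶ X') :
    nestRMap T f (𝟙 N) ≫ (rightUnitor X').hom = (rightUnitor X).hom ≫ uliftYoneda.{u}.map f

namespace PromonoidalData

variable {T : Protensor V} {N : Presheaf V} (S : PromonoidalData T N)

lemma assoc_post {A : Vᵒᵖ} {X X' Y Y' Z Z' U : V} (f : X ⟶ X') (g : Y ⟶ Y') (h : Z ⟶ Z')
    (s : ((T.obj U).obj Z).obj A) (t : ((T.obj X).obj Y).obj (op U)) :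
    (S.assoc X' Y' Z').hom.app A (nestLMk T (post T (𝟙 U) h s) (post T f g t)) =
      (nestRMap T f (postHom T g h)).app A ((S.assoc X Y Z).hom.app A (nestLMk T s t)) :=
  types_congr_hom (NatTrans.congr_app (S.assoc_natural f g h) A) (nestLMk T s t)

/-- Substitution of `p`, `q`, `r` for the three covariant objects: the map
`𝕍(•; X ◁ (Y ◁ Z)) → 𝕍(•; P ◁ (Q ◁ R))`. -/
def assocPush {P Q R : Presheaf V} {X Y Z : V} (p : P.obj (op X)) (q : Q.obj (op Y))
    (r : R.obj (op Z)) : nestR T X ((T.obj Y).obj Z) ⟶ conv T P (conv T Q R) where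
  app A := ↾Quot.lift (fun k => convMk T k.split p (convMk T k.arg q r)) (by
    rintro _ _ ⟨g, s, t⟩
    exact convMk_dinat_right T g s p (convMk T t q r))
  naturality A B a := by ext ⟨k⟩; rfl

lemma assocPush_assoc_post {P Q R : Presheaf V} {A : Vᵒᵖ} {X X' Y Y' Z Z' U : V}
    (f : X ⟶ X') (g : Y ⟶ Y') (h : Z ⟶ Z')
    (s : ((T.obj U).obj Z).obj A) (t : ((T.obj X).obj Y).obj (op U))
    (p : P.obj (op X')) (q : Q.obj (op Y')) (r : R.obj (op Z')) :
    (assocPush p q r).app A ((S.assoc X' Y' Z').hom.app A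
        (nestLMk T (post T (𝟙 U) h s) (post T f g t))) =
      (assocPush (P.map f.op p) (Q.map g.op q) (R.map h.op r)).app A
        ((S.assoc X Y Z).hom.app A (nestLMk T s t)) := by
  rw [assoc_post]
  obtain ⟨k⟩ := (S.assoc X Y Z).hom.app A (nestLMk T s t)
  change convMk T (post T f (𝟙 _) k.split) p (convMk T (post T g h k.arg) q r) =
    convMk T k.split (P.map f.op p) (convMk T k.arg _ _)
  rw [convMk_dinat_left, convMk_dinat]

/-- The associator at virtual arguments, `𝕍(•; (P ◁ Q) ◁ R) → 𝕍(•; P ◁ (Q ◁ R))`. It applies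
`α` to the two splits of a representative and keeps the elements of `P`, `Q`, `R`. -/
def assocConv (P Q R : Presheaf V) : conv T (conv T P Q) R ⟶ conv T P (conv T Q R) where
  app A := ↾Quot.lift (fun k => Quot.lift
      (fun j : ConvRep T P Q (op k.left) => (assocPush j.fst j.snd k.snd).app A
        ((S.assoc j.left j.right k.right).hom.app A (nestLMk T k.split j.split)))
      (by
        rintro _ _ ⟨f, g, t, p, q⟩
        have := S.assocPush_assoc_post f g (𝟙 _) k.split t p q k.snd
        rw [post_id] at this
        simpa using this)
      k.fst) (by
    rintro _ _ ⟨f, g, s, ⟨j⟩, r⟩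
    have := S.assocPush_assoc_post (𝟙 _) (𝟙 _) g s (((T.obj j.left).obj j.right).map f.op j.split)
      j.fst j.snd r
    rw [post_id, ← nestLMk_dinat, post_post] at this
    change (assocPush j.fst j.snd r).app A
        ((S.assoc j.left j.right _).hom.app A (nestLMk T (post T f g s) j.split)) =
      (assocPush j.fst j.snd (R.map g.op r)).app A
        ((S.assoc j.left j.right _).hom.app A
          (nestLMk T s (((T.obj j.left).obj j.right).map f.op j.split)))
    simpa using this)
  naturality A B a := by
    ext ⟨⟨U, W, s, ⟨j⟩, r⟩⟩
    change (assocPush j.fst j.snd r).app B ((S.assoc _ _ _).hom.app B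
      ((nestL T _ _).map a (nestLMk T s j.split))) = (conv T P (conv T Q R)).map a
        ((assocPush j.fst j.snd r).app A ((S.assoc _ _ _).hom.app A (nestLMk T s j.split)))
    simp only [NatTrans.naturality_apply]

/-- The left unitor at a virtual argument, `𝕍(•; N ◁ P) → P`: it sends `(s, n, p)` to the action
of the morphism `λ(s, n)` on `p`. -/
def leftUnitorConv (P : Presheaf V) : conv T N P ⟶ P where
  app A := ↾Quot.lift
    (fun k => P.map ((S.leftUnitor k.right).hom.app A (nestLMk T k.split k.fst)).down.op k.snd)
    (by
      rintro _ _ ⟨f, g, s, n, p⟩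
      have h : post T f g s = post T f (𝟙 _) (post T (𝟙 _) g s) := by simp [post_post]
      have h2 : (S.leftUnitor _).hom.app A (nestLMk T (post T (𝟙 _) g s) (N.map f.op n)) = _ :=
        types_congr_hom (NatTrans.congr_app (S.leftUnitor_natural g) A)
          (nestLMk T s (N.map f.op n))
      simp only [h, nestLMk_dinat, h2]
      simp)
  naturality A B a := by
    ext ⟨⟨U, W, s, n, p⟩⟩
    change P.map ((S.leftUnitor _).hom.app B ((nestL T N _).map a (nestLMk T s n))).down.op p =
      P.map a (P.map ((S.leftUnitor _).hom.app A (nestLMk T s n)).down.op p)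
    simp [NatTrans.naturality_apply]

/-- The right unitor at a virtual argument, `𝕍(•; P ◁ N) → P`. -/
def rightUnitorConv (P : Presheaf V) : conv T P N ⟶ P where
  app A := ↾Quot.lift
    (fun k => P.map ((S.rightUnitor k.left).hom.app A (nestRMk T k.split k.snd)).down.op k.fst)
    (by
      rintro _ _ ⟨f, g, s, p, n⟩
      have h : post T f g s = post T (𝟙 _) g (post T f (𝟙 _) s) := by simp [post_post]
      have h2 : (S.rightUnitor _).hom.app A (nestRMk T (post T f (𝟙 _) s) (N.map g.op n)) = _ :=
        types_congr_hom (NatTrans.congr_app (S.rightUnitor_natural f) A)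
          (nestRMk T s (N.map g.op n))
      simp only [h, nestRMk_dinat, h2]
      simp)
  naturality A B a := by
    ext ⟨⟨U, W, s, p, n⟩⟩
    change P.map ((S.rightUnitor _).hom.app B ((nestR T _ N).map a (nestRMk T s n))).down.op p =
      P.map a (P.map ((S.rightUnitor _).hom.app A (nestRMk T s n)).down.op p)
    simp [NatTrans.naturality_apply]

end PromonoidalData

/-- A promonoidal structure: pentagon and triangle equations hold. As everywhere below, the
equations are stated for all nested virtual arguments, an object `X` of `V` being the special case
of the representable presheaf `𝕍(•; X)`. -/
structure Promonoidal (T : Protensor V) (N : Presheaf V) extends PromonoidalData T N where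
  pentagon (P Q R S : Presheaf V) :
    toPromonoidalData.assocConv (conv T P Q) R S ≫ toPromonoidalData.assocConv P Q (conv T R S) =
      convMap T (toPromonoidalData.assocConv P Q R) (𝟙 S) ≫
        toPromonoidalData.assocConv P (conv T Q R) S ≫
          convMap T (𝟙 P) (toPromonoidalData.assocConv Q R S)
  triangle (P Q : Presheaf V) :
    toPromonoidalData.assocConv P N Q ≫ convMap T (𝟙 P) (toPromonoidalData.leftUnitorConv Q) =
      convMap T (toPromonoidalData.rightUnitorConv P) (𝟙 Q)

/-- The data of a produoidal structure on `V`: a parallel promonoidal structure `(Tp, I)`, written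
`⊗`, a sequential promonoidal structure `(Ts, N)`, written `◁`, and natural laxators
`ψ₂ : 𝕍(•; (X ◁ Y) ⊗ (Z ◁ W)) → 𝕍(•; (X ⊗ Z) ◁ (Y ⊗ W))`, `ψ₀ : 𝕍(•; I) → 𝕍(•; I ◁ I)`,
`φ₂ : 𝕍(•; N ⊗ N) → 𝕍(•; N)`, `φ₀ : 𝕍(•; I) → 𝕍(•; N)`. -/
structure ProduoidalData (Tp : Protensor V) (I : Presheaf V) (Ts : Protensor V) (N : Presheaf V)
    where
  par : Promonoidal Tp I
  seq : Promonoidal Ts N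
  psi₂ (X Y Z W : V) :
    conv Tp ((Ts.obj X).obj Y) ((Ts.obj Z).obj W) ⟶ conv Ts ((Tp.obj X).obj Z) ((Tp.obj Y).obj W)
  psi₂_natural {X X' Y Y' Z Z' W W' : V} (f : X ⟶ X') (g : Y ⟶ Y') (h : Z ⟶ Z') (k : W ⟶ W') :
    convMap Tp (postHom Ts f g) (postHom Ts h k) ≫ psi₂ X' Y' Z' W' =
      psi₂ X Y Z W ≫ convMap Ts (postHom Tp f h) (postHom Tp g k)
  psi₀ : I ⟶ conv Ts I I
  phi₂ : conv Tp N N ⟶ N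
  phi₀ : I ⟶ N

namespace ProduoidalData

variable {Tp : Protensor V} {I : Presheaf V} {Ts : Protensor V} {N : Presheaf V}
  (S : ProduoidalData Tp I Ts N)

/-- Substitution of `p`, `q`, `r`, `s` for the four covariant objects. -/
def psi₂Push {Tp Ts : Protensor V} {P Q R S : Presheaf V} {X Y Z W : V} (p : P.obj (op X))
    (q : Q.obj (op Y)) (r : R.obj (op Z)) (s : S.obj (op W)) :
    conv Ts ((Tp.obj X).obj Z) ((Tp.obj Y).obj W) ⟶ conv Ts (conv Tp P R) (conv Tp Q S) where
  app A := ↾Quot.lift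
    (fun k => convMk Ts k.split (convMk Tp k.fst p r) (convMk Tp k.snd q s)) (by
      rintro _ _ ⟨f, g, t, a, b⟩
      exact convMk_dinat Ts f g t (convMk Tp a p r) (convMk Tp b q s))
  naturality A B a := by ext ⟨k⟩; rfl

lemma psi₂Push_post {P Q R T : Presheaf V} {A : Vᵒᵖ} {X X' Y Y' Z Z' W W' U K : V}
    (f : X ⟶ X') (g : Y ⟶ Y') (h : Z ⟶ Z') (k : W ⟶ W')
    (t : ((Tp.obj U).obj K).obj A) (a : ((Ts.obj X).obj Y).obj (op U))
    (b : ((Ts.obj Z).obj W).obj (op K))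
    (p : P.obj (op X')) (q : Q.obj (op Y')) (r : R.obj (op Z')) (s : T.obj (op W')) :
    (psi₂Push p q r s).app A ((S.psi₂ X' Y' Z' W').app A
        (convMk Tp t (post Ts f g a) (post Ts h k b))) =
      (psi₂Push (P.map f.op p) (Q.map g.op q) (R.map h.op r) (T.map k.op s)).app A
        ((S.psi₂ X Y Z W).app A (convMk Tp t a b)) := by
  have := types_congr_hom (NatTrans.congr_app (S.psi₂_natural f g h k) A) (convMk Tp t a b)
  change (S.psi₂ X' Y' Z' W').app A (convMk Tp t (post Ts f g a) (post Ts h k b)) =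
    (convMap Ts (postHom Tp f h) (postHom Tp g k)).app A
      ((S.psi₂ X Y Z W).app A (convMk Tp t a b)) at this
  rw [this]
  obtain ⟨j⟩ := (S.psi₂ X Y Z W).app A (convMk Tp t a b)
  change convMk Ts j.split (convMk Tp (post Tp f h j.fst) p r)
      (convMk Tp (post Tp g k j.snd) q s) =
    convMk Ts j.split (convMk Tp j.fst _ _) (convMk Tp j.snd _ _)
  rw [convMk_dinat, convMk_dinat]

/-- The laxator `ψ₂` at virtual arguments,
`𝕍(•; (P ◁ Q) ⊗ (R ◁ T)) → 𝕍(•; (P ⊗ R) ◁ (Q ⊗ T))`. -/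
def psi₂Conv (P Q R T : Presheaf V) :
    conv Tp (conv Ts P Q) (conv Ts R T) ⟶ conv Ts (conv Tp P R) (conv Tp Q T) where
  app A := ↾Quot.lift (fun k => Quot.lift₂
      (fun (i : ConvRep Ts P Q (op k.left)) (j : ConvRep Ts R T (op k.right)) =>
        (psi₂Push i.fst i.snd j.fst j.snd).app A
          ((S.psi₂ i.left i.right j.left j.right).app A (convMk Tp k.split i.split j.split)))
      (by
        rintro i _ _ ⟨f, g, t, p, q⟩
        have := S.psi₂Push_post (𝟙 _) (𝟙 _) f g k.split i.split t i.fst i.snd p q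
        rw [post_id] at this
        simpa using this)
      (by
        rintro _ _ j ⟨f, g, t, p, q⟩
        have := S.psi₂Push_post f g (𝟙 _) (𝟙 _) k.split t j.split p q j.fst j.snd
        rw [post_id] at this
        simpa using this)
      k.fst k.snd) (by
    rintro _ _ ⟨f, g, s, ⟨i⟩, ⟨j⟩⟩
    exact congr_arg (fun x => (psi₂Push i.fst i.snd j.fst j.snd).app A
      ((S.psi₂ i.left i.right j.left j.right).app A x)) (convMk_dinat Tp f g s i.split j.split))
  naturality A B a := by
    ext ⟨⟨U, W, s, ⟨i⟩, ⟨j⟩⟩⟩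
    change (psi₂Push i.fst i.snd j.fst j.snd).app B ((S.psi₂ _ _ _ _).app B
        ((conv Tp _ _).map a (convMk Tp s i.split j.split))) = (conv Ts _ _).map a
      ((psi₂Push i.fst i.snd j.fst j.snd).app A
        ((S.psi₂ _ _ _ _).app A (convMk Tp s i.split j.split)))
    simp only [NatTrans.naturality_apply]

end ProduoidalData

/-- A produoidal structure on `V`: the data above, subject to the coherence equations of a duoidal
category. -/
structure ProduoidalStructure (Tp : Protensor V) (I : Presheaf V) (Ts : Protensor V)
    (N : Presheaf V) extends ProduoidalData Tp I Ts N where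
  psi₂_assoc_par (P Q R S T U : Presheaf V) :
    par.assocConv (conv Ts P Q) (conv Ts R S) (conv Ts T U) ≫
        convMap Tp (𝟙 _) (toProduoidalData.psi₂Conv R S T U) ≫
          toProduoidalData.psi₂Conv P Q (conv Tp R T) (conv Tp S U) =
      convMap Tp (toProduoidalData.psi₂Conv P Q R S) (𝟙 _) ≫
        toProduoidalData.psi₂Conv (conv Tp P R) (conv Tp Q S) T U ≫
          convMap Ts (par.assocConv P R T) (par.assocConv Q S U)
  psi₂_assoc_seq (P Q R S T U : Presheaf V) :
    convMap Tp (seq.assocConv P Q R) (seq.assocConv S T U) ≫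
        toProduoidalData.psi₂Conv P (conv Ts Q R) S (conv Ts T U) ≫
          convMap Ts (𝟙 _) (toProduoidalData.psi₂Conv Q R T U) =
      toProduoidalData.psi₂Conv (conv Ts P Q) R (conv Ts S T) U ≫
        convMap Ts (toProduoidalData.psi₂Conv P Q S T) (𝟙 _) ≫
          seq.assocConv (conv Tp P S) (conv Tp Q T) (conv Tp R U)
  par_left_unit (P Q : Presheaf V) :
    convMap Tp psi₀ (𝟙 _) ≫ toProduoidalData.psi₂Conv I I P Q ≫
        convMap Ts (par.leftUnitorConv P) (par.leftUnitorConv Q) =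
      par.leftUnitorConv (conv Ts P Q)
  par_right_unit (P Q : Presheaf V) :
    convMap Tp (𝟙 _) psi₀ ≫ toProduoidalData.psi₂Conv P Q I I ≫
        convMap Ts (par.rightUnitorConv P) (par.rightUnitorConv Q) =
      par.rightUnitorConv (conv Ts P Q)
  seq_left_unit (P Q : Presheaf V) :
    toProduoidalData.psi₂Conv N P N Q ≫ convMap Ts phi₂ (𝟙 _) ≫
        seq.leftUnitorConv (conv Tp P Q) =
      convMap Tp (seq.leftUnitorConv P) (seq.leftUnitorConv Q)
  seq_right_unit (P Q : Presheaf V) :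
    toProduoidalData.psi₂Conv P N Q N ≫ convMap Ts (𝟙 _) phi₂ ≫
        seq.rightUnitorConv (conv Tp P Q) =
      convMap Tp (seq.rightUnitorConv P) (seq.rightUnitorConv Q)
  phi₂_assoc :
    par.assocConv N N N ≫ convMap Tp (𝟙 N) phi₂ ≫ phi₂ = convMap Tp phi₂ (𝟙 N) ≫ phi₂
  psi₀_coassoc :
    psi₀ ≫ convMap Ts psi₀ (𝟙 I) ≫ seq.assocConv I I I = psi₀ ≫ convMap Ts (𝟙 I) psi₀
  phi_unit_left : convMap Tp phi₀ (𝟙 N) ≫ phi₂ = par.leftUnitorConv N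
  phi_unit_right : convMap Tp (𝟙 N) phi₀ ≫ phi₂ = par.rightUnitorConv N
  psi_counit_left : psi₀ ≫ convMap Ts phi₀ (𝟙 I) ≫ seq.leftUnitorConv I = 𝟙 I
  psi_counit_right : psi₀ ≫ convMap Ts (𝟙 I) phi₀ ≫ seq.rightUnitorConv I = 𝟙 I

/-- A produoidal category is normal if `φ₀ : 𝕍(•; I) → 𝕍(•; N)` is an isomorphism. -/
def ProduoidalStructure.IsNormal {Tp : Protensor V} {I : Presheaf V} {Ts : Protensor V}
    {N : Presheaf V} (S : ProduoidalStructure Tp I Ts N) : Prop := IsIso S.phi₀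

end Coends
end Produoidal

/-- Objects of the category of monoidal contexts: pairs of objects of `C`. -/
structure MCtx (C : Type u) where
  dom : C
  cod : C

namespace MCtx

variable {C : Type u} [Category.{v} C] [MonoidalCategory C]

/-- `m ⊗ id_X ⊗ n`. -/
def side {M M' N N' : C} (m : M ⟶ M') (X : C) (n : N ⟶ N') : M ⊗ X ⊗ N ⟶ M' ⊗ X ⊗ N' :=
  m ⊗ₘ 𝟙 X ⊗ₘ n

/-- `m ⊗ id_X ⊗ n ⊗ id_Y ⊗ o`. -/
def side₂ {M M' N N' O O' : C} (m : M ⟶ M') (X : C) (n : N ⟶ N') (Y : C) (o : O ⟶ O') :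
    M ⊗ X ⊗ N ⊗ Y ⊗ O ⟶ M' ⊗ X ⊗ N' ⊗ Y ⊗ O' :=
  m ⊗ₘ 𝟙 X ⊗ₘ n ⊗ₘ 𝟙 Y ⊗ₘ o

lemma side_eq {M M' N N' : C} (m : M ⟶ M') (X : C) (n : N ⟶ N') :
    side m X n = m ▷ _ ≫ M' ◁ X ◁ n := by
  simp [side, MonoidalCategory.tensorHom_def, -whiskerRight_tensor]

lemma side₂_eq {M M' N N' O O' : C} (m : M ⟶ M') (X : C) (n : N ⟶ N') (Y : C) (o : O ⟶ O') :
    side₂ m X n Y o = m ▷ _ ≫ M' ◁ X ◁ (n ▷ _ ≫ N' ◁ Y ◁ o) := by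
  simp [side₂, MonoidalCategory.tensorHom_def, -whiskerRight_tensor]

lemma side_comm {M M' N N' X Y : C} (m : M ⟶ M') (n : N ⟶ N') (h : X ⟶ Y) :
    side m X n ≫ M' ◁ h ▷ N' = M ◁ h ▷ N ≫ side m Y n := by
  simp [side, ← id_tensorHom, ← tensorHom_id]

lemma side₂_comm_left {M M' N N' O O' X Y Z : C} (m : M ⟶ M') (n : N ⟶ N') (o : O ⟶ O')
    (h : X ⟶ Y) :
    side₂ m X n Z o ≫ M' ◁ h ▷ (N' ⊗ Z ⊗ O') = M ◁ h ▷ (N ⊗ Z ⊗ O) ≫ side₂ m Y n Z o := by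
  simp [side₂, ← id_tensorHom, ← tensorHom_id]

lemma side₂_comm_right {M M' N N' O O' X Y Z : C} (m : M ⟶ M') (n : N ⟶ N') (o : O ⟶ O')
    (h : X ⟶ Y) :
    side₂ m Z n X o ≫ M' ◁ Z ◁ N' ◁ h ▷ O' = M ◁ Z ◁ N ◁ h ▷ O ≫ side₂ m Z n Y o := by
  simp [side₂, ← id_tensorHom, ← tensorHom_id]

lemma side_comm_assoc {M M' N N' X Y T : C} (m : M ⟶ M') (n : N ⟶ N') (h : X ⟶ Y)
    (k : M' ⊗ Y ⊗ N' ⟶ T) :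
    side m X n ≫ M' ◁ h ▷ N' ≫ k = M ◁ h ▷ N ≫ side m Y n ≫ k := by
  rw [← Category.assoc, side_comm, Category.assoc]

lemma side₂_comm_left_assoc {M M' N N' O O' X Y Z T : C} (m : M ⟶ M') (n : N ⟶ N') (o : O ⟶ O')
    (h : X ⟶ Y) (k : M' ⊗ Y ⊗ N' ⊗ Z ⊗ O' ⟶ T) :
    side₂ m X n Z o ≫ M' ◁ h ▷ (N' ⊗ Z ⊗ O') ≫ k =
      M ◁ h ▷ (N ⊗ Z ⊗ O) ≫ side₂ m Y n Z o ≫ k := by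
  rw [← Category.assoc, side₂_comm_left, Category.assoc]

lemma side₂_comm_right_assoc {M M' N N' O O' X Y Z T : C} (m : M ⟶ M') (n : N ⟶ N')
    (o : O ⟶ O') (h : X ⟶ Y) (k : M' ⊗ Z ⊗ N' ⊗ Y ⊗ O' ⟶ T) :
    side₂ m Z n X o ≫ M' ◁ Z ◁ N' ◁ h ▷ O' ≫ k =
      M ◁ Z ◁ N ◁ h ▷ O ≫ side₂ m Z n Y o ≫ k := by
  rw [← Category.assoc, side₂_comm_right, Category.assoc]

/-! ### Contexts -/

/-- Representatives `f ⨾ (M ⊗ ■ ⊗ N) ⨾ g` of monoidal contexts. -/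
structure HomRep (A X : MCtx C) where
  {M : C}
  {N : C}
  f : A.dom ⟶ M ⊗ X.dom ⊗ N
  g : M ⊗ X.cod ⊗ N ⟶ A.cod

/-- Dinaturality in `M` and `N`. -/
inductive HomRel (A X : MCtx C) : HomRep A X → HomRep A X → Prop
  | dinat {M M' N N' : C} (m : M ⟶ M') (n : N ⟶ N')
      (f : A.dom ⟶ M ⊗ X.dom ⊗ N) (g : M' ⊗ X.cod ⊗ N' ⟶ A.cod) :
      HomRel A X ⟨f ≫ side m X.dom n, g⟩ ⟨f, side m X.cod n ≫ g⟩

/-- Monoidal contexts `∫^{M,N} C(A; M ⊗ X ⊗ N) × C(M ⊗ X' ⊗ N; A')` from `(A, A')` with a hole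
`(X, X')`. -/
def Ctx (A X : MCtx C) := Quot (HomRel A X)

lemma HomRel.of_eq {A X : MCtx C} {M M' N N' : C} (m : M ⟶ M') (n : N ⟶ N')
    {f : A.dom ⟶ M ⊗ X.dom ⊗ N} {g : M' ⊗ X.cod ⊗ N' ⟶ A.cod}
    {f' : A.dom ⟶ M' ⊗ X.dom ⊗ N'} {g' : M ⊗ X.cod ⊗ N ⟶ A.cod}
    (hf : f' = f ≫ side m X.dom n) (hg : g' = side m X.cod n ≫ g) :
    HomRel A X ⟨f', g⟩ ⟨f, g'⟩ := by
  subst hf hg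
  exact .dinat m n f g

/-- The composite `f ⨾ (M ⊗ h ⊗ N) ⨾ ((M ⊗ P) ⊗ ■ ⊗ (Q ⊗ N)) ⨾ (M ⊗ k ⊗ N) ⨾ g` of
`f ⨾ (M ⊗ ■ ⊗ N) ⨾ g` and `h ⨾ (P ⊗ ■ ⊗ Q) ⨾ k`. Here `⊗≫` is composition up to the canonical
associativity and unit isomorphisms. -/
def HomRep.comp {A X Y : MCtx C} (r : HomRep A X) (s : HomRep X Y) : HomRep A Y where
  M := r.M ⊗ s.M
  N := s.N ⊗ r.N
  f := r.f ≫ r.M ◁ s.f ▷ r.N ⊗≫ 𝟙 _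
  g := 𝟙 _ ⊗≫ r.M ◁ s.g ▷ r.N ≫ r.g

/-- Composition of monoidal contexts. -/
def Ctx.comp {A X Y : MCtx C} : Ctx A X → Ctx X Y → Ctx A Y :=
  Quot.map₂ HomRep.comp
    (by
      rintro r _ _ ⟨m, n, f, g⟩
      refine HomRel.of_eq (r.M ◁ m) (n ▷ r.N) ?_ ?_
      · simp only [side_eq, monoidalComp]; monoidal
      · simp only [side_eq, monoidalComp]; monoidal)
    (by
      rintro _ _ s ⟨m, n, f, g⟩
      refine HomRel.of_eq (m ▷ s.M) (s.N ◁ n) ?_ ?_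
      · simp only [monoidalComp, Category.assoc, side_comm_assoc]
        simp only [side_eq]; monoidal
      · simp only [monoidalComp, ← side_comm_assoc]
        simp only [side_eq]; monoidal)

/-- The category of monoidal contexts. -/
instance : Category (MCtx C) where
  Hom A X := Ctx A X
  id A := Quot.mk _ ⟨𝟙 _ ⊗≫ 𝟙 (𝟙_ C ⊗ A.dom ⊗ 𝟙_ C), 𝟙 (𝟙_ C ⊗ A.cod ⊗ 𝟙_ C) ⊗≫ 𝟙 _⟩
  comp := Ctx.comp
  id_comp := by
    rintro A X ⟨r⟩
    refine Quot.sound (HomRel.of_eq (λ_ r.M).inv (ρ_ r.N).inv ?_ ?_) <;>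
      simp only [side_eq, monoidalComp] <;> monoidal
  comp_id := by
    rintro A X ⟨r⟩
    refine Quot.sound (HomRel.of_eq (ρ_ r.M).inv (λ_ r.N).inv ?_ ?_) <;>
      simp only [side_eq, monoidalComp] <;> monoidal
  assoc := by
    rintro A X Y Z ⟨r⟩ ⟨s⟩ ⟨t⟩
    refine Quot.sound (HomRel.of_eq (α_ r.M s.M t.M).inv (α_ t.N s.N r.N).hom ?_ ?_) <;>
      simp only [HomRep.comp, side_eq, monoidalComp] <;> monoidal

/-- The monoidal context `f ⨾ (M ⊗ ■ ⊗ N) ⨾ g`. -/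
def ctx {A X : MCtx C} {M N : C} (f : A.dom ⟶ M ⊗ X.dom ⊗ N) (g : M ⊗ X.cod ⊗ N ⟶ A.cod) :
    A ⟶ X := Quot.mk _ ⟨f, g⟩

/-! ### Units -/

/-- Filling the hole of a monoidal context with a morphism `h`: `f ⨾ (M ⊗ h ⊗ N) ⨾ g`. -/
def fill {A X : MCtx C} (h : X.dom ⟶ X.cod) : Ctx A X → (A.dom ⟶ A.cod) :=
  Quot.lift (fun r => r.f ≫ r.M ◁ h ▷ r.N ≫ r.g) (by
    rintro _ _ ⟨m, n, f, g⟩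
    simp only [Category.assoc, side_comm_assoc])

/-- The unit profunctor `(A, A') ↦ C(A; A')`. -/
def unit (C : Type u) [Category.{v} C] [MonoidalCategory C] : (MCtx C)ᵒᵖ ⥤ Type (max u v) where
  obj A := ULift.{u} (A.unop.dom ⟶ A.unop.cod)
  map c := ↾fun h => ⟨fill h.down c.unop⟩
  map_id A := by
    ext ⟨h⟩
    change (𝟙 A.unop.dom ⊗≫ 𝟙 (𝟙_ C ⊗ A.unop.dom ⊗ 𝟙_ C)) ≫ 𝟙_ C ◁ h ▷ 𝟙_ C ≫
      (𝟙 (𝟙_ C ⊗ A.unop.cod ⊗ 𝟙_ C) ⊗≫ 𝟙 A.unop.cod) = h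
    simp only [monoidalComp]; monoidal
  map_comp := by
    rintro A B D ⟨⟨c⟩⟩ ⟨⟨d⟩⟩
    ext ⟨h⟩
    change (d.f ≫ d.M ◁ c.f ▷ d.N ⊗≫ 𝟙 ((d.M ⊗ c.M) ⊗ A.unop.dom ⊗ c.N ⊗ d.N)) ≫
      (d.M ⊗ c.M) ◁ h ▷ (c.N ⊗ d.N) ≫
        (𝟙 ((d.M ⊗ c.M) ⊗ A.unop.cod ⊗ c.N ⊗ d.N) ⊗≫ d.M ◁ c.g ▷ d.N ≫ d.g) =
      d.f ≫ d.M ◁ (c.f ≫ c.M ◁ h ▷ c.N ≫ c.g) ▷ d.N ≫ d.g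
    simp only [monoidalComp]; monoidal

/-! ### Sequential splits -/

/-- Representatives `f ⨾ (M ⊗ ■ ⊗ N) ⨾ g ⨾ (K ⊗ ■ ⊗ L) ⨾ h` of sequential splits. -/
structure SeqRep (A X Y : MCtx C) where
  {M : C}
  {N : C}
  {K : C}
  {L : C}
  f : A.dom ⟶ M ⊗ X.dom ⊗ N
  g : M ⊗ X.cod ⊗ N ⟶ K ⊗ Y.dom ⊗ L
  h : K ⊗ Y.cod ⊗ L ⟶ A.cod

/-- Dinaturality in `M`, `N`, `K`, `L`. -/
inductive SeqRel (A X Y : MCtx C) : SeqRep A X Y → SeqRep A X Y → Prop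
  | dinat {M M' N N' K K' L L' : C} (m : M ⟶ M') (n : N ⟶ N') (k : K ⟶ K') (l : L ⟶ L')
      (f : A.dom ⟶ M ⊗ X.dom ⊗ N) (g : M' ⊗ X.cod ⊗ N' ⟶ K ⊗ Y.dom ⊗ L)
      (h : K' ⊗ Y.cod ⊗ L' ⟶ A.cod) :
      SeqRel A X Y ⟨f ≫ side m X.dom n, g ≫ side k Y.dom l, h⟩
        ⟨f, side m X.cod n ≫ g, side k Y.cod l ≫ h⟩

/-- Sequential splits
`∫^{M,N,K,L} C(A; M ⊗ X ⊗ N) × C(M ⊗ X' ⊗ N; K ⊗ Y ⊗ L) × C(K ⊗ Y' ⊗ L; A')`. -/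
def Seq (A X Y : MCtx C) := Quot (SeqRel A X Y)

/-- The sequential split `f ⨾ (M ⊗ ■ ⊗ N) ⨾ g ⨾ (K ⊗ ■ ⊗ L) ⨾ h`. -/
def seqSplit {A X Y : MCtx C} {M N K L : C} (f : A.dom ⟶ M ⊗ X.dom ⊗ N)
    (g : M ⊗ X.cod ⊗ N ⟶ K ⊗ Y.dom ⊗ L) (h : K ⊗ Y.cod ⊗ L ⟶ A.cod) : Seq A X Y :=
  Quot.mk _ ⟨f, g, h⟩

lemma side_id {M X N : C} : side (𝟙 M) X (𝟙 N) = 𝟙 _ := by simp [side]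

lemma seqSplit_eq₁ {A X Y : MCtx C} {M M' N N' K L : C} (m : M ⟶ M') (n : N ⟶ N')
    {f : A.dom ⟶ M ⊗ X.dom ⊗ N} {f' : A.dom ⟶ M' ⊗ X.dom ⊗ N'}
    {g : M ⊗ X.cod ⊗ N ⟶ K ⊗ Y.dom ⊗ L} {g' : M' ⊗ X.cod ⊗ N' ⟶ K ⊗ Y.dom ⊗ L}
    {h : K ⊗ Y.cod ⊗ L ⟶ A.cod} (hf : f' = f ≫ side m X.dom n)
    (hg : g = side m X.cod n ≫ g') : seqSplit f' g' h = seqSplit f g h := by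
  subst hf hg
  have := Quot.sound (SeqRel.dinat m n (𝟙 K) (𝟙 L) f g' h)
  simp only [side_id, Category.comp_id, Category.id_comp] at this
  exact this

lemma seqSplit_eq₂ {A X Y : MCtx C} {M N K K' L L' : C} (k : K ⟶ K') (l : L ⟶ L')
    {f : A.dom ⟶ M ⊗ X.dom ⊗ N} {g : M ⊗ X.cod ⊗ N ⟶ K ⊗ Y.dom ⊗ L}
    {g' : M ⊗ X.cod ⊗ N ⟶ K' ⊗ Y.dom ⊗ L'} {h : K ⊗ Y.cod ⊗ L ⟶ A.cod}
    {h' : K' ⊗ Y.cod ⊗ L' ⟶ A.cod} (hg : g' = g ≫ side k Y.dom l)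
    (hh : h = side k Y.cod l ≫ h') : seqSplit f g' h' = seqSplit f g h := by
  subst hg hh
  have := Quot.sound (SeqRel.dinat (𝟙 M) (𝟙 N) k l f g h')
  simp only [side_id, Category.comp_id, Category.id_comp] at this
  exact this

namespace SeqRep

/-- Precomposition with a context. -/
def pre {B A X Y : MCtx C} (r : HomRep B A) (s : SeqRep A X Y) : SeqRep B X Y where
  M := r.M ⊗ s.M
  N := s.N ⊗ r.N
  K := r.M ⊗ s.K
  L := s.L ⊗ r.N
  f := r.f ≫ r.M ◁ s.f ▷ r.N ⊗≫ 𝟙 _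
  g := 𝟙 _ ⊗≫ r.M ◁ s.g ▷ r.N ⊗≫ 𝟙 _
  h := 𝟙 _ ⊗≫ r.M ◁ s.h ▷ r.N ≫ r.g

/-- Filling the first hole with a context. -/
def post₁ {A X X' Y : MCtx C} (s : SeqRep A X Y) (r : HomRep X X') : SeqRep A X' Y where
  M := s.M ⊗ r.M
  N := r.N ⊗ s.N
  K := s.K
  L := s.L
  f := s.f ≫ s.M ◁ r.f ▷ s.N ⊗≫ 𝟙 _
  g := 𝟙 _ ⊗≫ s.M ◁ r.g ▷ s.N ≫ s.g
  h := s.h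

/-- Filling the second hole with a context. -/
def post₂ {A X Y Y' : MCtx C} (s : SeqRep A X Y) (r : HomRep Y Y') : SeqRep A X Y' where
  M := s.M
  N := s.N
  K := s.K ⊗ r.M
  L := r.N ⊗ s.L
  f := s.f
  g := s.g ≫ s.K ◁ r.f ▷ s.L ⊗≫ 𝟙 _
  h := 𝟙 _ ⊗≫ s.K ◁ r.g ▷ s.L ≫ s.h

end SeqRep

namespace Seq

def pre {B A X Y : MCtx C} : Ctx B A → Seq A X Y → Seq B X Y :=
  Quot.lift₂ (fun r s => Quot.mk _ (SeqRep.pre r s))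
    (by
      rintro r _ _ ⟨m, n, k, l, f, g, h⟩
      refine (seqSplit_eq₁ (r.M ◁ m) (n ▷ r.N)
        (g := 𝟙 _ ⊗≫ r.M ◁ (side m X.cod n ≫ g ≫ side k Y.dom l) ▷ r.N ⊗≫ 𝟙 _) ?_ ?_).trans
        (seqSplit_eq₂ (r.M ◁ k) (l ▷ r.N) ?_ ?_) <;>
      simp only [side_eq, monoidalComp] <;> monoidal)
    (by
      rintro _ _ s ⟨m, n, f, g⟩
      rename_i M M' N N'
      refine (seqSplit_eq₁ (m ▷ s.M) (s.N ◁ n)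
        (g := 𝟙 ((M ⊗ s.M) ⊗ X.cod ⊗ (s.N ⊗ N)) ⊗≫ M ◁ s.g ▷ N ≫ side m _ n ⊗≫
          𝟙 ((M' ⊗ s.K) ⊗ Y.dom ⊗ (s.L ⊗ N'))) ?_ ?_).trans
        (seqSplit_eq₂ (m ▷ s.K) (s.L ◁ n) ?_ ?_)
      · simp only [monoidalComp, Category.assoc, side_comm_assoc]
        simp only [side_eq]; monoidal
      · simp only [monoidalComp, ← side_comm_assoc]
        simp only [side_eq]; monoidal
      · simp only [monoidalComp]
        simp only [side_eq]; monoidal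
      · simp only [monoidalComp, ← side_comm_assoc]
        simp only [side_eq]; monoidal)

def post₁ {A X X' Y : MCtx C} : Seq A X Y → Ctx X X' → Seq A X' Y :=
  Quot.lift₂ (fun s r => Quot.mk _ (SeqRep.post₁ s r))
    (by
      rintro s _ _ ⟨m, n, f, g⟩
      refine (seqSplit_eq₁ (s.M ◁ m) (n ▷ s.N) ?_ ?_) <;>
      simp only [side_eq, monoidalComp] <;> monoidal)
    (by
      rintro _ _ r ⟨m, n, k, l, f, g, h⟩
      rename_i M M' N N' _ _ _ _
      refine (seqSplit_eq₁ (m ▷ r.M) (r.N ◁ n)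
        (g := 𝟙 ((M ⊗ r.M) ⊗ X'.cod ⊗ (r.N ⊗ N)) ⊗≫ M ◁ r.g ▷ N ≫ side m X.cod n ≫ g ≫
          side k Y.dom l) ?_ ?_).trans (seqSplit_eq₂ k l ?_ ?_)
      · simp only [monoidalComp, Category.assoc, side_comm_assoc]
        simp only [side_eq]; monoidal
      · simp only [monoidalComp, ← side_comm_assoc]
        simp only [side_eq]; monoidal
      · simp only [monoidalComp]
        simp only [side_eq]; monoidal
      · rfl)

def post₂ {A X Y Y' : MCtx C} : Seq A X Y → Ctx Y Y' → Seq A X Y' :=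
  Quot.lift₂ (fun s r => Quot.mk _ (SeqRep.post₂ s r))
    (by
      rintro s _ _ ⟨m, n, f, g⟩
      refine (seqSplit_eq₂ (s.K ◁ m) (n ▷ s.L) ?_ ?_) <;>
      simp only [side_eq, monoidalComp] <;> monoidal)
    (by
      rintro _ _ r ⟨m, n, k, l, f, g, h⟩
      rename_i K K' L L'
      refine (seqSplit_eq₁ m n rfl rfl).trans (seqSplit_eq₂ (k ▷ r.M) (r.N ◁ l) ?_ ?_)
      · simp only [monoidalComp, Category.assoc, side_comm_assoc]
        simp only [side_eq]; monoidal
      · simp only [monoidalComp, ← side_comm_assoc]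
        simp only [side_eq]; monoidal)

lemma pre_id {A X Y : MCtx C} (s : Seq A X Y) : pre (𝟙 A : A ⟶ A) s = s := by
  obtain ⟨s⟩ := s
  refine (seqSplit_eq₁ (λ_ s.M).inv (ρ_ s.N).inv (g := s.g ≫ side (λ_ s.K).inv Y.dom (ρ_ s.L).inv)
    ?_ ?_).trans
    (seqSplit_eq₂ (λ_ s.K).inv (ρ_ s.L).inv ?_ ?_) <;>
      simp only [side_eq, monoidalComp] <;> monoidal

lemma pre_comp {D B A X Y : MCtx C} (c : D ⟶ B) (d : B ⟶ A) (s : Seq A X Y) :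
    pre (c ≫ d) s = pre c (pre d s) := by
  obtain ⟨c⟩ := c
  obtain ⟨d⟩ := d
  obtain ⟨s⟩ := s
  refine (seqSplit_eq₁ (α_ c.M d.M s.M).inv (α_ s.N d.N c.N).hom
    (g := 𝟙 _ ⊗≫ c.M ◁ (d.M ◁ s.g ▷ d.N) ▷ c.N ⊗≫
      𝟙 (((c.M ⊗ d.M) ⊗ s.K) ⊗ Y.dom ⊗ s.L ⊗ d.N ⊗ c.N))
    ?_ ?_).trans
    (seqSplit_eq₂ (α_ c.M d.M s.K).inv (α_ s.L d.N c.N).hom ?_ ?_) <;>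
      simp only [HomRep.comp, SeqRep.pre, side_eq, monoidalComp] <;> monoidal

lemma post₁_id {A X Y : MCtx C} (s : Seq A X Y) : post₁ s (𝟙 X : X ⟶ X) = s := by
  obtain ⟨s⟩ := s
  refine (seqSplit_eq₁ (ρ_ s.M).inv (λ_ s.N).inv ?_ ?_) <;>
      simp only [side_eq, monoidalComp] <;> monoidal

lemma post₁_comp {A X X' X'' Y : MCtx C} (s : Seq A X Y) (c : X ⟶ X') (d : X' ⟶ X'') :
    post₁ s (c ≫ d) = post₁ (post₁ s c) d := by
  obtain ⟨c⟩ := c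
  obtain ⟨d⟩ := d
  obtain ⟨s⟩ := s
  refine (seqSplit_eq₁ (α_ s.M c.M d.M).hom (α_ d.N c.N s.N).inv ?_ ?_) <;>
      simp only [HomRep.comp, SeqRep.post₁, side_eq, monoidalComp] <;> monoidal

lemma post₂_id {A X Y : MCtx C} (s : Seq A X Y) : post₂ s (𝟙 Y : Y ⟶ Y) = s := by
  obtain ⟨s⟩ := s
  refine (seqSplit_eq₂ (ρ_ s.K).inv (λ_ s.L).inv ?_ ?_) <;>
      simp only [side_eq, monoidalComp] <;> monoidal

lemma post₂_comp {A X Y Y' Y'' : MCtx C} (s : Seq A X Y) (c : Y ⟶ Y') (d : Y' ⟶ Y'') :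
    post₂ s (c ≫ d) = post₂ (post₂ s c) d := by
  obtain ⟨c⟩ := c
  obtain ⟨d⟩ := d
  obtain ⟨s⟩ := s
  refine (seqSplit_eq₂ (α_ s.K c.M d.M).hom (α_ d.N c.N s.L).inv ?_ ?_) <;>
      simp only [HomRep.comp, SeqRep.post₂, side_eq, monoidalComp] <;> monoidal

lemma post₁_post₂ {A X X' Y Y' : MCtx C} (s : Seq A X Y) (c : X ⟶ X') (d : Y ⟶ Y') :
    post₂ (post₁ s c) d = post₁ (post₂ s d) c := by
  obtain ⟨c⟩ := c
  obtain ⟨d⟩ := d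
  obtain ⟨s⟩ := s
  refine congr_arg (Quot.mk _) ?_
  simp only [SeqRep.post₁, SeqRep.post₂, SeqRep.mk.injEq, heq_eq_eq, true_and]
  refine ⟨rfl, ?_, rfl⟩
  simp only [monoidalComp]; monoidal

lemma pre_post₁ {B A X X' Y : MCtx C} (b : B ⟶ A) (s : Seq A X Y) (c : X ⟶ X') :
    pre b (post₁ s c) = post₁ (pre b s) c := by
  obtain ⟨b⟩ := b
  obtain ⟨c⟩ := c
  obtain ⟨s⟩ := s
  refine (seqSplit_eq₁ (α_ b.M s.M c.M).hom (α_ c.N s.N b.N).inv ?_ ?_) <;>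
      simp only [SeqRep.pre, SeqRep.post₁, side_eq, monoidalComp] <;> monoidal

lemma pre_post₂ {B A X Y Y' : MCtx C} (b : B ⟶ A) (s : Seq A X Y) (c : Y ⟶ Y') :
    pre b (post₂ s c) = post₂ (pre b s) c := by
  obtain ⟨b⟩ := b
  obtain ⟨c⟩ := c
  obtain ⟨s⟩ := s
  refine (seqSplit_eq₂ (α_ b.M s.K c.M).hom (α_ c.N s.L b.N).inv ?_ ?_) <;>
      simp only [SeqRep.pre, SeqRep.post₂, side_eq, monoidalComp] <;> monoidal

end Seq

/-- The profunctor of sequential splits. -/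
def seq (C : Type u) [Category.{v} C] [MonoidalCategory C] :
    MCtx C ⥤ MCtx C ⥤ (MCtx C)ᵒᵖ ⥤ Type (max u v) where
  obj X :=
    { obj Y :=
        { obj A := Seq A.unop X Y
          map b := ↾Seq.pre b.unop
          map_id A := by ext s; exact Seq.pre_id s
          map_comp b b' := by ext s; exact Seq.pre_comp b'.unop b.unop s }
      map d :=
        { app A := ↾fun s => Seq.post₂ s d
          naturality A B b := by ext s; exact (Seq.pre_post₂ b.unop s d).symm }
      map_id Y := by ext A s; exact Seq.post₂_id s
      map_comp d d' := by ext A s; exact Seq.post₂_comp s d d' }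
  map c :=
    { app Y :=
        { app A := ↾fun s => Seq.post₁ s c
          naturality A B b := by ext s; exact (Seq.pre_post₁ b.unop s c).symm }
      naturality Y Y' d := by ext A s; exact (Seq.post₁_post₂ s c d).symm }
  map_id X := by ext Y A s; exact Seq.post₁_id s
  map_comp c c' := by ext Y A s; exact Seq.post₁_comp s c c'

/-! ### Parallel splits -/

/-- Representatives `f ⨾ (M ⊗ ■ ⊗ N ⊗ ■ ⊗ O) ⨾ g` of parallel splits. -/
structure ParRep (A X Y : MCtx C) where
  {M : C}
  {N : C}
  {O : C}
  f : A.dom ⟶ M ⊗ X.dom ⊗ N ⊗ Y.dom ⊗ O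
  g : M ⊗ X.cod ⊗ N ⊗ Y.cod ⊗ O ⟶ A.cod

/-- Dinaturality in `M`, `N`, `O`. -/
inductive ParRel (A X Y : MCtx C) : ParRep A X Y → ParRep A X Y → Prop
  | dinat {M M' N N' O O' : C} (m : M ⟶ M') (n : N ⟶ N') (o : O ⟶ O')
      (f : A.dom ⟶ M ⊗ X.dom ⊗ N ⊗ Y.dom ⊗ O) (g : M' ⊗ X.cod ⊗ N' ⊗ Y.cod ⊗ O' ⟶ A.cod) :
      ParRel A X Y ⟨f ≫ side₂ m X.dom n Y.dom o, g⟩ ⟨f, side₂ m X.cod n Y.cod o ≫ g⟩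

/-- Parallel splits
`∫^{M,N,O} C(A; M ⊗ X ⊗ N ⊗ Y ⊗ O) × C(M ⊗ X' ⊗ N ⊗ Y' ⊗ O; A')`. -/
def Par (A X Y : MCtx C) := Quot (ParRel A X Y)

/-- The parallel split `f ⨾ (M ⊗ ■ ⊗ N ⊗ ■ ⊗ O) ⨾ g`. -/
def parSplit {A X Y : MCtx C} {M N O : C} (f : A.dom ⟶ M ⊗ X.dom ⊗ N ⊗ Y.dom ⊗ O)
    (g : M ⊗ X.cod ⊗ N ⊗ Y.cod ⊗ O ⟶ A.cod) : Par A X Y :=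
  Quot.mk _ ⟨f, g⟩

lemma parSplit_eq {A X Y : MCtx C} {M M' N N' O O' : C} (m : M ⟶ M') (n : N ⟶ N') (o : O ⟶ O')
    {f : A.dom ⟶ M ⊗ X.dom ⊗ N ⊗ Y.dom ⊗ O} {f' : A.dom ⟶ M' ⊗ X.dom ⊗ N' ⊗ Y.dom ⊗ O'}
    {g : M ⊗ X.cod ⊗ N ⊗ Y.cod ⊗ O ⟶ A.cod} {g' : M' ⊗ X.cod ⊗ N' ⊗ Y.cod ⊗ O' ⟶ A.cod}
    (hf : f' = f ≫ side₂ m X.dom n Y.dom o) (hg : g = side₂ m X.cod n Y.cod o ≫ g') :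
    parSplit f' g' = parSplit f g := by
  subst hf hg
  exact Quot.sound (ParRel.dinat m n o f g')

namespace ParRep

/-- Precomposition with a context. -/
def pre {B A X Y : MCtx C} (r : HomRep B A) (s : ParRep A X Y) : ParRep B X Y where
  M := r.M ⊗ s.M
  N := s.N
  O := s.O ⊗ r.N
  f := r.f ≫ r.M ◁ s.f ▷ r.N ⊗≫ 𝟙 _
  g := 𝟙 _ ⊗≫ r.M ◁ s.g ▷ r.N ≫ r.g

/-- Filling the first hole with a context. -/
def post₁ {A X X' Y : MCtx C} (s : ParRep A X Y) (r : HomRep X X') : ParRep A X' Y where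
  M := s.M ⊗ r.M
  N := r.N ⊗ s.N
  O := s.O
  f := s.f ≫ s.M ◁ r.f ▷ (s.N ⊗ Y.dom ⊗ s.O) ⊗≫ 𝟙 _
  g := 𝟙 _ ⊗≫ s.M ◁ r.g ▷ (s.N ⊗ Y.cod ⊗ s.O) ≫ s.g

/-- Filling the second hole with a context. -/
def post₂ {A X Y Y' : MCtx C} (s : ParRep A X Y) (r : HomRep Y Y') : ParRep A X Y' where
  M := s.M
  N := s.N ⊗ r.M
  O := r.N ⊗ s.O
  f := s.f ≫ s.M ◁ X.dom ◁ s.N ◁ r.f ▷ s.O ⊗≫ 𝟙 _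
  g := 𝟙 _ ⊗≫ s.M ◁ X.cod ◁ s.N ◁ r.g ▷ s.O ≫ s.g

end ParRep

namespace Par

def pre {B A X Y : MCtx C} : Ctx B A → Par A X Y → Par B X Y :=
  Quot.lift₂ (fun r s => Quot.mk _ (ParRep.pre r s))
    (by
      rintro r _ _ ⟨m, n, o, f, g⟩
      refine parSplit_eq (r.M ◁ m) n (o ▷ r.N) ?_ ?_ <;>
      simp only [side₂_eq, monoidalComp] <;> monoidal)
    (by
      rintro _ _ s ⟨m, n, f, g⟩
      refine parSplit_eq (m ▷ s.M) (𝟙 s.N) (s.O ◁ n) ?_ ?_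
      · simp only [monoidalComp, Category.assoc, side_comm_assoc]
        simp only [side_eq, side₂_eq]; monoidal
      · simp only [monoidalComp, ← side_comm_assoc]
        simp only [side_eq, side₂_eq]; monoidal)

def post₁ {A X X' Y : MCtx C} : Par A X Y → Ctx X X' → Par A X' Y :=
  Quot.lift₂ (fun s r => Quot.mk _ (ParRep.post₁ s r))
    (by
      rintro s _ _ ⟨m, n, f, g⟩
      refine parSplit_eq (s.M ◁ m) (n ▷ s.N) (𝟙 s.O) ?_ ?_ <;>
      simp only [side_eq, side₂_eq, monoidalComp] <;> monoidal)
    (by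
      rintro _ _ r ⟨m, n, o, f, g⟩
      refine parSplit_eq (m ▷ r.M) (r.N ◁ n) o ?_ ?_
      · simp only [monoidalComp, Category.assoc, side₂_comm_left_assoc]
        simp only [side₂_eq]; monoidal
      · simp only [monoidalComp, ← side₂_comm_left_assoc]
        simp only [side₂_eq]; monoidal)

def post₂ {A X Y Y' : MCtx C} : Par A X Y → Ctx Y Y' → Par A X Y' :=
  Quot.lift₂ (fun s r => Quot.mk _ (ParRep.post₂ s r))
    (by
      rintro s _ _ ⟨m, n, f, g⟩
      refine parSplit_eq (𝟙 s.M) (s.N ◁ m) (n ▷ s.O) ?_ ?_ <;>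
      simp only [side_eq, side₂_eq, monoidalComp] <;> monoidal)
    (by
      rintro _ _ r ⟨m, n, o, f, g⟩
      refine parSplit_eq m (n ▷ r.M) (r.N ◁ o) ?_ ?_
      · simp only [monoidalComp, Category.assoc, side₂_comm_right_assoc]
        simp only [side₂_eq]; monoidal
      · simp only [monoidalComp, ← side₂_comm_right_assoc]
        simp only [side₂_eq]; monoidal)

lemma pre_id {A X Y : MCtx C} (s : Par A X Y) : pre (𝟙 A : A ⟶ A) s = s := by
  obtain ⟨s⟩ := s
  refine parSplit_eq (λ_ s.M).inv (𝟙 s.N) (ρ_ s.O).inv ?_ ?_ <;>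
    simp only [side₂_eq, monoidalComp] <;> monoidal

lemma pre_comp {D B A X Y : MCtx C} (c : D ⟶ B) (d : B ⟶ A) (s : Par A X Y) :
    pre (c ≫ d) s = pre c (pre d s) := by
  obtain ⟨c⟩ := c
  obtain ⟨d⟩ := d
  obtain ⟨s⟩ := s
  refine parSplit_eq (α_ c.M d.M s.M).inv (𝟙 s.N) (α_ s.O d.N c.N).hom ?_ ?_ <;>
    simp only [HomRep.comp, ParRep.pre, side₂_eq, monoidalComp] <;> monoidal

lemma post₁_id {A X Y : MCtx C} (s : Par A X Y) : post₁ s (𝟙 X : X ⟶ X) = s := by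
  obtain ⟨s⟩ := s
  refine parSplit_eq (ρ_ s.M).inv (λ_ s.N).inv (𝟙 s.O) ?_ ?_ <;>
    simp only [side₂_eq, monoidalComp] <;> monoidal

lemma post₁_comp {A X X' X'' Y : MCtx C} (s : Par A X Y) (c : X ⟶ X') (d : X' ⟶ X'') :
    post₁ s (c ≫ d) = post₁ (post₁ s c) d := by
  obtain ⟨c⟩ := c
  obtain ⟨d⟩ := d
  obtain ⟨s⟩ := s
  refine parSplit_eq (α_ s.M c.M d.M).hom (α_ d.N c.N s.N).inv (𝟙 s.O) ?_ ?_ <;>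
    simp only [HomRep.comp, ParRep.post₁, side₂_eq, monoidalComp] <;> monoidal

lemma post₂_id {A X Y : MCtx C} (s : Par A X Y) : post₂ s (𝟙 Y : Y ⟶ Y) = s := by
  obtain ⟨s⟩ := s
  refine parSplit_eq (𝟙 s.M) (ρ_ s.N).inv (λ_ s.O).inv ?_ ?_ <;>
    simp only [side₂_eq, monoidalComp] <;> monoidal

lemma post₂_comp {A X Y Y' Y'' : MCtx C} (s : Par A X Y) (c : Y ⟶ Y') (d : Y' ⟶ Y'') :
    post₂ s (c ≫ d) = post₂ (post₂ s c) d := by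
  obtain ⟨c⟩ := c
  obtain ⟨d⟩ := d
  obtain ⟨s⟩ := s
  refine parSplit_eq (𝟙 s.M) (α_ s.N c.M d.M).hom (α_ d.N c.N s.O).inv ?_ ?_ <;>
    simp only [HomRep.comp, ParRep.post₂, side₂_eq, monoidalComp] <;> monoidal

lemma post₁_post₂ {A X X' Y Y' : MCtx C} (s : Par A X Y) (c : X ⟶ X') (d : Y ⟶ Y') :
    post₂ (post₁ s c) d = post₁ (post₂ s d) c := by
  obtain ⟨c⟩ := c
  obtain ⟨d⟩ := d
  obtain ⟨s⟩ := s
  have e₁ : ∀ {P Q P' Q' : C} (p : P ⟶ P') (q : Q ⟶ Q'),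
      s.M ◁ p ▷ (s.N ⊗ Q ⊗ s.O) ≫ s.M ◁ P' ◁ s.N ◁ q ▷ s.O =
        s.M ◁ P ◁ s.N ◁ q ▷ s.O ≫ s.M ◁ p ▷ (s.N ⊗ Q' ⊗ s.O) := by
    intros
    simp [← id_tensorHom, ← tensorHom_id]
  refine parSplit_eq (𝟙 _) (α_ c.N s.N d.M).inv (𝟙 _) ?_ ?_
  · trans s.f ≫ (s.M ◁ X.dom ◁ s.N ◁ d.f ▷ s.O ≫
        s.M ◁ c.f ▷ (s.N ⊗ (d.M ⊗ Y'.dom ⊗ d.N) ⊗ s.O)) ⊗≫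
          𝟙 ((s.M ⊗ c.M) ⊗ X'.dom ⊗ ((c.N ⊗ s.N) ⊗ d.M) ⊗ Y'.dom ⊗ (d.N ⊗ s.O))
    · rw [← e₁]
      simp only [ParRep.post₁, monoidalComp]
      monoidal
    · simp only [ParRep.post₁, ParRep.post₂, side₂_eq, monoidalComp]
      monoidal
  · trans 𝟙 ((s.M ⊗ c.M) ⊗ X'.cod ⊗ (c.N ⊗ s.N ⊗ d.M) ⊗ Y'.cod ⊗ (d.N ⊗ s.O)) ⊗≫
        (s.M ◁ c.g ▷ (s.N ⊗ (d.M ⊗ Y'.cod ⊗ d.N) ⊗ s.O) ≫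
          s.M ◁ X.cod ◁ s.N ◁ d.g ▷ s.O) ≫ s.g
    · simp only [ParRep.post₂, monoidalComp]
      monoidal
    · rw [e₁]
      simp only [ParRep.post₁, ParRep.post₂, side₂_eq, monoidalComp]
      monoidal

lemma pre_post₁ {B A X X' Y : MCtx C} (b : B ⟶ A) (s : Par A X Y) (c : X ⟶ X') :
    pre b (post₁ s c) = post₁ (pre b s) c := by
  obtain ⟨b⟩ := b
  obtain ⟨c⟩ := c
  obtain ⟨s⟩ := s
  refine parSplit_eq (α_ b.M s.M c.M).hom (𝟙 _) (𝟙 _) ?_ ?_ <;>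
    simp only [ParRep.pre, ParRep.post₁, side₂_eq, monoidalComp] <;> monoidal

lemma pre_post₂ {B A X Y Y' : MCtx C} (b : B ⟶ A) (s : Par A X Y) (c : Y ⟶ Y') :
    pre b (post₂ s c) = post₂ (pre b s) c := by
  obtain ⟨b⟩ := b
  obtain ⟨c⟩ := c
  obtain ⟨s⟩ := s
  refine parSplit_eq (𝟙 _) (𝟙 _) (α_ c.N s.O b.N).inv ?_ ?_ <;>
    simp only [ParRep.pre, ParRep.post₂, side₂_eq, monoidalComp] <;> monoidal

end Par

/-- The profunctor of parallel splits. -/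
def par (C : Type u) [Category.{v} C] [MonoidalCategory C] :
    MCtx C ⥤ MCtx C ⥤ (MCtx C)ᵒᵖ ⥤ Type (max u v) where
  obj X :=
    { obj Y :=
        { obj A := Par A.unop X Y
          map b := ↾Par.pre b.unop
          map_id A := by ext s; exact Par.pre_id s
          map_comp b b' := by ext s; exact Par.pre_comp b'.unop b.unop s }
      map d :=
        { app A := ↾fun s => Par.post₂ s d
          naturality A B b := by ext s; exact (Par.pre_post₂ b.unop s d).symm }
      map_id Y := by ext A s; exact Par.post₂_id s
      map_comp d d' := by ext A s; exact Par.post₂_comp s d d' }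
  map c :=
    { app Y :=
        { app A := ↾fun s => Par.post₁ s c
          naturality A B b := by ext s; exact (Par.pre_post₁ b.unop s c).symm }
      naturality Y Y' d := by ext A s; exact (Par.post₁_post₂ s c d).symm }
  map_id X := by ext Y A s; exact Par.post₁_id s
  map_comp c c' := by ext Y A s; exact Par.post₁_comp s c c'

/-! ### Iterated splits

Two splits, one nested in the other, substitute to a split with more holes. The three coends below
collect the splits that arise in this way. -/

/-- Representatives `f ⨾ (M ⊗ ■ ⊗ N) ⨾ g ⨾ (K ⊗ ■ ⊗ L) ⨾ h ⨾ (P ⊗ ■ ⊗ Q) ⨾ k` of sequential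
splits into three. -/
structure SeqThreeRep (A X Y Z : MCtx C) where
  {M : C}
  {N : C}
  {K : C}
  {L : C}
  {P : C}
  {Q : C}
  f : A.dom ⟶ M ⊗ X.dom ⊗ N
  g : M ⊗ X.cod ⊗ N ⟶ K ⊗ Y.dom ⊗ L
  h : K ⊗ Y.cod ⊗ L ⟶ P ⊗ Z.dom ⊗ Q
  k : P ⊗ Z.cod ⊗ Q ⟶ A.cod

/-- Dinaturality in `M`, `N`, `K`, `L`, `P`, `Q`. -/
inductive SeqThreeRel (A X Y Z : MCtx C) : SeqThreeRep A X Y Z → SeqThreeRep A X Y Z → Prop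
  | dinat {M M' N N' K K' L L' P P' Q Q' : C} (m : M ⟶ M') (n : N ⟶ N') (i : K ⟶ K')
      (l : L ⟶ L') (p : P ⟶ P') (q : Q ⟶ Q')
      (f : A.dom ⟶ M ⊗ X.dom ⊗ N) (g : M' ⊗ X.cod ⊗ N' ⟶ K ⊗ Y.dom ⊗ L)
      (h : K' ⊗ Y.cod ⊗ L' ⟶ P ⊗ Z.dom ⊗ Q) (k : P' ⊗ Z.cod ⊗ Q' ⟶ A.cod) :
      SeqThreeRel A X Y Z
        ⟨f ≫ side m X.dom n, g ≫ side i Y.dom l, h ≫ side p Z.dom q, k⟩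
        ⟨f, side m X.cod n ≫ g, side i Y.cod l ≫ h, side p Z.cod q ≫ k⟩

/-- Sequential splits into three: the coend over `M`, `N`, `K`, `L`, `P`, `Q` of
`C(A; M ⊗ X ⊗ N) × C(M ⊗ X' ⊗ N; K ⊗ Y ⊗ L) × C(K ⊗ Y' ⊗ L; P ⊗ Z ⊗ Q) × C(P ⊗ Z' ⊗ Q; A')`. -/
def SeqThree (A X Y Z : MCtx C) := Quot (SeqThreeRel A X Y Z)

/-- The split into three given by `s : (A, A') → U ◁ Z` and `t : U → X ◁ Y`. -/
def SeqRep.substLeft {A U X Y Z : MCtx C} (s : SeqRep A U Z) (t : SeqRep U X Y) :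
    SeqThree A X Y Z :=
  Quot.mk _
    { M := s.M ⊗ t.M
      N := t.N ⊗ s.N
      K := s.M ⊗ t.K
      L := t.L ⊗ s.N
      P := s.K
      Q := s.L
      f := s.f ≫ s.M ◁ t.f ▷ s.N ⊗≫ 𝟙 _
      g := 𝟙 _ ⊗≫ s.M ◁ t.g ▷ s.N ⊗≫ 𝟙 _
      h := 𝟙 _ ⊗≫ s.M ◁ t.h ▷ s.N ≫ s.g
      k := s.h }

/-- The split into three given by `s : (A, A') → X ◁ U` and `t : U → Y ◁ Z`. -/
def SeqRep.substRight {A U X Y Z : MCtx C} (s : SeqRep A X U) (t : SeqRep U Y Z) :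
    SeqThree A X Y Z :=
  Quot.mk _
    { M := s.M
      N := s.N
      K := s.K ⊗ t.M
      L := t.N ⊗ s.L
      P := s.K ⊗ t.K
      Q := t.L ⊗ s.L
      f := s.f
      g := s.g ≫ s.K ◁ t.f ▷ s.L ⊗≫ 𝟙 _
      h := 𝟙 _ ⊗≫ s.K ◁ t.g ▷ s.L ⊗≫ 𝟙 _
      k := 𝟙 _ ⊗≫ s.K ◁ t.h ▷ s.L ≫ s.h }

/-- Representatives `f ⨾ (M ⊗ ■ ⊗ N ⊗ ■ ⊗ O ⊗ ■ ⊗ P) ⨾ g` of parallel splits into three. -/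
structure ParThreeRep (A X Y Z : MCtx C) where
  {M : C}
  {N : C}
  {O : C}
  {P : C}
  f : A.dom ⟶ M ⊗ X.dom ⊗ N ⊗ Y.dom ⊗ O ⊗ Z.dom ⊗ P
  g : M ⊗ X.cod ⊗ N ⊗ Y.cod ⊗ O ⊗ Z.cod ⊗ P ⟶ A.cod

/-- `m ⊗ id_X ⊗ n ⊗ id_Y ⊗ o ⊗ id_Z ⊗ p`. -/
def side₃ {M M' N N' O O' P P' : C} (m : M ⟶ M') (X : C) (n : N ⟶ N') (Y : C) (o : O ⟶ O')
    (Z : C) (p : P ⟶ P') :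
    M ⊗ X ⊗ N ⊗ Y ⊗ O ⊗ Z ⊗ P ⟶ M' ⊗ X ⊗ N' ⊗ Y ⊗ O' ⊗ Z ⊗ P' :=
  m ⊗ₘ 𝟙 X ⊗ₘ n ⊗ₘ 𝟙 Y ⊗ₘ o ⊗ₘ 𝟙 Z ⊗ₘ p

/-- Dinaturality in `M`, `N`, `O`, `P`. -/
inductive ParThreeRel (A X Y Z : MCtx C) : ParThreeRep A X Y Z → ParThreeRep A X Y Z → Prop
  | dinat {M M' N N' O O' P P' : C} (m : M ⟶ M') (n : N ⟶ N') (o : O ⟶ O') (p : P ⟶ P')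
      (f : A.dom ⟶ M ⊗ X.dom ⊗ N ⊗ Y.dom ⊗ O ⊗ Z.dom ⊗ P)
      (g : M' ⊗ X.cod ⊗ N' ⊗ Y.cod ⊗ O' ⊗ Z.cod ⊗ P' ⟶ A.cod) :
      ParThreeRel A X Y Z ⟨f ≫ side₃ m X.dom n Y.dom o Z.dom p, g⟩
        ⟨f, side₃ m X.cod n Y.cod o Z.cod p ≫ g⟩

/-- Parallel splits into three, `∫^{M,N,O,P}
C(A; M ⊗ X ⊗ N ⊗ Y ⊗ O ⊗ Z ⊗ P) × C(M ⊗ X' ⊗ N ⊗ Y' ⊗ O ⊗ Z' ⊗ P; A')`. -/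
def ParThree (A X Y Z : MCtx C) := Quot (ParThreeRel A X Y Z)

/-- The split into three given by `s : (A, A') → U ⊗ Z` and `t : U → X ⊗ Y`. -/
def ParRep.substLeft {A U X Y Z : MCtx C} (s : ParRep A U Z) (t : ParRep U X Y) :
    ParThree A X Y Z :=
  Quot.mk _
    { M := s.M ⊗ t.M
      N := t.N
      O := t.O ⊗ s.N
      P := s.O
      f := s.f ≫ s.M ◁ t.f ▷ (s.N ⊗ Z.dom ⊗ s.O) ⊗≫ 𝟙 _
      g := 𝟙 _ ⊗≫ s.M ◁ t.g ▷ (s.N ⊗ Z.cod ⊗ s.O) ≫ s.g }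

/-- The split into three given by `s : (A, A') → X ⊗ U` and `t : U → Y ⊗ Z`. -/
def ParRep.substRight {A U X Y Z : MCtx C} (s : ParRep A X U) (t : ParRep U Y Z) :
    ParThree A X Y Z :=
  Quot.mk _
    { M := s.M
      N := s.N ⊗ t.M
      O := t.N
      P := t.O ⊗ s.O
      f := s.f ≫ s.M ◁ X.dom ◁ s.N ◁ t.f ▷ s.O ⊗≫ 𝟙 _
      g := 𝟙 _ ⊗≫ s.M ◁ X.cod ◁ s.N ◁ t.g ▷ s.O ≫ s.g }

/-- Representatives
`f ⨾ (M ⊗ ■ ⊗ N ⊗ ■ ⊗ O) ⨾ g ⨾ (K ⊗ ■ ⊗ L ⊗ ■ ⊗ R) ⨾ h` of splits into two sequential layers of two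
parallel holes, `X`, `Z` in the first layer and `Y`, `W` in the second. -/
structure SeqParRep (A X Y Z W : MCtx C) where
  {M : C}
  {N : C}
  {O : C}
  {K : C}
  {L : C}
  {R : C}
  f : A.dom ⟶ M ⊗ X.dom ⊗ N ⊗ Z.dom ⊗ O
  g : M ⊗ X.cod ⊗ N ⊗ Z.cod ⊗ O ⟶ K ⊗ Y.dom ⊗ L ⊗ W.dom ⊗ R
  h : K ⊗ Y.cod ⊗ L ⊗ W.cod ⊗ R ⟶ A.cod

/-- Dinaturality in `M`, `N`, `O`, `K`, `L`, `R`. -/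
inductive SeqParRel (A X Y Z W : MCtx C) : SeqParRep A X Y Z W → SeqParRep A X Y Z W → Prop
  | dinat {M M' N N' O O' K K' L L' R R' : C} (m : M ⟶ M') (n : N ⟶ N') (o : O ⟶ O')
      (k : K ⟶ K') (l : L ⟶ L') (r : R ⟶ R')
      (f : A.dom ⟶ M ⊗ X.dom ⊗ N ⊗ Z.dom ⊗ O)
      (g : M' ⊗ X.cod ⊗ N' ⊗ Z.cod ⊗ O' ⟶ K ⊗ Y.dom ⊗ L ⊗ W.dom ⊗ R)
      (h : K' ⊗ Y.cod ⊗ L' ⊗ W.cod ⊗ R' ⟶ A.cod) :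
      SeqParRel A X Y Z W
        ⟨f ≫ side₂ m X.dom n Z.dom o, g ≫ side₂ k Y.dom l W.dom r, h⟩
        ⟨f, side₂ m X.cod n Z.cod o ≫ g, side₂ k Y.cod l W.cod r ≫ h⟩

/-- The coend over `M`, `N`, `O`, `K`, `L`, `R` of `C(A; M ⊗ X ⊗ N ⊗ Z ⊗ O) ×
C(M ⊗ X' ⊗ N ⊗ Z' ⊗ O; K ⊗ Y ⊗ L ⊗ W ⊗ R) × C(K ⊗ Y' ⊗ L ⊗ W' ⊗ R; A')`. -/
def SeqPar (A X Y Z W : MCtx C) := Quot (SeqParRel A X Y Z W)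

/-- The split into two layers given by a parallel split `r : (A, A') → U ⊗ V` and sequential splits
`s : U → X ◁ Y` and `t : V → Z ◁ W`. -/
def ParRep.substSeq {A U V X Y Z W : MCtx C} (r : ParRep A U V) (s : SeqRep U X Y)
    (t : SeqRep V Z W) : SeqPar A X Y Z W :=
  Quot.mk _
    { M := r.M ⊗ s.M
      N := s.N ⊗ r.N ⊗ t.M
      O := t.N ⊗ r.O
      K := r.M ⊗ s.K
      L := s.L ⊗ r.N ⊗ t.K
      R := t.L ⊗ r.O
      f := r.f ≫ (𝟙 r.M ⊗ₘ s.f ⊗ₘ 𝟙 r.N ⊗ₘ t.f ⊗ₘ 𝟙 r.O) ⊗≫ 𝟙 _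
      g := 𝟙 _ ⊗≫ (𝟙 r.M ⊗ₘ s.g ⊗ₘ 𝟙 r.N ⊗ₘ t.g ⊗ₘ 𝟙 r.O) ⊗≫ 𝟙 _
      h := 𝟙 _ ⊗≫ (𝟙 r.M ⊗ₘ s.h ⊗ₘ 𝟙 r.N ⊗ₘ t.h ⊗ₘ 𝟙 r.O) ≫ r.g }

/-- The split into two layers given by a sequential split `s : (A, A') → U ◁ V` and parallel splits
`p : U → X ⊗ Z` and `q : V → Y ⊗ W`. -/
def SeqRep.substPar {A U V X Y Z W : MCtx C} (s : SeqRep A U V) (p : ParRep U X Z)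
    (q : ParRep V Y W) : SeqPar A X Y Z W :=
  Quot.mk _
    { M := s.M ⊗ p.M
      N := p.N
      O := p.O ⊗ s.N
      K := s.K ⊗ q.M
      L := q.N
      R := q.O ⊗ s.L
      f := s.f ≫ s.M ◁ p.f ▷ s.N ⊗≫ 𝟙 _
      g := 𝟙 _ ⊗≫ (s.M ◁ p.g ▷ s.N ≫ s.g ≫ s.K ◁ q.f ▷ s.L) ⊗≫ 𝟙 _
      h := 𝟙 _ ⊗≫ s.K ◁ q.g ▷ s.L ≫ s.h }

/-- The class of a representative. -/
def SeqRep.cls {A X Y : MCtx C} (s : SeqRep A X Y) : (((seq C).obj X).obj Y).obj (op A) :=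
  Quot.mk _ s

/-- The class of a representative. -/
def ParRep.cls {A X Y : MCtx C} (s : ParRep A X Y) : (((par C).obj X).obj Y).obj (op A) :=
  Quot.mk _ s

/-- A morphism of `C` as an element of the unit profunctor. -/
def toUnit {A : MCtx C} (f : A.dom ⟶ A.cod) : (unit C).obj (op A) := ⟨f⟩

/-- A context as an element of the representable presheaf. -/
def toYoneda {A X : MCtx C} (c : A ⟶ X) : (uliftYoneda.{u}.obj X).obj (op A) := ⟨c⟩

end MCtx

open Produoidal MCtx

/-! A presheaf on monoidal contexts is a profunctor `P(A, A')` on `C` with compatible maps `P(A, A')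
→ P(M ⊗ A ⊗ N, M ⊗ A' ⊗ N)`, a two-sided Tambara module. The reason is that each context factors as
a plain pre- and postcomposition, a left whiskering and a right whiskering (`ctx_eq_comp`), so a
family of maps is natural once it respects these three (`homOfGenerators`).

In this language both convolutions become familiar. The sequential one is composition of
profunctors, `(P ◁ Q)(A, A') = ∫^B P(A, B) × Q(B, A')`: it is spanned by composites `p ; q` cut at
an object `B`, and the only relation slides a morphism across the cut (`seqK_surj`, `seqK_dinat`,
`seqLift`). The parallel one is a Day convolution balanced over `C`: it is spanned by `p ⊗ q`
together with `f : A ⟶ S ⊗ T` and `g : S' ⊗ T' ⟶ A'`, modulo absorbing morphisms into `f` and `g`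
and passing a side object from the right of `p` to the left of `q` (`parK_surj`, `parK_pl`,
`parK_slide`, `parLift`). The hom profunctor is the unit of both, which is why `φ₀` is an identity
and the structure is normal.

The structure maps are then evident on generators: `(p ; q) ; r ↦ p ; (q ; r)`, the analogous
reassociation of `⊗`, the action of a morphism of `C` for the unitors, and the interchange `(p ; q)
⊗ (r ; s) ↦ (p ⊗ r) ; (q ⊗ s)` for `ψ₂`. The maps `ψ₀` and `φ₂` come from left unitors at the unit,
so they are invertible. Each coherence equation is compared on generators, where coherence and
interchange in `C` suffice.

Two translations connect this with the statement. By Yoneda, associators, unitors and laxators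
natural in presheaf arguments restrict to splits of objects, and extending the restriction gives
back the original maps (`assocConv_toData`, `leftUnitorConv_toData`, `rightUnitorConv_toData`,
`psi₂Conv_eq`). For the explicit formulas, the nested coends embed in the coends of splits with
several holes (`toSeqThree_injective`, `toParThree_injective`, `toSeqPar_injective`), so an equality
of nested classes is the same as an equality of substituted splits. -/

namespace Produoidal

/-! ### Yoneda reduction: splits of objects as convolutions of representables. -/

section Virtual

variable {V : Type u} [Category.{w} V]

/-- The presheaf represented by `X`. -/
abbrev yo (X : V) : Presheaf V := uliftYoneda.{u}.obj X

/-- The universal element of a representable presheaf. -/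
def yoId (X : V) : (yo X).obj (op X) := ⟨𝟙 X⟩

/-- The natural transformation `𝕍(•; X) → P` classified by an element of `P(X)`. -/
def classify {P : Presheaf V} {X : V} (p : P.obj (op X)) : yo X ⟶ P where
  app A := ↾fun c => P.map c.down.op p
  naturality A B a := by ext c; simp

lemma classify_app {P : Presheaf V} {X : V} (p : P.obj (op X)) {A : Vᵒᵖ} (c : (yo X).obj A) :
    (classify p).app A c = P.map c.down.op p := rfl

lemma classify_yoId {P : Presheaf V} {X : V} (p : P.obj (op X)) :
    (classify p).app (op X) (yoId X) = p := by simp [classify_app, yoId]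

lemma hom_comm {P Q R S : Presheaf V} {f : P ⟶ Q} {g : Q ⟶ S} {h : P ⟶ R} {k : R ⟶ S}
    (e : f ≫ g = h ≫ k) {A : Vᵒᵖ} (x : P.obj A) :
    g.app A (f.app A x) = k.app A (h.app A x) :=
  types_congr_hom (NatTrans.congr_app e A) x

variable (T : Protensor V)

lemma convMap_app {P P' Q Q' : Presheaf V} (φ : P ⟶ P') (χ : Q ⟶ Q') {U W : V} {A : Vᵒᵖ}
    (t : ((T.obj U).obj W).obj A) (p : P.obj (op U)) (q : Q.obj (op W)) :
    (convMap T φ χ).app A (convMk T t p q) = convMk T t (φ.app _ p) (χ.app _ q) := rfl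

lemma convMap_id (P Q : Presheaf V) : convMap T (𝟙 P) (𝟙 Q) = 𝟙 _ := by
  ext A ⟨r⟩; rfl

lemma convMap_comp {P P' P'' Q Q' Q'' : Presheaf V} (φ : P ⟶ P') (φ' : P' ⟶ P'') (χ : Q ⟶ Q')
    (χ' : Q' ⟶ Q'') : convMap T (φ ≫ φ') (χ ≫ χ') = convMap T φ χ ≫ convMap T φ' χ' := by
  ext A ⟨r⟩; rfl

/-- Functoriality of `conv` on isomorphisms. -/
def convIso {P P' Q Q' : Presheaf V} (φ : P ≅ P') (χ : Q ≅ Q') : conv T P Q ≅ conv T P' Q' where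
  hom := convMap T φ.hom χ.hom
  inv := convMap T φ.inv χ.inv
  hom_inv_id := by rw [← convMap_comp, φ.hom_inv_id, χ.hom_inv_id, convMap_id]
  inv_hom_id := by rw [← convMap_comp, φ.inv_hom_id, χ.inv_hom_id, convMap_id]

/-- The Yoneda reduction `𝕍(•; P ◁ Z) ≅ 𝕍(•; P ◁ 𝕍(•; Z))`. -/
def nestLIso (P : Presheaf V) (Z : V) : nestL T P Z ≅ conv T P (yo Z) where
  hom :=
    { app A := ↾Quot.lift (fun k => convMk T k.split k.arg (yoId Z)) (by
        rintro _ _ ⟨f, t, p⟩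
        exact convMk_dinat_left T f t p _)
      naturality A B a := by ext ⟨k⟩; rfl }
  inv :=
    { app A := ↾Quot.lift (fun k => nestLMk T (post T (𝟙 _) k.snd.down k.split) k.fst) (by
        rintro _ _ ⟨f, g, t, p, z⟩
        change nestLMk T (post T (𝟙 _) z.down (post T f g t)) p =
          nestLMk T (post T (𝟙 _) (g ≫ z.down) t) (P.map f.op p)
        -- Dinaturality returns `f` to the split; both sides then act on `t` by `f` and `g ≫
        -- z.down`.
        rw [← nestLMk_dinat, post_post, post_post, Category.comp_id, Category.id_comp,
          Category.comp_id])
      naturality A B a := by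
        ext ⟨k⟩
        exact congr_arg (fun x => nestLMk T x k.fst) (map_post T a _ _ _).symm }
  hom_inv_id := by
    ext A ⟨k⟩
    exact congr_arg (fun x => nestLMk T x k.arg) (post_id T _)
  inv_hom_id := by
    ext A ⟨U, W, t, p, z⟩
    change convMk T (post T (𝟙 _) z.down t) p (yoId Z) = convMk T t p z
    rw [convMk_dinat_right]
    congr 1
    exact congr_arg ULift.up (Category.comp_id z.down)

/-- The Yoneda reduction `𝕍(•; X ◁ Q) ≅ 𝕍(•; 𝕍(•; X) ◁ Q)`. -/
def nestRIso (X : V) (Q : Presheaf V) : nestR T X Q ≅ conv T (yo X) Q where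
  hom :=
    { app A := ↾Quot.lift (fun k => convMk T k.split (yoId X) k.arg) (by
        rintro _ _ ⟨f, t, p⟩
        exact convMk_dinat_right T f t _ p)
      naturality A B a := by ext ⟨k⟩; rfl }
  inv :=
    { app A := ↾Quot.lift (fun k => nestRMk T (post T k.fst.down (𝟙 _) k.split) k.snd) (by
        rintro _ _ ⟨f, g, t, z, p⟩
        change nestRMk T (post T z.down (𝟙 _) (post T f g t)) p =
          nestRMk T (post T (f ≫ z.down) (𝟙 _) t) (Q.map g.op p)
        rw [← nestRMk_dinat, post_post, post_post, Category.comp_id, Category.id_comp,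
          Category.comp_id])
      naturality A B a := by
        ext ⟨k⟩
        exact congr_arg (fun x => nestRMk T x k.snd) (map_post T a _ _ _).symm }
  hom_inv_id := by
    ext A ⟨k⟩
    exact congr_arg (fun x => nestRMk T x k.arg) (post_id T _)
  inv_hom_id := by
    ext A ⟨U, W, t, z, p⟩
    change convMk T (post T z.down (𝟙 _) t) (yoId X) p = convMk T t z p
    rw [convMk_dinat_left]
    congr 1
    exact congr_arg ULift.up (Category.comp_id z.down)

/-- The Yoneda reduction `𝕍(•; X ◁ Y) ≅ 𝕍(•; 𝕍(•; X) ◁ 𝕍(•; Y))`. -/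
def splitIso (X Y : V) : (T.obj X).obj Y ≅ conv T (yo X) (yo Y) where
  hom :=
    { app A := ↾fun t => convMk T t (yoId X) (yoId Y)
      naturality A B a := by ext t; rfl }
  inv :=
    { app A := ↾Quot.lift (fun k => post T k.fst.down k.snd.down k.split) (by
        rintro _ _ ⟨f, g, t, x, y⟩
        exact post_post T _ _ _ _ _)
      naturality A B a := by
        ext ⟨k⟩
        exact (map_post T a _ _ _).symm }
  hom_inv_id := by
    ext A t
    exact post_id T t
  inv_hom_id := by
    ext A ⟨U, W, t, x, y⟩
    change convMk T (post T x.down y.down t) (yoId X) (yoId Y) = convMk T t x y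
    rw [convMk_dinat]
    congr 1
    · exact congr_arg ULift.up (Category.comp_id x.down)
    · exact congr_arg ULift.up (Category.comp_id y.down)

lemma splitIso_natural {X X' Y Y' : V} (f : X ⟶ X') (g : Y ⟶ Y') :
    postHom T f g ≫ (splitIso T X' Y').hom =
      (splitIso T X Y).hom ≫ convMap T (uliftYoneda.{u}.map f) (uliftYoneda.{u}.map g) := by
  ext A t
  change convMk T (post T f g t) _ _ = convMk T t _ _
  rw [convMk_dinat]
  congr 1
  · exact congr_arg ULift.up ((Category.comp_id f).trans (Category.id_comp f).symm)
  · exact congr_arg ULift.up ((Category.comp_id g).trans (Category.id_comp g).symm)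

lemma nestLIso_natural {P P' : Presheaf V} {Z Z' : V} (φ : P ⟶ P') (h : Z ⟶ Z') :
    nestLMap T φ h ≫ (nestLIso T P' Z').hom =
      (nestLIso T P Z).hom ≫ convMap T φ (uliftYoneda.{u}.map h) := by
  ext A ⟨U, t, p⟩
  change convMk T (post T (𝟙 _) h t) (φ.app _ p) _ = convMk T t _ _
  rw [convMk_dinat_right]
  congr 1
  exact congr_arg ULift.up ((Category.comp_id h).trans (Category.id_comp h).symm)

lemma nestRIso_natural {Q Q' : Presheaf V} {X X' : V} (f : X ⟶ X') (χ : Q ⟶ Q') :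
    nestRMap T f χ ≫ (nestRIso T X' Q').hom =
      (nestRIso T X Q).hom ≫ convMap T (uliftYoneda.{u}.map f) χ := by
  ext A ⟨U, t, p⟩
  change convMk T (post T f (𝟙 _) t) _ (χ.app _ p) = convMk T t _ _
  rw [convMk_dinat_left]
  congr 1
  exact congr_arg ULift.up ((Category.comp_id f).trans (Category.id_comp f).symm)

/-! ### Promonoidal data from structure maps at presheaf arguments. -/

/-- Associators and unitors of `conv`, natural in presheaf arguments. -/
structure VirtualData (N : Presheaf V) where
  assoc (P Q R : Presheaf V) : conv T (conv T P Q) R ≅ conv T P (conv T Q R)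
  assoc_natural {P P' Q Q' R R' : Presheaf V} (φ : P ⟶ P') (χ : Q ⟶ Q') (ω : R ⟶ R') :
    convMap T (convMap T φ χ) ω ≫ (assoc P' Q' R').hom =
      (assoc P Q R).hom ≫ convMap T φ (convMap T χ ω)
  left (P : Presheaf V) : conv T N P ≅ P
  left_natural {P P' : Presheaf V} (φ : P ⟶ P') :
    convMap T (𝟙 N) φ ≫ (left P').hom = (left P).hom ≫ φ
  right (P : Presheaf V) : conv T P N ≅ P
  right_natural {P P' : Presheaf V} (φ : P ⟶ P') :
    convMap T φ (𝟙 N) ≫ (right P').hom = (right P).hom ≫ φ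

variable {T} {N : Presheaf V}

namespace VirtualData

variable (D : VirtualData T N)

/-- The associator of splits. -/
def assocIso (X Y Z : V) : nestL T ((T.obj X).obj Y) Z ≅ nestR T X ((T.obj Y).obj Z) :=
  nestLIso T _ Z ≪≫ convIso T (splitIso T X Y) (Iso.refl _) ≪≫ D.assoc (yo X) (yo Y) (yo Z) ≪≫
    (convIso T (Iso.refl _) (splitIso T Y Z)).symm ≪≫ (nestRIso T X _).symm

/-- The definition with the inverses cleared: only forward Yoneda reductions remain, and these have
simple values on representatives. -/
lemma assocIso_eq {X Y Z : V} :
    (D.assocIso X Y Z).hom ≫ (nestRIso T X _).hom ≫ convMap T (𝟙 _) (splitIso T Y Z).hom =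
      (nestLIso T _ Z).hom ≫ convMap T (splitIso T X Y).hom (𝟙 _) ≫
        (D.assoc (yo X) (yo Y) (yo Z)).hom := by
  have : convMap T (𝟙 (yo X)) (splitIso T Y Z).hom =
    (convIso T (Iso.refl (yo X)) (splitIso T Y Z)).hom := rfl
  rw [this, ← Category.assoc, ← Iso.eq_comp_inv, ← Iso.eq_comp_inv]
  simp [assocIso, convIso]

/-- The Yoneda reductions on the target are injective, so the value of the associator on splits can
be tested inside `conv`. -/
lemma assocIso_app_eq_iff {X Y Z : V} {A : Vᵒᵖ} (x : (nestL T ((T.obj X).obj Y) Z).obj A)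
    (y : (nestR T X ((T.obj Y).obj Z)).obj A) :
    (D.assocIso X Y Z).hom.app A x = y ↔
      (D.assoc (yo X) (yo Y) (yo Z)).hom.app A
        ((convMap T (splitIso T X Y).hom (𝟙 _)).app A ((nestLIso T _ Z).hom.app A x)) =
      (convMap T (𝟙 _) (splitIso T Y Z).hom).app A ((nestRIso T X _).hom.app A y) := by
  have h : (convMap T (𝟙 _) (splitIso T Y Z).hom).app A
      ((nestRIso T X _).hom.app A ((D.assocIso X Y Z).hom.app A x)) = _ :=
    types_congr_hom (NatTrans.congr_app (D.assocIso_eq (X := X) (Y := Y) (Z := Z)) A) x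
  refine ⟨fun e => by rw [← e, h]; rfl, fun e => ?_⟩
  have e' := h.trans e
  exact (Iso.toEquiv ((nestRIso T X _ ≪≫
    convIso T (Iso.refl (yo X)) (splitIso T Y Z)).app A)).injective e'

lemma convMap_comp_assoc {P P' P'' Q Q' Q'' R : Presheaf V} (φ : P ⟶ P') (φ' : P' ⟶ P'')
    (χ : Q ⟶ Q') (χ' : Q' ⟶ Q'') (k : conv T P'' Q'' ⟶ R) :
    convMap T φ χ ≫ convMap T φ' χ' ≫ k = convMap T (φ ≫ φ') (χ ≫ χ') ≫ k := by
  rw [convMap_comp, Category.assoc]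

/-- The promonoidal data obtained by restriction to representable presheaves. -/
def toData : PromonoidalData T N where
  assoc := D.assocIso
  assoc_natural {X X' Y Y' Z Z'} f g h := by
    -- After composing with the Yoneda reduction of the target, both sides run through `conv`, where
    -- naturality of `D.assoc` applies.
    rw [← cancel_mono ((nestRIso T X' _).hom ≫ (convIso T (Iso.refl _) (splitIso T Y' Z')).hom)]
    change _ ≫ _ ≫ convMap T (𝟙 _) (splitIso T Y' Z').hom =
      _ ≫ _ ≫ convMap T (𝟙 _) (splitIso T Y' Z').hom
    have e1 := nestRIso_natural T f (postHom T g h)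
    have e2 := nestLIso_natural T (postHom T f g) h
    rw [Category.assoc, assocIso_eq, reassoc_of% e2, Category.assoc, reassoc_of% e1,
      ← convMap_comp, splitIso_natural, Category.comp_id, convMap_comp_assoc,
      splitIso_natural, Category.comp_id]
    have e3 := D.assocIso_eq (X := X) (Y := Y) (Z := Z)
    have e4 : convMap T (uliftYoneda.{u}.map f) ((splitIso T Y Z).hom ≫
        convMap T (uliftYoneda.map g) (uliftYoneda.map h)) =
      convMap T (𝟙 _) (splitIso T Y Z).hom ≫ convMap T (uliftYoneda.{u}.map f)
        (convMap T (uliftYoneda.map g) (uliftYoneda.map h)) := by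
      rw [← convMap_comp, Category.id_comp]
    have e5 := D.assoc_natural (uliftYoneda.{u}.map f) (uliftYoneda.{u}.map g)
      (uliftYoneda.{u}.map h)
    have e6 : convMap T ((splitIso T X Y).hom ≫ convMap T (uliftYoneda.{u}.map f)
        (uliftYoneda.map g)) (uliftYoneda.{u}.map h) =
      convMap T (splitIso T X Y).hom (𝟙 _) ≫ convMap T
        (convMap T (uliftYoneda.map f) (uliftYoneda.map g)) (uliftYoneda.{u}.map h) := by
      rw [← convMap_comp, Category.id_comp]
    rw [e4, reassoc_of% e3, e6, Category.assoc, e5]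
  leftUnitor Y := nestLIso T N Y ≪≫ D.left (yo Y)
  leftUnitor_natural {Y Y'} g := by
    have e := nestLIso_natural T (𝟙 N) g
    simp only [Iso.trans_hom, reassoc_of% e, Category.assoc, D.left_natural]
  rightUnitor X := nestRIso T X N ≪≫ D.right (yo X)
  rightUnitor_natural {X X'} f := by
    have e := nestRIso_natural T f (𝟙 N)
    simp only [Iso.trans_hom, reassoc_of% e, Category.assoc, D.right_natural]

/-- Substituting elements is functoriality along the maps out of representables that classify them;
this brings naturality in presheaf arguments into play. -/
lemma assocPush_eq {P Q R : Presheaf V} {X Y Z : V} (p : P.obj (op X)) (q : Q.obj (op Y))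
    (r : R.obj (op Z)) :
    PromonoidalData.assocPush (T := T) p q r = (nestRIso T X _).hom ≫
      convMap T (𝟙 _) (splitIso T Y Z).hom ≫
        convMap T (classify p) (convMap T (classify q) (classify r)) := by
  ext A ⟨k⟩
  change convMk T k.split p (convMk T k.arg q r) =
    convMk T k.split ((classify p).app _ (yoId X))
      (convMk T k.arg ((classify q).app _ (yoId Y)) ((classify r).app _ (yoId Z)))
  simp only [classify_yoId]

/-- A class in the triple convolution is the image, under the classifying maps of `p`, `q`, `r`, of
a class with universal elements in their place. Both associators are natural and agree on the
latter, hence everywhere. Consequently the coherence axioms may be checked on `D.assoc` itself. -/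
lemma assocConv_toData (P Q R : Presheaf V) :
    D.toData.assocConv P Q R = (D.assoc P Q R).hom := by
  ext A ⟨⟨U, Z, s, ⟨⟨X, Y, t, p, q⟩⟩, r⟩⟩
  change (PromonoidalData.assocPush p q r).app A
    ((D.assocIso X Y Z).hom.app A (nestLMk T s t)) = _
  rw [assocPush_eq]
  have h : (convMap T (𝟙 _) (splitIso T Y Z).hom).app A
      ((nestRIso T X _).hom.app A ((D.assocIso X Y Z).hom.app A (nestLMk T s t))) =
      (D.assoc _ _ _).hom.app A (convMk T s (convMk T t (yoId X) (yoId Y)) (yoId Z)) :=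
    types_congr_hom (NatTrans.congr_app (D.assocIso_eq (X := X) (Y := Y) (Z := Z)) A) _
  change (convMap T (classify p) (convMap T (classify q) (classify r))).app A
    ((convMap T (𝟙 _) (splitIso T Y Z).hom).app A
      ((nestRIso T X _).hom.app A ((D.assocIso X Y Z).hom.app A (nestLMk T s t)))) = _
  -- Naturality moves the classifying maps in front of the associator, where they turn universal
  -- elements back into `p`, `q`, `r`.
  rw [h, ← hom_comm (D.assoc_natural _ _ _), convMap_app, convMap_app]
  simp only [classify_yoId]
  rfl

lemma leftUnitorConv_toData (P : Presheaf V) :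
    D.toData.leftUnitorConv P = (D.left P).hom := by
  ext A ⟨⟨U, Z, s, n, p⟩⟩
  change (classify p).app A ((D.left (yo Z)).hom.app A (convMk T s n (yoId Z))) = _
  rw [← hom_comm (D.left_natural _), convMap_app, classify_yoId]
  rfl

lemma rightUnitorConv_toData (P : Presheaf V) :
    D.toData.rightUnitorConv P = (D.right P).hom := by
  ext A ⟨⟨U, Z, s, p, n⟩⟩
  change (classify p).app A ((D.right (yo U)).hom.app A (convMk T s (yoId U) n)) = _
  rw [← hom_comm (D.right_natural _), convMap_app, classify_yoId]
  rfl

end VirtualData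

/-! ### Interchange maps at presheaf arguments. -/

/-- A laxator for `conv`, natural in presheaf arguments. -/
structure VirtualLaxator (Tp Ts : Protensor V) where
  hom (P Q R S : Presheaf V) :
    conv Tp (conv Ts P Q) (conv Ts R S) ⟶ conv Ts (conv Tp P R) (conv Tp Q S)
  natural {P P' Q Q' R R' S S' : Presheaf V} (φ : P ⟶ P') (χ : Q ⟶ Q') (ω : R ⟶ R') (σ : S ⟶ S') :
    convMap Tp (convMap Ts φ χ) (convMap Ts ω σ) ≫ hom P' Q' R' S' =
      hom P Q R S ≫ convMap Ts (convMap Tp φ ω) (convMap Tp χ σ)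

namespace VirtualLaxator

variable {Tp Ts : Protensor V} (L : VirtualLaxator Tp Ts)

/-- The restriction of a laxator to representable presheaves. -/
def split (X Y Z W : V) :
    conv Tp ((Ts.obj X).obj Y) ((Ts.obj Z).obj W) ⟶
      conv Ts ((Tp.obj X).obj Z) ((Tp.obj Y).obj W) :=
  convMap Tp (splitIso Ts X Y).hom (splitIso Ts Z W).hom ≫ L.hom _ _ _ _ ≫
    convMap Ts (splitIso Tp X Z).inv (splitIso Tp Y W).inv

lemma split_eq (X Y Z W : V) :
    L.split X Y Z W ≫ convMap Ts (splitIso Tp X Z).hom (splitIso Tp Y W).hom =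
      convMap Tp (splitIso Ts X Y).hom (splitIso Ts Z W).hom ≫ L.hom _ _ _ _ := by
  simp [split, ← convMap_comp, convMap_id]

lemma split_app_eq_iff {X Y Z W : V} {A : Vᵒᵖ}
    (x : (conv Tp ((Ts.obj X).obj Y) ((Ts.obj Z).obj W)).obj A)
    (y : (conv Ts ((Tp.obj X).obj Z) ((Tp.obj Y).obj W)).obj A) :
    (L.split X Y Z W).app A x = y ↔
      (L.hom _ _ _ _).app A ((convMap Tp (splitIso Ts X Y).hom (splitIso Ts Z W).hom).app A x) =
        (convMap Ts (splitIso Tp X Z).hom (splitIso Tp Y W).hom).app A y := by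
  rw [← hom_comm (L.split_eq X Y Z W)]
  exact (Iso.toEquiv
    ((convIso Ts (splitIso Tp X Z) (splitIso Tp Y W)).app A)).injective.eq_iff.symm

/-- Once the isomorphism on the target is cancelled, this is naturality of the laxator at
representables combined with naturality of `splitIso` on either side. -/
lemma split_natural {X X' Y Y' Z Z' W W' : V} (f : X ⟶ X') (g : Y ⟶ Y') (h : Z ⟶ Z')
    (k : W ⟶ W') :
    convMap Tp (postHom Ts f g) (postHom Ts h k) ≫ L.split X' Y' Z' W' =
      L.split X Y Z W ≫ convMap Ts (postHom Tp f h) (postHom Tp g k) := by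
  rw [← cancel_mono (convIso Ts (splitIso Tp X' Z') (splitIso Tp Y' W')).hom]
  change _ ≫ convMap Ts (splitIso Tp X' Z').hom (splitIso Tp Y' W').hom =
    _ ≫ convMap Ts (splitIso Tp X' Z').hom (splitIso Tp Y' W').hom
  rw [Category.assoc, split_eq, Category.assoc, ← convMap_comp, splitIso_natural,
    splitIso_natural, convMap_comp, ← Category.assoc (L.split _ _ _ _), split_eq, Category.assoc,
    ← L.natural, ← Category.assoc, ← Category.assoc, ← convMap_comp, ← convMap_comp,
    splitIso_natural, splitIso_natural]

lemma psi₂Push_eq {P Q R S : Presheaf V} {X Y Z W : V} (p : P.obj (op X)) (q : Q.obj (op Y))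
    (r : R.obj (op Z)) (s : S.obj (op W)) :
    ProduoidalData.psi₂Push (Tp := Tp) (Ts := Ts) p q r s =
      convMap Ts (splitIso Tp X Z).hom (splitIso Tp Y W).hom ≫
        convMap Ts (convMap Tp (classify p) (classify r)) (convMap Tp (classify q) (classify s)) := by
  ext A ⟨k⟩
  change convMk Ts k.split (convMk Tp k.fst p r) (convMk Tp k.snd q s) =
    convMk Ts k.split (convMk Tp k.fst ((classify p).app _ (yoId X)) ((classify r).app _ (yoId Z)))
      (convMk Tp k.snd ((classify q).app _ (yoId Y)) ((classify s).app _ (yoId W)))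
  simp only [classify_yoId]

/-- The same Yoneda argument as for the associator: a laxator natural in presheaves is determined by
its values on universal elements. -/
lemma psi₂Conv_eq {I N : Presheaf V} (S : ProduoidalData Tp I Ts N)
    (hS : S.psi₂ = L.split) (P Q R T : Presheaf V) : S.psi₂Conv P Q R T = L.hom P Q R T := by
  ext A ⟨⟨U, K, s, ⟨⟨X, Y, a, p, q⟩⟩, ⟨⟨Z, W, b, r, t⟩⟩⟩⟩
  change (ProduoidalData.psi₂Push p q r t).app A ((S.psi₂ X Y Z W).app A (convMk Tp s a b)) = _
  rw [psi₂Push_eq, hS]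
  change (convMap Ts _ _).app A ((convMap Ts _ _).app A _) = _
  rw [hom_comm (L.split_eq X Y Z W), convMap_app, ← hom_comm (L.natural _ _ _ _)]
  change (L.hom P Q R T).app A (convMk Tp s
    (convMk Ts a ((classify p).app _ (yoId X)) ((classify q).app _ (yoId Y)))
    (convMk Ts b ((classify r).app _ (yoId Z)) ((classify t).app _ (yoId W)))) = _
  simp only [classify_yoId]
  rfl

end VirtualLaxator

end Virtual

end Produoidal

namespace MCtx

variable {C : Type u} [Category.{v} C] [MonoidalCategory C]

/-! ### Generating contexts -/

lemma ctx_eq {A X : MCtx C} {M M' N N' : C} (m : M ⟶ M') (n : N ⟶ N')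
    {f : A.dom ⟶ M ⊗ X.dom ⊗ N} {f' : A.dom ⟶ M' ⊗ X.dom ⊗ N'}
    {g : M ⊗ X.cod ⊗ N ⟶ A.cod} {g' : M' ⊗ X.cod ⊗ N' ⟶ A.cod}
    (hf : f' = f ≫ side m X.dom n) (hg : g = side m X.cod n ≫ g') :
    ctx f' g' = ctx f g :=
  Quot.sound (HomRel.of_eq m n hf hg)

/-- The context `f ⨾ ■ ⨾ g`. -/
def pl {A A' B B' : C} (f : A ⟶ B) (g : B' ⟶ A') : (⟨A, A'⟩ : MCtx C) ⟶ ⟨B, B'⟩ :=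
  ctx (M := 𝟙_ C) (N := 𝟙_ C) (f ≫ (λ_ B).inv ≫ 𝟙_ C ◁ (ρ_ B).inv)
    (𝟙_ C ◁ (ρ_ B').hom ≫ (λ_ B').hom ≫ g)

/-- The context `M ⊗ ■`. -/
def sL (M A A' : C) : (⟨M ⊗ A, M ⊗ A'⟩ : MCtx C) ⟶ ⟨A, A'⟩ :=
  ctx (M := M) (N := 𝟙_ C) (M ◁ (ρ_ A).inv) (M ◁ (ρ_ A').hom)

/-- The context `■ ⊗ N`. -/
def sR (A A' N : C) : (⟨A ⊗ N, A' ⊗ N⟩ : MCtx C) ⟶ ⟨A, A'⟩ :=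
  ctx (M := 𝟙_ C) (N := N) (λ_ (A ⊗ N)).inv (λ_ (A' ⊗ N)).hom

/-- The factorisation into generators on which every naturality check below rests. -/
lemma ctx_eq_comp {A X : MCtx C} {M N : C} (f : A.dom ⟶ M ⊗ X.dom ⊗ N)
    (g : M ⊗ X.cod ⊗ N ⟶ A.cod) :
    ctx f g = (pl f g : A ⟶ _) ≫ sL M _ _ ≫ sR X.dom X.cod N := by
  -- Composition leaves the side objects `𝟙_ C ⊗ (M ⊗ 𝟙_ C)` and `(N ⊗ 𝟙_ C) ⊗ 𝟙_ C`; dinaturality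
  -- along unitors removes the units. The unitors and associators given as witnesses in the lemmas
  -- below play the same role.
  refine ctx_eq ((λ_ _).hom ≫ (ρ_ _).hom) ((ρ_ _).hom ≫ (ρ_ _).hom) ?_ ?_ <;>
    simp only [HomRep.comp, side_eq, monoidalComp] <;> monoidal

lemma pl_id (A A' : C) : pl (𝟙 A) (𝟙 A') = 𝟙 (⟨A, A'⟩ : MCtx C) := by
  refine ctx_eq (𝟙 _) (𝟙 _) ?_ ?_ <;>
    simp only [side_eq, monoidalComp] <;> monoidal

lemma pl_comp_ctx {A A' : C} {B X : MCtx C} {M N : C} (a : A ⟶ B.dom) (b : B.cod ⟶ A')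
    (f : B.dom ⟶ M ⊗ X.dom ⊗ N) (g : M ⊗ X.cod ⊗ N ⟶ B.cod) :
    (pl a b : _ ⟶ B) ≫ ctx f g = ctx (A := ⟨A, A'⟩) (a ≫ f) (g ≫ b) := by
  refine Eq.symm (ctx_eq (λ_ _).hom (ρ_ _).hom ?_ ?_) <;>
    simp only [side_eq, monoidalComp] <;> monoidal

lemma pl_pl {A A' B B' D D' : C} (f : A ⟶ B) (g : B' ⟶ A') (f' : B ⟶ D) (g' : D' ⟶ B') :
    pl f g ≫ pl f' g' = pl (f ≫ f') (g' ≫ g) :=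
  (pl_comp_ctx (B := ⟨B, B'⟩) f g _ _).trans (by simp [pl])

lemma ctx_dinat {A X : MCtx C} {M M' N N' : C} (m : M ⟶ M') (n : N ⟶ N')
    (f : A.dom ⟶ M ⊗ X.dom ⊗ N) (g : M' ⊗ X.cod ⊗ N' ⟶ A.cod) :
    ctx (f ≫ side m X.dom n) g = ctx f (side m X.cod n ≫ g) :=
  ctx_eq m n rfl rfl

/-- This relation and the next ones suffice to bring a composite of generators to the order plain,
left whiskering, right whiskering. -/
lemma sL_pl {A A' B B' : C} (M : C) (f : A ⟶ B) (g : B' ⟶ A') :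
    sL M A A' ≫ pl f g = pl (M ◁ f) (M ◁ g) ≫ sL M B B' := by
  refine ctx_eq ((λ_ M).hom ≫ (ρ_ M).inv) (𝟙 (𝟙_ C ⊗ 𝟙_ C)) ?_ ?_ <;>
    simp only [side_eq, monoidalComp] <;> monoidal

lemma sR_pl {A A' B B' : C} (N : C) (f : A ⟶ B) (g : B' ⟶ A') :
    sR A A' N ≫ pl f g = pl (f ▷ N) (g ▷ N) ≫ sR B B' N := by
  refine ctx_eq (𝟙 (𝟙_ C ⊗ 𝟙_ C)) ((ρ_ N).hom ≫ (λ_ N).inv) ?_ ?_ <;>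
    simp only [side_eq, monoidalComp] <;> monoidal

/-- What remains of dinaturality in `M` after factoring: a morphism beside the hole may be run
before or after it. -/
lemma sL_dinat {A A' M M' : C} (m : M ⟶ M') :
    pl (m ▷ A) (𝟙 (M' ⊗ A')) ≫ sL M' A A' = pl (𝟙 _) (m ▷ A') ≫ sL M A A' := by
  refine ctx_eq (𝟙_ C ◁ m) (𝟙 _) ?_ ?_ <;>
    simp only [side_eq] <;> monoidal

lemma sR_dinat {A A' N N' : C} (n : N ⟶ N') :
    pl (A ◁ n) (𝟙 (A' ⊗ N')) ≫ sR A A' N' = pl (𝟙 _) (A' ◁ n) ≫ sR A A' N := by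
  refine ctx_eq (𝟙 _) (n ▷ 𝟙_ C) ?_ ?_ <;>
    simp only [side_eq] <;> monoidal

lemma sR_sL (M A A' N : C) :
    sR (M ⊗ A) (M ⊗ A') N ≫ sL M A A' =
      pl (α_ M A N).hom (α_ M A' N).inv ≫ sL M _ _ ≫ sR A A' N := by
  refine ctx_eq ((λ_ _).hom ≫ (ρ_ _).hom ≫ (λ_ _).inv)
    ((ρ_ _).hom ≫ (ρ_ _).hom ≫ (λ_ _).inv) ?_ ?_ <;>
    simp only [HomRep.comp, side_eq, monoidalComp] <;> monoidal

lemma sL_sL (M M' A A' : C) :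
    sL M (M' ⊗ A) (M' ⊗ A') ≫ sL M' A A' =
      pl (α_ M M' A).inv (α_ M M' A').hom ≫ sL (M ⊗ M') A A' := by
  refine ctx_eq (λ_ _).hom (𝟙 _) ?_ ?_ <;>
    simp only [side_eq, monoidalComp] <;> monoidal

lemma sR_sR (A A' N N' : C) :
    sR (A ⊗ N') (A' ⊗ N') N ≫ sR A A' N' =
      pl (α_ A N' N).hom (α_ A' N' N).inv ≫ sR A A' (N' ⊗ N) := by
  refine ctx_eq (𝟙 _) (ρ_ _).hom ?_ ?_ <;>
    simp only [side_eq, monoidalComp] <;> monoidal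

lemma sL_unit (A A' : C) : sL (𝟙_ C) A A' = pl (λ_ A).hom (λ_ A').inv := by
  refine ctx_eq (𝟙 _) (𝟙 _) ?_ ?_ <;>
    simp only [side_eq] <;> monoidal

lemma sR_unit (A A' : C) : sR A A' (𝟙_ C) = pl (ρ_ A).hom (ρ_ A').inv := by
  refine ctx_eq (𝟙 _) (𝟙 _) ?_ ?_ <;>
    simp only [side_eq] <;> monoidal

/-- The context `M ⊗ ■ ⊗ N`. -/
def st (M : C) (X : MCtx C) (N : C) : (⟨M ⊗ X.dom ⊗ N, M ⊗ X.cod ⊗ N⟩ : MCtx C) ⟶ X :=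
  ctx (A := ⟨_, _⟩) (𝟙 _) (𝟙 _)

lemma st_dinat {X : MCtx C} {M M' N N' : C} (m : M ⟶ M') (n : N ⟶ N') :
    pl (side m X.dom n) (𝟙 _) ≫ st M' X N' = pl (𝟙 _) (side m X.cod n) ≫ st M X N := by
  refine (pl_comp_ctx (B := ⟨_, _⟩) _ _ _ _).trans
    (Eq.trans ?_ (pl_comp_ctx (B := ⟨_, _⟩) _ _ _ _).symm)
  simpa using ctx_dinat (A := ⟨_, _⟩) m n (𝟙 (M ⊗ X.dom ⊗ N)) (𝟙 _)

/-- Separates the side objects from the morphisms when the hole of `M ⊗ ■ ⊗ N` is filled; needed for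
the independence of representatives in `parLift`. -/
lemma st_comp_ctx {X Y : MCtx C} {M N P Q : C} (f : X.dom ⟶ P ⊗ Y.dom ⊗ Q)
    (g : P ⊗ Y.cod ⊗ Q ⟶ X.cod) :
    st M X N ≫ ctx f g = pl (M ◁ f ▷ N ⊗≫ 𝟙 ((M ⊗ P) ⊗ Y.dom ⊗ Q ⊗ N))
      (𝟙 ((M ⊗ P) ⊗ Y.cod ⊗ Q ⊗ N) ⊗≫ M ◁ g ▷ N) ≫ st (M ⊗ P) Y (Q ⊗ N) := by
  refine Eq.trans ?_ (pl_comp_ctx (B := ⟨_, _⟩) _ _ _ _).symm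
  refine ctx_eq (𝟙 _) (𝟙 _) ?_ ?_ <;> simp [side, monoidalComp]

lemma sR_comp_ctx {X Y : MCtx C} {N P Q : C} (f : X.dom ⟶ P ⊗ Y.dom ⊗ Q)
    (g : P ⊗ Y.cod ⊗ Q ⟶ X.cod) :
    sR X.dom X.cod N ≫ ctx f g = pl (f ▷ N ⊗≫ 𝟙 (P ⊗ Y.dom ⊗ Q ⊗ N))
      (𝟙 (P ⊗ Y.cod ⊗ Q ⊗ N) ⊗≫ g ▷ N) ≫ sL P _ _ ≫ sR Y.dom Y.cod (Q ⊗ N) := by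
  refine Eq.trans ?_ (ctx_eq_comp (A := ⟨_, _⟩) _ _)
  refine ctx_eq (λ_ _).inv (𝟙 _) ?_ ?_ <;>
    simp only [side_eq, monoidalComp] <;> monoidal

lemma sR_st (M N N' : C) (X : MCtx C) :
    sR _ _ N' ≫ st M X N = pl (𝟙 _ ⊗≫ 𝟙 (M ⊗ X.dom ⊗ N ⊗ N')) (𝟙 (M ⊗ X.cod ⊗ N ⊗ N') ⊗≫ 𝟙 _) ≫
      st M X (N ⊗ N') := by
  refine Eq.trans ?_ (pl_comp_ctx (B := ⟨_, _⟩) _ _ _ _).symm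
  refine ctx_eq (λ_ _).inv (𝟙 _) ?_ ?_ <;>
    simp only [side_eq, monoidalComp] <;> monoidal

/-! ### The action of contexts on presheaves -/

/-- The action of a morphism on an element of a presheaf. -/
def act {P : Presheaf (MCtx C)} {A B : MCtx C} (c : A ⟶ B) (p : P.obj (op B)) : P.obj (op A) :=
  P.map c.op p

section Act

variable {P Q : Presheaf (MCtx C)}

lemma act_act {A B D : MCtx C} (c : A ⟶ B) (d : B ⟶ D) (p : P.obj (op D)) :
    act c (act d p) = act (c ≫ d) p := by simp [act]

lemma act_id {A : MCtx C} (p : P.obj (op A)) : act (𝟙 A) p = p := by simp [act]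

lemma app_act (φ : P ⟶ Q) {A B : MCtx C} (c : A ⟶ B) (p : P.obj (op B)) :
    φ.app _ (act c p) = act c (φ.app _ p) := NatTrans.naturality_apply φ c.op p

lemma act_pl_id {A A' : C} (p : P.obj (op ⟨A, A'⟩)) : act (pl (𝟙 A) (𝟙 A')) p = p := by
  rw [pl_id, act_id]

lemma act_pl_pl {A A' B B' D D' : C} (f : A ⟶ B) (g : B' ⟶ A') (f' : B ⟶ D) (g' : D' ⟶ B')
    (p : P.obj (op ⟨D, D'⟩)) :
    act (pl f g) (act (pl f' g') p) = act (pl (f ≫ f') (g' ≫ g)) p := by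
  rw [act_act, pl_pl]

/-- A family of maps of presheaves is natural if it commutes with the generating contexts. -/
def homOfGenerators (F : ∀ A A' : C, P.obj (op ⟨A, A'⟩) → Q.obj (op ⟨A, A'⟩))
    (hpl : ∀ {A A' B B' : C} (f : A ⟶ B) (g : B' ⟶ A') (p : P.obj (op ⟨B, B'⟩)),
      F A A' (act (pl f g) p) = act (pl f g) (F B B' p))
    (hL : ∀ (M A A' : C) (p : P.obj (op ⟨A, A'⟩)),
      F _ _ (act (sL M A A') p) = act (sL M A A') (F A A' p))
    (hR : ∀ (A A' N : C) (p : P.obj (op ⟨A, A'⟩)),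
      F _ _ (act (sR A A' N) p) = act (sR A A' N) (F A A' p)) : P ⟶ Q where
  app A := ↾F A.unop.dom A.unop.cod
  naturality := by
    rintro ⟨B⟩ ⟨A⟩ ⟨⟨c⟩⟩
    ext p
    change F A.dom A.cod (act (ctx c.f c.g) p) = act (ctx c.f c.g) (F B.dom B.cod p)
    rw [ctx_eq_comp, ← act_act, ← act_act, ← act_act, ← act_act]
    exact (hpl _ _ _).trans (congr_arg _ ((hL _ _ _ _).trans (congr_arg _ (hR _ _ _ _))))

lemma homOfGenerators_app (F : ∀ A A' : C, P.obj (op ⟨A, A'⟩) → Q.obj (op ⟨A, A'⟩)) (hpl) (hL)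
    (hR) (A A' : C) (p : P.obj (op ⟨A, A'⟩)) :
    (homOfGenerators F hpl hL hR).app _ p = F A A' p := rfl

end Act

/-! ### Sequential composites of presheaves -/

/-- The representative of `cut`. -/
def cutRep (A B A' : C) : SeqRep (⟨A, A'⟩ : MCtx C) ⟨A, B⟩ ⟨B, A'⟩ where
  M := 𝟙_ C
  N := 𝟙_ C
  K := 𝟙_ C
  L := 𝟙_ C
  f := (λ_ A).inv ≫ 𝟙_ C ◁ (ρ_ A).inv
  g := 𝟙 _
  h := 𝟙_ C ◁ (ρ_ A').hom ≫ (λ_ A').hom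

/-- The split of `(A, A')` into `(A, B)` and `(B, A')`. -/
def cut (A B A' : C) : Seq (⟨A, A'⟩ : MCtx C) ⟨A, B⟩ ⟨B, A'⟩ := Quot.mk _ (cutRep A B A')

/-- Cutting right after the first hole separates the two holes: `f` belongs to the first piece, and
`g`, `h` to the second. Hence cuts generate all sequential splits. -/
lemma seqSplit_eq_post_cut {A X Y : MCtx C} {M N K L : C} (f : A.dom ⟶ M ⊗ X.dom ⊗ N)
    (g : M ⊗ X.cod ⊗ N ⟶ K ⊗ Y.dom ⊗ L) (h : K ⊗ Y.cod ⊗ L ⟶ A.cod) :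
    (seqSplit f g h : Seq A X Y) =
      Seq.post₂ (Seq.post₁ (cut A.dom (M ⊗ X.cod ⊗ N) A.cod) (ctx (A := ⟨A.dom, _⟩) f (𝟙 _)))
        (ctx (A := ⟨_, A.cod⟩) g h) := by
  refine (seqSplit_eq₁ (λ_ _).hom (ρ_ _).hom ?_ rfl).trans
    (seqSplit_eq₂ (λ_ _).hom (ρ_ _).hom ?_ ?_) <;>
    simp only [side_eq, SeqRep.post₁, cutRep, monoidalComp] <;> monoidal

/-- A morphism at the cut may close the first piece or open the second. For sequential composites
this is the only relation. -/
lemma cut_dinat {A A' B B' : C} (b : B ⟶ B') :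
    Seq.post₁ (cut A B' A') (pl (𝟙 A) b) = Seq.post₂ (cut A B A') (pl b (𝟙 A')) := by
  refine (seqSplit_eq₁ (λ_ _).inv (ρ_ _).inv ?_ rfl).trans
    (seqSplit_eq₂ (λ_ _).hom (ρ_ _).hom ?_ ?_) <;>
    simp only [side_eq, cutRep, monoidalComp] <;> monoidal

lemma pre_ctx_cut {A X : MCtx C} {M N : C} (B : C) (f : A.dom ⟶ M ⊗ X.dom ⊗ N)
    (g : M ⊗ X.cod ⊗ N ⟶ A.cod) :
    Seq.pre (ctx f g) (cut X.dom B X.cod) =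
      Seq.post₂ (Seq.post₁ (cut A.dom (M ⊗ B ⊗ N) A.cod)
        (ctx (A := ⟨A.dom, _⟩) (X := ⟨X.dom, B⟩) f (𝟙 _)))
        (ctx (A := ⟨_, A.cod⟩) (X := ⟨B, X.cod⟩) (𝟙 _) g) := by
  have e : Seq.pre (ctx f g) (cut X.dom B X.cod) = seqSplit
      (SeqRep.pre ⟨f, g⟩ (cutRep X.dom B X.cod)).f (SeqRep.pre ⟨f, g⟩ (cutRep X.dom B X.cod)).g
      (SeqRep.pre ⟨f, g⟩ (cutRep X.dom B X.cod)).h := rfl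
  rw [e]
  refine Eq.trans ?_ (seqSplit_eq_post_cut (X := ⟨X.dom, B⟩) (Y := ⟨B, X.cod⟩) f (𝟙 _) g)
  refine (seqSplit_eq₁ (ρ_ _).inv (λ_ _).inv ?_ rfl).trans
    (seqSplit_eq₂ (ρ_ _).inv (λ_ _).inv ?_ ?_) <;>
    simp only [side_eq, SeqRep.pre, cutRep, monoidalComp] <;> monoidal

/-! ### Parallel composites of presheaves -/

/-- The split of `(A, A')` into `(S, S')` and `(T, T')`. -/
def join {A A' S S' T T' : C} (f : A ⟶ S ⊗ T) (g : S' ⊗ T' ⟶ A') :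
    Par (⟨A, A'⟩ : MCtx C) ⟨S, S'⟩ ⟨T, T'⟩ :=
  parSplit (M := 𝟙_ C) (N := 𝟙_ C) (O := 𝟙_ C)
    (f ⊗≫ 𝟙 (𝟙_ C ⊗ S ⊗ 𝟙_ C ⊗ T ⊗ 𝟙_ C)) (𝟙 (𝟙_ C ⊗ S' ⊗ 𝟙_ C ⊗ T' ⊗ 𝟙_ C) ⊗≫ g)

/-- The side object `N` between the holes has to go to one of the two factors; it is given to the
first. -/
lemma parSplit_eq_post_join {A X Y : MCtx C} {M N O : C}
    (f : A.dom ⟶ M ⊗ X.dom ⊗ N ⊗ Y.dom ⊗ O) (g : M ⊗ X.cod ⊗ N ⊗ Y.cod ⊗ O ⟶ A.cod) :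
    (parSplit f g : Par A X Y) = Par.post₂ (Par.post₁
      (join (S := M ⊗ X.dom ⊗ N) (T := Y.dom ⊗ O) (S' := M ⊗ X.cod ⊗ N) (T' := Y.cod ⊗ O)
        (f ⊗≫ 𝟙 _) (𝟙 _ ⊗≫ g))
      (ctx (A := ⟨_, _⟩) (𝟙 _) (𝟙 _))) (sR Y.dom Y.cod O) := by
  refine parSplit_eq (λ_ M).hom ((ρ_ _).hom ≫ (ρ_ _).hom) ((ρ_ _).hom) ?_ ?_ <;>
    simp only [side₂_eq, ParRep.post₁, monoidalComp] <;> monoidal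

lemma join_pl {A A' S S' T T' P P' Q Q' : C} (f : A ⟶ S ⊗ T) (g : S' ⊗ T' ⟶ A') (s : S ⟶ P)
    (s' : P' ⟶ S') (t : T ⟶ Q) (t' : Q' ⟶ T') :
    Par.post₂ (Par.post₁ (join f g) (pl s s')) (pl t t') =
      join (f ≫ (s ⊗ₘ t)) ((s' ⊗ₘ t') ≫ g) := by
  refine parSplit_eq (λ_ _).inv ((λ_ (𝟙_ C)).inv ≫ (λ_ _).inv ▷ 𝟙_ C) (λ_ _).inv ?_ ?_
  -- The holes are filled in turn, so `s` comes before `t` on the way in and `t'` before `s'` on the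
  -- way out. The two expansions of a tensor of morphisms are chosen accordingly.
  · simp only [side₂_eq, ParRep.post₁, monoidalComp, MonoidalCategory.tensorHom_def]; monoidal
  · simp only [side₂_eq, ParRep.post₁, monoidalComp, MonoidalCategory.tensorHom_def']; monoidal

/-- A side object between the holes belongs equally to either factor; this is the balancing over
`C`. -/
lemma join_slide {A A' S S' T T' N : C} (f : A ⟶ (S ⊗ N) ⊗ T) (g : (S' ⊗ N) ⊗ T' ⟶ A') :
    Par.post₁ (join f g) (sR S S' N) =
      Par.post₂ (join (f ≫ (α_ S N T).hom) ((α_ S' N T').inv ≫ g)) (sL N T T') := by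
  refine parSplit_eq (λ_ _).inv ((λ_ _).hom ≫ (ρ_ _).inv) (λ_ _).hom ?_ ?_ <;>
    simp only [side₂_eq, monoidalComp] <;> monoidal

lemma pre_pl_join {A A' B B' S S' T T' : C} (a : B ⟶ A) (a' : A' ⟶ B') (f : A ⟶ S ⊗ T)
    (g : S' ⊗ T' ⟶ A') :
    Par.pre (pl a a') (join f g) = join (a ≫ f) (g ≫ a') := by
  refine parSplit_eq (λ_ _).inv (𝟙 _) (λ_ _).inv ?_ ?_ <;>
    simp only [side₂_eq, monoidalComp] <;> monoidal

lemma pre_sL_join {A A' S S' T T' : C} (M : C) (f : A ⟶ S ⊗ T) (g : S' ⊗ T' ⟶ A') :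
    Par.pre (sL M A A') (join f g) =
      Par.post₁ (join (M ◁ f ≫ (α_ M S T).inv) ((α_ M S' T').hom ≫ M ◁ g)) (sL M S S') := by
  refine parSplit_eq ((λ_ _).hom ≫ (ρ_ _).inv) (λ_ _).hom (λ_ _).inv ?_ ?_ <;>
    simp only [side₂_eq, monoidalComp] <;> monoidal

lemma pre_sR_join {A A' S S' T T' : C} (N : C) (f : A ⟶ S ⊗ T) (g : S' ⊗ T' ⟶ A') :
    Par.pre (sR A A' N) (join f g) =
      Par.post₂ (join (f ▷ N ≫ (α_ S T N).hom) ((α_ S' T' N).inv ≫ g ▷ N)) (sR T T' N) := by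
  refine parSplit_eq (λ_ _).inv (ρ_ _).hom ((ρ_ _).hom ≫ (λ_ _).inv) ?_ ?_ <;>
    simp only [side₂_eq, monoidalComp] <;> monoidal

lemma pre_pl_cut {A A' D D' : C} (B : C) (a : D ⟶ A) (a' : A' ⟶ D') :
    Seq.pre (pl a a') (cut A B A') =
      Seq.post₂ (Seq.post₁ (cut D B D') (pl a (𝟙 B))) (pl (𝟙 B) a') := by
  let s := SeqRep.pre (B := ⟨D, D'⟩) ⟨a ≫ (λ_ A).inv ≫ 𝟙_ C ◁ (ρ_ A).inv, 𝟙_ C ◁ (ρ_ A').hom ≫ (λ_ A').hom ≫ a'⟩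
    (cutRep A B A')
  change seqSplit s.f s.g s.h = _
  refine (seqSplit_eq₁ (𝟙 _) (𝟙 _) ?_ rfl).trans (seqSplit_eq₂ (𝟙 _) (𝟙 _) ?_ ?_) <;>
    simp only [s, side_eq, SeqRep.pre, SeqRep.post₁, cutRep, monoidalComp] <;> monoidal

lemma pre_sL_cut (M A B A' : C) :
    Seq.pre (sL M A A') (cut A B A') =
      Seq.post₂ (Seq.post₁ (cut (M ⊗ A) (M ⊗ B) (M ⊗ A')) (sL M A B)) (sL M B A') := by
  let s := SeqRep.pre (B := ⟨_, _⟩) ⟨M ◁ (ρ_ A).inv, M ◁ (ρ_ A').hom⟩ (cutRep A B A')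
  change seqSplit s.f s.g s.h = _
  refine (seqSplit_eq₁ ((λ_ M).hom ≫ (ρ_ M).inv) (𝟙 _) ?_ rfl).trans
    (seqSplit_eq₂ ((λ_ M).hom ≫ (ρ_ M).inv) (𝟙 _) ?_ ?_) <;>
    simp only [s, side_eq, SeqRep.pre, SeqRep.post₁, cutRep, monoidalComp] <;> monoidal

lemma pre_sR_cut (A B A' N : C) :
    Seq.pre (sR A A' N) (cut A B A') =
      Seq.post₂ (Seq.post₁ (cut (A ⊗ N) (B ⊗ N) (A' ⊗ N)) (sR A B N)) (sR B A' N) := by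
  let s := SeqRep.pre (B := ⟨_, _⟩) ⟨(λ_ (A ⊗ N)).inv, (λ_ (A' ⊗ N)).hom⟩ (cutRep A B A')
  change seqSplit s.f s.g s.h = _
  refine (seqSplit_eq₁ (𝟙 _) ((ρ_ N).hom ≫ (λ_ N).inv) ?_ rfl).trans
    (seqSplit_eq₂ (𝟙 _) ((ρ_ N).hom ≫ (λ_ N).inv) ?_ ?_) <;>
    simp only [s, side_eq, SeqRep.pre, SeqRep.post₁, cutRep, monoidalComp] <;> monoidal

/-! ### Sequential convolution as composition of profunctors. -/

section SeqK

variable {P Q : Presheaf (MCtx C)} {A A' : C}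

/-- The class of `(p, q)`, for `p` in `P(A, B)` and `q` in `Q(B, A')`. -/
def seqK (B : C) (p : P.obj (op ⟨A, B⟩)) (q : Q.obj (op ⟨B, A'⟩)) :
    (conv (seq C) P Q).obj (op ⟨A, A'⟩) := convMk (seq C) (cut A B A') p q

lemma seqK_dinat {B B' : C} (b : B ⟶ B') (p : P.obj (op ⟨A, B⟩)) (q : Q.obj (op ⟨B', A'⟩)) :
    seqK B' (act (pl (𝟙 A) b) p) q = seqK B p (act (pl b (𝟙 A')) q) := by
  refine (convMk_dinat_left (seq C) (pl (𝟙 A) b) (cut A B' A') p q).symm.trans ?_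
  refine Eq.trans ?_ (convMk_dinat_right (seq C) (pl b (𝟙 A')) (cut A B A') p q)
  refine congr_arg (fun t => convMk (seq C) t p q) ?_
  refine (Seq.post₂_id (Seq.post₁ (cut A B' A') (pl (𝟙 A) b))).trans ((cut_dinat b).trans ?_)
  exact congr_arg (fun t => Seq.post₂ t (pl b (𝟙 A'))) (Seq.post₁_id _).symm

/-- Normal form of a representative: the contexts around the holes are absorbed into `p` and `q`,
and only a cut is left. -/
lemma convMk_seqSplit {X Y : MCtx C} {M N K L : C} (f : A ⟶ M ⊗ X.dom ⊗ N)
    (g : M ⊗ X.cod ⊗ N ⟶ K ⊗ Y.dom ⊗ L) (h : K ⊗ Y.cod ⊗ L ⟶ A') (p : P.obj (op X))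
    (q : Q.obj (op Y)) :
    convMk (seq C) (A := op ⟨A, A'⟩) (seqSplit (A := ⟨A, A'⟩) f g h) p q =
      seqK (M ⊗ X.cod ⊗ N) (act (ctx (A := ⟨A, _⟩) f (𝟙 _)) p)
        (act (ctx (A := ⟨_, A'⟩) g h) q) := by
  rw [seqSplit_eq_post_cut]
  exact convMk_dinat (seq C) (ctx (A := ⟨A, _⟩) f (𝟙 _)) (ctx (A := ⟨_, A'⟩) g h)
    (cut A (M ⊗ X.cod ⊗ N) A') p q

lemma seqK_surj (x : (conv (seq C) P Q).obj (op ⟨A, A'⟩)) : ∃ B p q, x = seqK B p q := by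
  obtain ⟨X, Y, ⟨s⟩, p, q⟩ := x
  exact ⟨_, _, _, convMk_seqSplit s.f s.g s.h p q⟩

/-- Whiskering distributes over composition: the side objects accompany both pieces, `f` is spent on
the first and `g` on the second. -/
lemma act_ctx_seqK {D : MCtx C} {M N B : C} (f : D.dom ⟶ M ⊗ A ⊗ N) (g : M ⊗ A' ⊗ N ⟶ D.cod)
    (p : P.obj (op ⟨A, B⟩)) (q : Q.obj (op ⟨B, A'⟩)) :
    act (ctx (X := ⟨A, A'⟩) f g) (seqK B p q) =
      (seqK (M ⊗ B ⊗ N) (act (ctx (A := ⟨D.dom, _⟩) (X := ⟨A, B⟩) f (𝟙 _)) p)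
        (act (ctx (A := ⟨_, D.cod⟩) (X := ⟨B, A'⟩) (𝟙 _) g) q) :
        (conv (seq C) P Q).obj (op ⟨D.dom, D.cod⟩)) := by
  refine (map_convMk (seq C) (ctx f g : D ⟶ ⟨A, A'⟩).op (cut A B A') p q).trans ?_
  refine (congr_arg (fun t => convMk (seq C) t p q)
    (pre_ctx_cut (X := ⟨A, A'⟩) B f g)).trans ?_
  exact convMk_dinat (seq C) (ctx (A := ⟨D.dom, M ⊗ B ⊗ N⟩) (X := ⟨A, B⟩) f (𝟙 _))
    (ctx (A := ⟨M ⊗ B ⊗ N, D.cod⟩) (X := ⟨B, A'⟩) (𝟙 _) g) (cut D.dom (M ⊗ B ⊗ N) D.cod) p q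

lemma act_pl_seqK {D D' B : C} (a : D ⟶ A) (a' : A' ⟶ D') (p : P.obj (op ⟨A, B⟩))
    (q : Q.obj (op ⟨B, A'⟩)) :
    act (pl a a') (seqK B p q) = seqK B (act (pl a (𝟙 B)) p) (act (pl (𝟙 B) a') q) :=
  (congr_arg (fun t => convMk (seq C) t p q) (pre_pl_cut B a a')).trans
    (convMk_dinat (seq C) (pl a (𝟙 B)) (pl (𝟙 B) a') (cut D B D') p q)

lemma act_sL_seqK {B : C} (M : C) (p : P.obj (op ⟨A, B⟩)) (q : Q.obj (op ⟨B, A'⟩)) :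
    act (sL M A A') (seqK B p q) = seqK (M ⊗ B) (act (sL M A B) p) (act (sL M B A') q) :=
  (congr_arg (fun t => convMk (seq C) t p q) (pre_sL_cut M A B A')).trans
    (convMk_dinat (seq C) (sL M A B) (sL M B A') (cut _ _ _) p q)

lemma act_sR_seqK {B : C} (N : C) (p : P.obj (op ⟨A, B⟩)) (q : Q.obj (op ⟨B, A'⟩)) :
    act (sR A A' N) (seqK B p q) = seqK (B ⊗ N) (act (sR A B N) p) (act (sR B A' N) q) :=
  (congr_arg (fun t => convMk (seq C) t p q) (pre_sR_cut A B A' N)).trans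
    (convMk_dinat (seq C) (sR A B N) (sR B A' N) (cut _ _ _) p q)

variable {T : Sort*}

/-- The universal property of sequential composites. -/
def seqLift (F : ∀ B, P.obj (op ⟨A, B⟩) → Q.obj (op ⟨B, A'⟩) → T)
    (hF : ∀ {B B' : C} (b : B ⟶ B') (p : P.obj (op ⟨A, B⟩)) (q : Q.obj (op ⟨B', A'⟩)),
      F B' (act (pl (𝟙 A) b) p) q = F B p (act (pl b (𝟙 A')) q)) :
    (conv (seq C) P Q).obj (op ⟨A, A'⟩) → T :=
  Quot.lift (fun k => Quot.lift (fun s : SeqRep ⟨A, A'⟩ k.left k.right =>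
      F (s.M ⊗ k.left.cod ⊗ s.N) (act (ctx (A := ⟨A, _⟩) s.f (𝟙 _)) k.fst)
        (act (ctx (A := ⟨_, A'⟩) s.g s.h) k.snd))
    (by
      rintro _ _ ⟨m, n, i, l, f, g, h⟩
      -- A side morphism before the first hole can be run after it, hence at the cut, where `hF`
      -- passes it to the second piece.
      have e₁ : ∀ {M N M' N' : C} (m : M ⟶ M') (n : N ⟶ N') (f : A ⟶ M ⊗ k.left.dom ⊗ N),
          ctx (A := ⟨A, _⟩) (X := k.left) (f ≫ side m k.left.dom n) (𝟙 _) =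
            pl (𝟙 A) (side m k.left.cod n) ≫ ctx (A := ⟨A, _⟩) f (𝟙 _) := by
        intros
        rw [pl_comp_ctx (B := ⟨A, _⟩), ctx_dinat, Category.id_comp, Category.id_comp,
          Category.comp_id]
      simp only [e₁, ← act_act, hF]
      congr 1
      rw [act_act, pl_comp_ctx (B := ⟨_, A'⟩), ← Category.assoc, ctx_dinat, Category.comp_id])
    k.split)
  (by
    rintro _ _ ⟨c, d, ⟨s⟩, p, q⟩
    rename_i U U' W W' _
    obtain ⟨c⟩ := c
    obtain ⟨d⟩ := d
    -- Filling the first hole with `c` moves the cut to just after the new hole. The part `c.g` then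
    -- lies between the two possible cuts, and `hF` applied to `x` carries it across.
    let x : (s.M ⊗ c.M) ⊗ U'.cod ⊗ (c.N ⊗ s.N) ⟶ s.M ⊗ U.cod ⊗ s.N :=
      𝟙 _ ⊗≫ s.M ◁ c.g ▷ s.N
    let y : A ⟶ (s.M ⊗ c.M) ⊗ U'.dom ⊗ (c.N ⊗ s.N) := s.f ≫ s.M ◁ c.f ▷ s.N ⊗≫ 𝟙 _
    have e₁ : ctx (A := ⟨A, s.M ⊗ U.cod ⊗ s.N⟩) (X := U) s.f (𝟙 _) ≫ ctx c.f c.g =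
        pl (𝟙 A) x ≫ ctx (A := ⟨A, _⟩) (X := U') y (𝟙 _) := by
      rw [pl_comp_ctx (B := ⟨A, _⟩), Category.id_comp, Category.id_comp]
      exact congr_arg (ctx _) (by simp [monoidalComp, x])
    have e₂ : pl x (𝟙 A') ≫ (ctx (A := ⟨_, A'⟩) (X := W) s.g s.h ≫ ctx d.f d.g) =
        ctx (A := ⟨(s.M ⊗ c.M) ⊗ U'.cod ⊗ (c.N ⊗ s.N), A'⟩) (X := W') (M := s.K ⊗ d.M)
          (N := d.N ⊗ s.L) ((𝟙 _ ⊗≫ s.M ◁ c.g ▷ s.N ≫ s.g) ≫ s.K ◁ d.f ▷ s.L ⊗≫ 𝟙 _)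
            (𝟙 _ ⊗≫ s.K ◁ d.g ▷ s.L ≫ s.h) := by
      refine (pl_comp_ctx (B := ⟨_, A'⟩) _ _ _ _).trans ?_
      simp [monoidalComp, x]
    refine Eq.trans ?_ (congr_arg₂ (F _) (act_act _ _ _).symm (act_act _ _ _).symm)
    change _ = F _ (act (ctx (A := ⟨A, s.M ⊗ U.cod ⊗ s.N⟩) (X := U) s.f (𝟙 _) ≫ ctx c.f c.g) p) _
    rw [e₁, ← act_act, hF, act_act]
    exact congr_arg (fun x => F _ _ (act x q)) e₂.symm)

/-- The chosen representative of the cut passes through `𝟙_ C ⊗ B ⊗ 𝟙_ C`; `hF` moves the unitors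
across the cut, where they cancel. -/
lemma seqLift_seqK (F : ∀ B, P.obj (op ⟨A, B⟩) → Q.obj (op ⟨B, A'⟩) → T) (hF) (B : C)
    (p : P.obj (op ⟨A, B⟩)) (q : Q.obj (op ⟨B, A'⟩)) :
    seqLift F hF (seqK B p q) = F B p q := by
  change F (𝟙_ C ⊗ B ⊗ 𝟙_ C) (act _ p) (act _ q) = _
  have e₁ : ctx (A := ⟨A, 𝟙_ C ⊗ B ⊗ 𝟙_ C⟩) (X := ⟨A, B⟩) (cutRep A B A').f (𝟙 _) =
      pl (𝟙 A) ((λ_ B).inv ≫ 𝟙_ C ◁ (ρ_ B).inv) := by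
    simp [pl, cutRep]
  have e₂ : pl ((λ_ B).inv ≫ 𝟙_ C ◁ (ρ_ B).inv) (𝟙 A') ≫
      ctx (A := ⟨_, A'⟩) (X := ⟨B, A'⟩) (cutRep A B A').g (cutRep A B A').h = 𝟙 _ := by
    refine (pl_comp_ctx (B := ⟨_, A'⟩) _ _ _ _).trans (Eq.trans ?_ (pl_id B A'))
    simp [pl, cutRep]
  refine (congr_arg (fun c => F (𝟙_ C ⊗ B ⊗ 𝟙_ C) (act c p) _) e₁).trans ?_
  refine (hF _ _ _).trans (congr_arg (F B p) ?_)
  exact (act_act _ _ _).trans ((congr_arg (fun c => act c q) e₂).trans (act_id q))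

end SeqK

/-! ### Parallel convolution as a balanced tensor of profunctors. -/

section ParK

variable {P Q : Presheaf (MCtx C)} {A A' : C}

/-- The class of `(f, g, p, q)`, for `p` in `P(S, S')` and `q` in `Q(T, T')`. -/
def parK {S S' T T' : C} (f : A ⟶ S ⊗ T) (g : S' ⊗ T' ⟶ A') (p : P.obj (op ⟨S, S'⟩))
    (q : Q.obj (op ⟨T, T'⟩)) : (conv (par C) P Q).obj (op ⟨A, A'⟩) :=
  convMk (par C) (join f g) p q

lemma parK_pl {S S' T T' U U' W W' : C} (f : A ⟶ S ⊗ T) (g : S' ⊗ T' ⟶ A') (s : S ⟶ U)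
    (s' : U' ⟶ S') (t : T ⟶ W) (t' : W' ⟶ T') (p : P.obj (op ⟨U, U'⟩))
    (q : Q.obj (op ⟨W, W'⟩)) :
    parK f g (act (pl s s') p) (act (pl t t') q) =
      parK (f ≫ (s ⊗ₘ t)) ((s' ⊗ₘ t') ≫ g) p q :=
  (convMk_dinat (par C) (pl s s') (pl t t') (join f g) p q).symm.trans
    (congr_arg (fun x => convMk (par C) x p q) (join_pl f g s s' t t'))

lemma parK_slide {S S' T T' N : C} (f : A ⟶ (S ⊗ N) ⊗ T) (g : (S' ⊗ N) ⊗ T' ⟶ A')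
    (p : P.obj (op ⟨S, S'⟩)) (q : Q.obj (op ⟨T, T'⟩)) :
    parK f g (act (sR S S' N) p) q =
      parK (f ≫ (α_ S N T).hom) ((α_ S' N T').inv ≫ g) p (act (sL N T T') q) := by
  refine (convMk_dinat_left (par C) (sR S S' N) (join f g) p q).symm.trans ?_
  refine Eq.trans ?_ (convMk_dinat_right (par C) (sL N T T') (join _ _) p q)
  refine congr_arg (fun x => convMk (par C) x p q) ?_
  refine (Par.post₂_id (Par.post₁ (join f g) (sR S S' N))).trans ((join_slide f g).trans ?_)
  exact congr_arg (fun t => Par.post₂ t (sL N T T')) (Par.post₁_id _).symm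

lemma convMk_parSplit {X Y : MCtx C} {M N O : C} (f : A ⟶ M ⊗ X.dom ⊗ N ⊗ Y.dom ⊗ O)
    (g : M ⊗ X.cod ⊗ N ⊗ Y.cod ⊗ O ⟶ A') (p : P.obj (op X)) (q : Q.obj (op Y)) :
    convMk (par C) (A := op ⟨A, A'⟩) (parSplit (A := ⟨A, A'⟩) f g) p q =
      parK (S := M ⊗ X.dom ⊗ N) (T := Y.dom ⊗ O) (S' := M ⊗ X.cod ⊗ N) (T' := Y.cod ⊗ O)
        (f ⊗≫ 𝟙 _) (𝟙 _ ⊗≫ g) (act (ctx (A := ⟨_, _⟩) (𝟙 _) (𝟙 _)) p)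
        (act (sR Y.dom Y.cod O) q) := by
  rw [parSplit_eq_post_join]
  exact convMk_dinat (par C) (ctx (A := ⟨_, _⟩) (𝟙 _) (𝟙 _)) (sR Y.dom Y.cod O) (join _ _) p q

lemma parK_surj (x : (conv (par C) P Q).obj (op ⟨A, A'⟩)) :
    ∃ (S S' T T' : C) (f : A ⟶ S ⊗ T) (g : S' ⊗ T' ⟶ A') (p : P.obj (op ⟨S, S'⟩))
      (q : Q.obj (op ⟨T, T'⟩)), x = parK f g p q := by
  obtain ⟨X, Y, ⟨s⟩, p, q⟩ := x
  exact ⟨_, _, _, _, _, _, _, _, convMk_parSplit s.f s.g p q⟩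

lemma act_pl_parK {D D' S S' T T' : C} (a : D ⟶ A) (a' : A' ⟶ D') (f : A ⟶ S ⊗ T)
    (g : S' ⊗ T' ⟶ A') (p : P.obj (op ⟨S, S'⟩)) (q : Q.obj (op ⟨T, T'⟩)) :
    act (pl a a') (parK f g p q) = parK (a ≫ f) (g ≫ a') p q :=
  congr_arg (fun x => convMk (par C) x p q) (pre_pl_join a a' f g)

lemma act_sL_parK {S S' T T' : C} (M : C) (f : A ⟶ S ⊗ T) (g : S' ⊗ T' ⟶ A')
    (p : P.obj (op ⟨S, S'⟩)) (q : Q.obj (op ⟨T, T'⟩)) :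
    act (sL M A A') (parK f g p q) =
      parK (M ◁ f ≫ (α_ M S T).inv) ((α_ M S' T').hom ≫ M ◁ g) (act (sL M S S') p) q := by
  refine (congr_arg (fun x => convMk (par C) x p q) (pre_sL_join M f g)).trans ?_
  refine Eq.trans ?_ (convMk_dinat_left (par C) (sL M S S') (join _ _) p q)
  exact congr_arg (fun x => convMk (par C) x p q) (Par.post₂_id _).symm

lemma act_sR_parK {S S' T T' : C} (N : C) (f : A ⟶ S ⊗ T) (g : S' ⊗ T' ⟶ A')
    (p : P.obj (op ⟨S, S'⟩)) (q : Q.obj (op ⟨T, T'⟩)) :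
    act (sR A A' N) (parK f g p q) =
      parK (f ▷ N ≫ (α_ S T N).hom) ((α_ S' T' N).inv ≫ g ▷ N) p (act (sR T T' N) q) := by
  refine (congr_arg (fun x => convMk (par C) x p q) (pre_sR_join N f g)).trans ?_
  refine Eq.trans ?_ (convMk_dinat_right (par C) (sR T T' N) (join _ _) p q)
  exact congr_arg (fun t => convMk (par C) (Par.post₂ t (sR T T' N)) p q) (Par.post₁_id _).symm

variable {E : Sort*}

/-- A function respecting the two relations does not see how the object between the holes is shared
out, so all of it may be collected in the first factor. -/
lemma slide_st (F : ∀ {S S' T T' : C}, (A ⟶ S ⊗ T) → (S' ⊗ T' ⟶ A') → P.obj (op ⟨S, S'⟩) →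
      Q.obj (op ⟨T, T'⟩) → E)
    (hpl : ∀ {S S' T T' U U' W W' : C} (f : A ⟶ S ⊗ T) (g : S' ⊗ T' ⟶ A') (s : S ⟶ U)
      (s' : U' ⟶ S') (t : T ⟶ W) (t' : W' ⟶ T') (p : P.obj (op ⟨U, U'⟩)) (q : Q.obj (op ⟨W, W'⟩)),
      F f g (act (pl s s') p) (act (pl t t') q) = F (f ≫ (s ⊗ₘ t)) ((s' ⊗ₘ t') ≫ g) p q)
    (hslide : ∀ {S S' T T' N : C} (f : A ⟶ (S ⊗ N) ⊗ T) (g : (S' ⊗ N) ⊗ T' ⟶ A')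
      (p : P.obj (op ⟨S, S'⟩)) (q : Q.obj (op ⟨T, T'⟩)),
      F f g (act (sR S S' N) p) q =
        F (f ≫ (α_ S N T).hom) ((α_ S' N T').inv ≫ g) p (act (sL N T T') q))
    {X Y : MCtx C} {M N N' O : C}
    (f : A ⟶ (M ⊗ X.dom ⊗ N) ⊗ (N' ⊗ Y.dom ⊗ O))
    (g : (M ⊗ X.cod ⊗ N) ⊗ (N' ⊗ Y.cod ⊗ O) ⟶ A') (p : P.obj (op X)) (q : Q.obj (op Y)) :
    F f g (act (st M X N) p) (act (sL N' _ _) (act (sR Y.dom Y.cod O) q)) =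
      F (f ⊗≫ 𝟙 ((M ⊗ X.dom ⊗ (N ⊗ N')) ⊗ (Y.dom ⊗ O)))
        (𝟙 ((M ⊗ X.cod ⊗ (N ⊗ N')) ⊗ (Y.cod ⊗ O)) ⊗≫ g)
        (act (st M X (N ⊗ N')) p) (act (sR Y.dom Y.cod O) q) := by
  -- The relation is used backwards: `N'` travels to the first factor, where `sR_st` merges it with
  -- `N`.
  have e := hslide (f ≫ (α_ _ _ _).inv) ((α_ _ _ _).hom ≫ g) (act (st M X N) p)
    (act (sR _ _ O) q)
  rw [act_act, sR_st, ← act_act, ← act_pl_id (act (sR _ _ O) q), hpl] at e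
  simp only [act_pl_id, Category.assoc, Iso.inv_hom_id, Iso.inv_hom_id_assoc,
    Category.comp_id] at e
  refine e.symm.trans ?_
  congr 1 <;> simp only [monoidalComp] <;> monoidal

/-- Invariance under dinaturality in the objects filling the holes. Filling the second hole enlarges
the middle side object, and `slide_st` redistributes it. -/
lemma fill_st (F : ∀ {S S' T T' : C}, (A ⟶ S ⊗ T) → (S' ⊗ T' ⟶ A') → P.obj (op ⟨S, S'⟩) →
      Q.obj (op ⟨T, T'⟩) → E)
    (hpl : ∀ {S S' T T' U U' W W' : C} (f : A ⟶ S ⊗ T) (g : S' ⊗ T' ⟶ A') (s : S ⟶ U)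
      (s' : U' ⟶ S') (t : T ⟶ W) (t' : W' ⟶ T') (p : P.obj (op ⟨U, U'⟩)) (q : Q.obj (op ⟨W, W'⟩)),
      F f g (act (pl s s') p) (act (pl t t') q) = F (f ≫ (s ⊗ₘ t)) ((s' ⊗ₘ t') ≫ g) p q)
    (hslide : ∀ {S S' T T' N : C} (f : A ⟶ (S ⊗ N) ⊗ T) (g : (S' ⊗ N) ⊗ T' ⟶ A')
      (p : P.obj (op ⟨S, S'⟩)) (q : Q.obj (op ⟨T, T'⟩)),
      F f g (act (sR S S' N) p) q =
        F (f ≫ (α_ S N T).hom) ((α_ S' N T').inv ≫ g) p (act (sL N T T') q))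
    {X Y X' Y' : MCtx C} (s : ParRep ⟨A, A'⟩ X Y) (c : HomRep X X') (d : HomRep Y Y')
    (p : P.obj (op X')) (q : Q.obj (op Y')) :
    F (((s.post₁ c).post₂ d).f ⊗≫ 𝟙 _)
      (𝟙 _ ⊗≫ ((s.post₁ c).post₂ d).g) (act (st ((s.post₁ c).post₂ d).M X' ((s.post₁ c).post₂ d).N) p)
      (act (sR Y'.dom Y'.cod ((s.post₁ c).post₂ d).O) q) =
    F (s.f ⊗≫ 𝟙 _) (𝟙 _ ⊗≫ s.g) (act (st s.M X s.N) (act (ctx c.f c.g) p))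
      (act (sR Y.dom Y.cod s.O) (act (ctx d.f d.g) q)) := by
  rw [act_act, act_act, st_comp_ctx, sR_comp_ctx, ← act_act, ← act_act, hpl, ← act_act,
    slide_st F hpl hslide]
  congr 1
  · simp only [ParRep.post₁, ParRep.post₂, monoidalComp, MonoidalCategory.tensorHom_def]; monoidal
  · simp only [ParRep.post₁, ParRep.post₂, monoidalComp, MonoidalCategory.tensorHom_def']; monoidal

/-- The universal property of parallel composites. -/
def parLift (F : ∀ {S S' T T' : C}, (A ⟶ S ⊗ T) → (S' ⊗ T' ⟶ A') → P.obj (op ⟨S, S'⟩) →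
      Q.obj (op ⟨T, T'⟩) → E)
    (hpl : ∀ {S S' T T' U U' W W' : C} (f : A ⟶ S ⊗ T) (g : S' ⊗ T' ⟶ A') (s : S ⟶ U)
      (s' : U' ⟶ S') (t : T ⟶ W) (t' : W' ⟶ T') (p : P.obj (op ⟨U, U'⟩)) (q : Q.obj (op ⟨W, W'⟩)),
      F f g (act (pl s s') p) (act (pl t t') q) = F (f ≫ (s ⊗ₘ t)) ((s' ⊗ₘ t') ≫ g) p q)
    (hslide : ∀ {S S' T T' N : C} (f : A ⟶ (S ⊗ N) ⊗ T) (g : (S' ⊗ N) ⊗ T' ⟶ A')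
      (p : P.obj (op ⟨S, S'⟩)) (q : Q.obj (op ⟨T, T'⟩)),
      F f g (act (sR S S' N) p) q =
        F (f ≫ (α_ S N T).hom) ((α_ S' N T').inv ≫ g) p (act (sL N T T') q)) :
    (conv (par C) P Q).obj (op ⟨A, A'⟩) → E :=
  Quot.lift (fun k => Quot.lift (fun s : ParRep ⟨A, A'⟩ k.left k.right =>
      F (s.f ⊗≫ 𝟙 _) (𝟙 _ ⊗≫ s.g) (act (st s.M k.left s.N) k.fst)
        (act (sR k.right.dom k.right.cod s.O) k.snd))
    (by
      rintro _ _ ⟨m, n, o, f, g⟩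
      rename_i M M' N N' O O'
      -- The side morphisms are placed inside the two elements. Read in one way `hpl` releases them
      -- into `f`; after `st_dinat` and `sR_dinat` it releases them into `g`.
      have e := hpl (f ⊗≫ 𝟙 ((M ⊗ k.left.dom ⊗ N) ⊗ k.right.dom ⊗ O))
        (𝟙 ((M' ⊗ k.left.cod ⊗ N') ⊗ k.right.cod ⊗ O') ⊗≫ g) (side m k.left.dom n) (𝟙 _)
        (k.right.dom ◁ o) (𝟙 _) (act (st M' k.left N') k.fst) (act (sR _ _ O') k.snd)
      rw [act_act, act_act, st_dinat, sR_dinat, ← act_act, ← act_act, hpl] at e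
      refine Eq.trans ?_ (e.symm.trans ?_) <;> congr 1 <;>
        simp only [side₂_eq, side_eq, monoidalComp, MonoidalCategory.tensorHom_def] <;> monoidal)
    k.split)
  (by
    rintro _ _ ⟨c, d, ⟨s⟩, p, q⟩
    obtain ⟨c⟩ := c
    obtain ⟨d⟩ := d
    exact fill_st F hpl hslide s c d p q)

/-- The side objects of `join` are units, so the whiskerings produced by the lift are plain contexts
made of unitors, and `hpl` removes them. -/
lemma parLift_parK (F : ∀ {S S' T T' : C}, (A ⟶ S ⊗ T) → (S' ⊗ T' ⟶ A') → P.obj (op ⟨S, S'⟩) →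
      Q.obj (op ⟨T, T'⟩) → E) (hpl) (hslide) {S S' T T' : C} (f : A ⟶ S ⊗ T) (g : S' ⊗ T' ⟶ A')
    (p : P.obj (op ⟨S, S'⟩)) (q : Q.obj (op ⟨T, T'⟩)) :
    parLift F hpl hslide (parK f g p q) = F f g p q := by
  have e₁ : st (𝟙_ C) ⟨S, S'⟩ (𝟙_ C) =
      pl ((λ_ (S ⊗ 𝟙_ C)).hom ≫ (ρ_ S).hom) ((ρ_ S').inv ≫ (λ_ (S' ⊗ 𝟙_ C)).inv) := by
    refine ctx_eq (𝟙 _) (𝟙 _) ?_ ?_ <;> simp only [side_eq] <;> monoidal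
  refine (congr_arg₂ (F _ _) (congr_arg (fun c => act c p) e₁)
    (congr_arg (fun c => act c q) (sR_unit T T'))).trans ?_
  rw [hpl]
  congr 1 <;>
    simp only [monoidalComp, MonoidalCategory.tensorHom_def] <;> monoidal

end ParK

/-! ### Calculus of canonical elements -/

section Calculus

variable {P Q R S : Presheaf (MCtx C)}

lemma act_sL_pl {A A' B B' : C} (M : C) (f : A ⟶ B) (g : B' ⟶ A') (p : P.obj (op ⟨B, B'⟩)) :
    act (sL M A A') (act (pl f g) p) = act (pl (M ◁ f) (M ◁ g)) (act (sL M B B') p) := by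
  rw [act_act, sL_pl, act_act]

lemma act_sR_pl {A A' B B' : C} (N : C) (f : A ⟶ B) (g : B' ⟶ A') (p : P.obj (op ⟨B, B'⟩)) :
    act (sR A A' N) (act (pl f g) p) = act (pl (f ▷ N) (g ▷ N)) (act (sR B B' N) p) := by
  rw [act_act, sR_pl, act_act]

lemma act_sR_sL (M A A' N : C) (p : P.obj (op ⟨A, A'⟩)) :
    act (sR (M ⊗ A) (M ⊗ A') N) (act (sL M A A') p) =
      act (pl (α_ M A N).hom (α_ M A' N).inv) (act (sL M _ _) (act (sR A A' N) p)) := by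
  rw [act_act, sR_sL, act_act, act_act, Category.assoc]

lemma act_sL_sL (M M' A A' : C) (p : P.obj (op ⟨A, A'⟩)) :
    act (sL M (M' ⊗ A) (M' ⊗ A')) (act (sL M' A A') p) =
      act (pl (α_ M M' A).inv (α_ M M' A').hom) (act (sL (M ⊗ M') A A') p) := by
  rw [act_act, sL_sL, act_act]

lemma act_sR_sR (A A' N N' : C) (p : P.obj (op ⟨A, A'⟩)) :
    act (sR (A ⊗ N') (A' ⊗ N') N) (act (sR A A' N') p) =
      act (pl (α_ A N' N).hom (α_ A' N' N).inv) (act (sR A A' (N' ⊗ N)) p) := by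
  rw [act_act, sR_sR, act_act]

lemma act_sL_dinat {A A' D D' M M' : C} (f : D ⟶ M ⊗ A) (m : M ⟶ M') (g : M' ⊗ A' ⟶ D')
    (p : P.obj (op ⟨A, A'⟩)) :
    act (pl (f ≫ m ▷ A) g) (act (sL M' A A') p) =
      act (pl f (m ▷ A' ≫ g)) (act (sL M A A') p) := by
  have e := congr_arg (fun c => act (pl f g) (act c p)) (sL_dinat (A := A) (A' := A') m)
  simpa only [← act_act, act_pl_pl, Category.id_comp, Category.comp_id] using e

lemma act_sR_dinat {A A' D D' N N' : C} (f : D ⟶ A ⊗ N) (n : N ⟶ N') (g : A' ⊗ N' ⟶ D')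
    (p : P.obj (op ⟨A, A'⟩)) :
    act (pl (f ≫ A ◁ n) g) (act (sR A A' N') p) =
      act (pl f (A' ◁ n ≫ g)) (act (sR A A' N) p) := by
  have e := congr_arg (fun c => act (pl f g) (act c p)) (sR_dinat (A := A) (A' := A') n)
  simpa only [← act_act, act_pl_pl, Category.id_comp, Category.comp_id] using e

lemma act_pl_congr {A A' B B' : C} {f f' : A ⟶ B} {g g' : B' ⟶ A'} (hf : f = f') (hg : g = g')
    (p : P.obj (op ⟨B, B'⟩)) : act (pl f g) p = act (pl f' g') p := by rw [hf, hg]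

lemma parK_congr {A A' S S' T T' : C} {f f' : A ⟶ S ⊗ T} {g g' : S' ⊗ T' ⟶ A'} (hf : f = f')
    (hg : g = g') (p : P.obj (op ⟨S, S'⟩)) (q : Q.obj (op ⟨T, T'⟩)) :
    parK f g p q = parK f' g' p q := by rw [hf, hg]

lemma parK_pl_left {A A' S S' T T' U U' : C} (f : A ⟶ S ⊗ T) (g : S' ⊗ T' ⟶ A') (s : S ⟶ U)
    (s' : U' ⟶ S') (p : P.obj (op ⟨U, U'⟩)) (q : Q.obj (op ⟨T, T'⟩)) :
    parK f g (act (pl s s') p) q = parK (f ≫ s ▷ T) (s' ▷ T' ≫ g) p q := by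
  have e := parK_pl f g s s' (𝟙 _) (𝟙 _) p q
  simpa only [act_pl_id, tensorHom_id] using e

lemma parK_pl_right {A A' S S' T T' W W' : C} (f : A ⟶ S ⊗ T) (g : S' ⊗ T' ⟶ A') (t : T ⟶ W)
    (t' : W' ⟶ T') (p : P.obj (op ⟨S, S'⟩)) (q : Q.obj (op ⟨W, W'⟩)) :
    parK f g p (act (pl t t') q) = parK (f ≫ S ◁ t) (S' ◁ t' ≫ g) p q := by
  have e := parK_pl f g (𝟙 _) (𝟙 _) t t' p q
  simpa only [act_pl_id, id_tensorHom] using e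

lemma convMap_seqK {A A' B : C} (φ : P ⟶ R) (χ : Q ⟶ S) (p : P.obj (op ⟨A, B⟩))
    (q : Q.obj (op ⟨B, A'⟩)) :
    (convMap (seq C) φ χ).app _ (seqK B p q) = seqK B (φ.app _ p) (χ.app _ q) := rfl

lemma convMap_parK {A A' S₁ S₁' T T' : C} (φ : P ⟶ R) (χ : Q ⟶ S) (f : A ⟶ S₁ ⊗ T)
    (g : S₁' ⊗ T' ⟶ A') (p : P.obj (op ⟨S₁, S₁'⟩)) (q : Q.obj (op ⟨T, T'⟩)) :
    (convMap (par C) φ χ).app _ (parK f g p q) = parK f g (φ.app _ p) (χ.app _ q) := rfl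

lemma comp_app_apply (φ : P ⟶ Q) (χ : Q ⟶ R) {A : (MCtx C)ᵒᵖ} (p : P.obj A) :
    (φ ≫ χ).app A p = χ.app A (φ.app A p) := rfl

lemma id_app_apply {A : (MCtx C)ᵒᵖ} (p : P.obj A) : (NatTrans.app (𝟙 P) A) p = p := rfl

lemma hom_ext_at {φ χ : P ⟶ Q}
    (h : ∀ (A A' : C) (p : P.obj (op ⟨A, A'⟩)), φ.app _ p = χ.app _ p) : φ = χ := by
  ext A p
  exact h _ _ p

/-- Cuts exhaust the composite; this is what reduces the coherence equations to generators. -/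
lemma hom_ext_seqK {φ χ : conv (seq C) P Q ⟶ R}
    (h : ∀ (A A' B : C) (p : P.obj (op ⟨A, B⟩)) (q : Q.obj (op ⟨B, A'⟩)),
      φ.app _ (seqK B p q) = χ.app _ (seqK B p q)) : φ = χ := by
  refine hom_ext_at fun A A' x => ?_
  obtain ⟨B, p, q, rfl⟩ := seqK_surj x
  exact h _ _ _ _ _

lemma hom_ext_parK {φ χ : conv (par C) P Q ⟶ R}
    (h : ∀ (A A' S S' T T' : C) (f : A ⟶ S ⊗ T) (g : S' ⊗ T' ⟶ A') (p : P.obj (op ⟨S, S'⟩))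
      (q : Q.obj (op ⟨T, T'⟩)), φ.app _ (parK f g p q) = χ.app _ (parK f g p q)) : φ = χ := by
  refine hom_ext_at fun A A' x => ?_
  obtain ⟨S, S', T, T', f, g, p, q, rfl⟩ := parK_surj x
  exact h _ _ _ _ _ _ _ _ _ _

/-- An isomorphism from a natural transformation with componentwise inverses. -/
def isoOfInverse (φ : P ⟶ Q) (ψ : ∀ A A' : C, Q.obj (op ⟨A, A'⟩) → P.obj (op ⟨A, A'⟩))
    (h₁ : ∀ (A A' : C) (p : P.obj (op ⟨A, A'⟩)), ψ A A' (φ.app _ p) = p)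
    (h₂ : ∀ (A A' : C) (q : Q.obj (op ⟨A, A'⟩)), φ.app _ (ψ A A' q) = q) : P ≅ Q where
  hom := φ
  inv :=
    { app A := ↾ψ A.unop.dom A.unop.cod
      naturality := by
        rintro ⟨A⟩ ⟨B⟩ c
        ext q
        change ψ B.dom B.cod (Q.map c q) = P.map c (ψ A.dom A.cod q)
        have e : Q.map c q = φ.app _ (P.map c (ψ A.dom A.cod q)) := by
          rw [NatTrans.naturality_apply]
          exact congr_arg _ (h₂ _ _ q).symm
        rw [e]
        exact h₁ _ _ _ }
  hom_inv_id := by ext A p; exact h₁ _ _ p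
  inv_hom_id := by ext A q; exact h₂ _ _ q

/-- A morphism of `C` as an element of the unit. -/
def u {A A' : C} (n : A ⟶ A') : (unit C).obj (op ⟨A, A'⟩) := toUnit (A := ⟨A, A'⟩) n

lemma u_surj {A A' : C} (x : (unit C).obj (op ⟨A, A'⟩)) : ∃ n, x = u n := ⟨x.down, rfl⟩

lemma act_pl_u {A A' B B' : C} (f : A ⟶ B) (g : B' ⟶ A') (n : B ⟶ B') :
    act (pl f g) (u n) = u (f ≫ n ≫ g) := by
  change u ((f ≫ (λ_ B).inv ≫ 𝟙_ C ◁ (ρ_ B).inv) ≫ 𝟙_ C ◁ n ▷ 𝟙_ C ≫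
    𝟙_ C ◁ (ρ_ B').hom ≫ (λ_ B').hom ≫ g) = _
  congr 1
  monoidal

lemma act_sL_u {A A' : C} (M : C) (n : A ⟶ A') : act (sL M A A') (u n) = u (M ◁ n) := by
  change u (M ◁ (ρ_ A).inv ≫ M ◁ n ▷ 𝟙_ C ≫ M ◁ (ρ_ A').hom) = _
  congr 1
  monoidal

lemma act_sR_u {A A' : C} (N : C) (n : A ⟶ A') : act (sR A A' N) (u n) = u (n ▷ N) := by
  change u ((λ_ (A ⊗ N)).inv ≫ 𝟙_ C ◁ n ▷ N ≫ (λ_ (A' ⊗ N)).hom) = _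
  congr 1
  monoidal

end Calculus

/-! ### The sequential structure -/

section Sequential

variable (P Q R : Presheaf (MCtx C))

/-- The sequential associator at presheaf arguments. -/
def seqAssoc : conv (seq C) (conv (seq C) P Q) R ⟶ conv (seq C) P (conv (seq C) Q R) :=
  homOfGenerators
    (fun A A' => seqLift (fun B x r => seqLift (fun D p q => seqK D p (seqK B q r))
        (by intros; rw [seqK_dinat, act_pl_seqK, act_pl_id]) x)
      (by
        intro B B' b x r
        obtain ⟨D, p, q, rfl⟩ := seqK_surj x
        rw [act_pl_seqK, seqLift_seqK, seqLift_seqK, act_pl_id, seqK_dinat]))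
    (by
      intro A A' B B' f g x
      obtain ⟨B, x, r, rfl⟩ := seqK_surj x
      obtain ⟨D, p, q, rfl⟩ := seqK_surj x
      simp only [act_pl_seqK, seqLift_seqK, act_pl_id])
    (by
      intro M A A' x
      obtain ⟨B, x, r, rfl⟩ := seqK_surj x
      obtain ⟨D, p, q, rfl⟩ := seqK_surj x
      simp only [act_sL_seqK, seqLift_seqK])
    (by
      intro A A' N x
      obtain ⟨B, x, r, rfl⟩ := seqK_surj x
      obtain ⟨D, p, q, rfl⟩ := seqK_surj x
      simp only [act_sR_seqK, seqLift_seqK])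

variable {P Q R}

lemma seqAssoc_seqK {A A' B D : C} (p : P.obj (op ⟨A, D⟩)) (q : Q.obj (op ⟨D, B⟩))
    (r : R.obj (op ⟨B, A'⟩)) :
    (seqAssoc P Q R).app _ (seqK B (seqK D p q) r) = seqK D p (seqK B q r) := by
  rw [seqAssoc, homOfGenerators_app, seqLift_seqK, seqLift_seqK]

variable (P Q R)

/-- The invertibility of the sequential associator. -/
def seqAssocIso : conv (seq C) (conv (seq C) P Q) R ≅ conv (seq C) P (conv (seq C) Q R) :=
  isoOfInverse (seqAssoc P Q R)
    (fun A A' => seqLift (fun D p y => seqLift (fun B q r => seqK B (seqK D p q) r)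
        (by intros; rw [← seqK_dinat, act_pl_seqK, act_pl_id]) y)
      (by
        intro B B' b p y
        obtain ⟨D, q, r, rfl⟩ := seqK_surj y
        rw [act_pl_seqK, seqLift_seqK, seqLift_seqK, act_pl_id, seqK_dinat]))
    (by
      intro A A' x
      obtain ⟨B, x, r, rfl⟩ := seqK_surj x
      obtain ⟨D, p, q, rfl⟩ := seqK_surj x
      rw [seqAssoc_seqK, seqLift_seqK, seqLift_seqK])
    (by
      intro A A' x
      obtain ⟨B, p, y, rfl⟩ := seqK_surj x
      obtain ⟨D, q, r, rfl⟩ := seqK_surj y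
      rw [seqLift_seqK, seqLift_seqK, seqAssoc_seqK])

/-- The left unitor of the sequential structure. -/
def seqLeft : conv (seq C) (unit C) P ⟶ P :=
  homOfGenerators
    (fun A A' => seqLift (fun B n p => act (pl n.down (𝟙 _)) p) (by
      intro B B' b n q
      obtain ⟨n, rfl⟩ := u_surj n
      rw [act_pl_u, act_pl_pl]
      exact act_pl_congr (by simp [u, toUnit]) (by simp) q))
    (by
      intro A A' B B' f g x
      obtain ⟨B, n, q, rfl⟩ := seqK_surj x
      obtain ⟨n, rfl⟩ := u_surj n
      rw [act_pl_seqK, act_pl_u, seqLift_seqK, seqLift_seqK, act_pl_pl, act_pl_pl]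
      exact act_pl_congr (by simp [u, toUnit]) (by simp) q)
    (by
      intro M A A' x
      obtain ⟨B, n, q, rfl⟩ := seqK_surj x
      obtain ⟨n, rfl⟩ := u_surj n
      rw [act_sL_seqK, act_sL_u, seqLift_seqK, seqLift_seqK, act_sL_pl]
      exact act_pl_congr (by simp [u, toUnit]) (by simp) _)
    (by
      intro M A A' x
      obtain ⟨B, n, q, rfl⟩ := seqK_surj x
      obtain ⟨n, rfl⟩ := u_surj n
      rw [act_sR_seqK, act_sR_u, seqLift_seqK, seqLift_seqK, act_sR_pl]
      exact act_pl_congr (by simp [u, toUnit]) (by simp) _)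

/-- The right unitor of the sequential structure. -/
def seqRight : conv (seq C) P (unit C) ⟶ P :=
  homOfGenerators
    (fun A A' => seqLift (fun B p n => act (pl (𝟙 _) n.down) p) (by
      intro B B' b p n
      obtain ⟨n, rfl⟩ := u_surj n
      rw [act_pl_u, act_pl_pl]
      exact act_pl_congr (by simp) (by simp [u, toUnit]) p))
    (by
      intro A A' B B' f g x
      obtain ⟨B, q, n, rfl⟩ := seqK_surj x
      obtain ⟨n, rfl⟩ := u_surj n
      rw [act_pl_seqK, act_pl_u, seqLift_seqK, seqLift_seqK, act_pl_pl, act_pl_pl]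
      exact act_pl_congr (by simp) (by simp [u, toUnit]) q)
    (by
      intro M A A' x
      obtain ⟨B, q, n, rfl⟩ := seqK_surj x
      obtain ⟨n, rfl⟩ := u_surj n
      rw [act_sL_seqK, act_sL_u, seqLift_seqK, seqLift_seqK, act_sL_pl]
      exact act_pl_congr (by simp) (by simp [u, toUnit]) _)
    (by
      intro M A A' x
      obtain ⟨B, q, n, rfl⟩ := seqK_surj x
      obtain ⟨n, rfl⟩ := u_surj n
      rw [act_sR_seqK, act_sR_u, seqLift_seqK, seqLift_seqK, act_sR_pl]
      exact act_pl_congr (by simp) (by simp [u, toUnit]) _)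

variable {P}

lemma seqLeft_seqK {A A' B : C} (n : A ⟶ B) (p : P.obj (op ⟨B, A'⟩)) :
    (seqLeft P).app _ (seqK B (u n) p) = act (pl n (𝟙 A')) p := by
  rw [seqLeft, homOfGenerators_app, seqLift_seqK]
  rfl

lemma seqRight_seqK {A A' B : C} (p : P.obj (op ⟨A, B⟩)) (n : B ⟶ A') :
    (seqRight P).app _ (seqK B p (u n)) = act (pl (𝟙 A) n) p := by
  rw [seqRight, homOfGenerators_app, seqLift_seqK]
  rfl

/-- The unit is generated by identities, the rest being an action that can be slid across a cut.
This inverts the sequential unitors. -/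
lemma u_eq_pl_left {A B : C} (n : A ⟶ B) : u n = act (pl (𝟙 A) n) (u (𝟙 A)) := by
  simp [act_pl_u]

lemma u_eq_pl_right {A B : C} (n : A ⟶ B) : u n = act (pl n (𝟙 B)) (u (𝟙 B)) := by
  simp [act_pl_u]

variable (P)

/-- The invertibility of the left unitor. -/
def seqLeftIso : conv (seq C) (unit C) P ≅ P :=
  isoOfInverse (seqLeft P) (fun A A' p => seqK A (u (𝟙 A)) p)
    (by
      intro A A' x
      obtain ⟨B, n, p, rfl⟩ := seqK_surj x
      obtain ⟨n, rfl⟩ := u_surj n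
      rw [seqLeft_seqK, ← seqK_dinat, ← u_eq_pl_left])
    (by intro A A' p; rw [seqLeft_seqK, act_pl_id])

/-- The invertibility of the right unitor. -/
def seqRightIso : conv (seq C) P (unit C) ≅ P :=
  isoOfInverse (seqRight P) (fun A A' p => seqK A' p (u (𝟙 A')))
    (by
      intro A A' x
      obtain ⟨B, p, n, rfl⟩ := seqK_surj x
      obtain ⟨n, rfl⟩ := u_surj n
      rw [seqRight_seqK, seqK_dinat, ← u_eq_pl_right])
    (by intro A A' p; rw [seqRight_seqK, act_pl_id])

end Sequential

/-- The sequential structure at presheaf arguments. -/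
def seqVirtual (C : Type u) [Category.{v} C] [MonoidalCategory C] :
    VirtualData (seq C) (unit C) where
  assoc := seqAssocIso
  assoc_natural φ χ ω := by
    refine hom_ext_seqK fun A A' B x r => ?_
    obtain ⟨D, p, q, rfl⟩ := seqK_surj x
    change (seqAssoc _ _ _).app _ (seqK B (seqK D _ _) _) =
      (convMap _ _ _).app _ ((seqAssoc _ _ _).app _ (seqK B (seqK D p q) r))
    rw [seqAssoc_seqK, seqAssoc_seqK]
    rfl
  left := seqLeftIso
  left_natural φ := by
    refine hom_ext_seqK fun A A' B n p => ?_
    obtain ⟨n, rfl⟩ := u_surj n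
    change (seqLeft _).app _ (seqK B (u n) _) = φ.app _ ((seqLeft _).app _ _)
    rw [seqLeft_seqK, seqLeft_seqK, app_act]
  right := seqRightIso
  right_natural φ := by
    refine hom_ext_seqK fun A A' B p n => ?_
    obtain ⟨n, rfl⟩ := u_surj n
    change (seqRight _).app _ (seqK B _ (u n)) = φ.app _ ((seqRight _).app _ _)
    rw [seqRight_seqK, seqRight_seqK, app_act]

/-! ### The parallel structure -/

section Parallel

variable {P Q R : Presheaf (MCtx C)}

lemma parK_eq_pl {A A' S S' T T' : C} (f : A ⟶ S ⊗ T) (g : S' ⊗ T' ⟶ A')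
    (p : P.obj (op ⟨S, S'⟩)) (q : Q.obj (op ⟨T, T'⟩)) :
    parK f g p q = act (pl f g) (parK (𝟙 _) (𝟙 _) p q) := by
  rw [act_pl_parK, Category.comp_id, Category.id_comp]

/-- Normal form of nested parallel elements: the inner morphisms move to the outside. Two such
elements then coincide as soon as their outer morphisms do. -/
lemma parK_nest_right {A A' S S' T T' U U' W W' : C} (f : A ⟶ S ⊗ T) (g : S' ⊗ T' ⟶ A')
    (f' : T ⟶ U ⊗ W) (g' : U' ⊗ W' ⟶ T') (p : P.obj (op ⟨S, S'⟩)) (q : Q.obj (op ⟨U, U'⟩))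
    (r : R.obj (op ⟨W, W'⟩)) :
    parK f g p (parK f' g' q r) =
      parK (f ≫ S ◁ f') (S' ◁ g' ≫ g) p (parK (𝟙 _) (𝟙 _) q r) := by
  rw [parK_eq_pl f', parK_pl_right]

lemma parK_nest_left {A A' S S' T T' U U' W W' : C} (f : A ⟶ S ⊗ T) (g : S' ⊗ T' ⟶ A')
    (f' : S ⟶ U ⊗ W) (g' : U' ⊗ W' ⟶ S') (p : P.obj (op ⟨U, U'⟩)) (q : Q.obj (op ⟨W, W'⟩))
    (r : R.obj (op ⟨T, T'⟩)) :
    parK f g (parK f' g' p q) r =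
      parK (f ≫ f' ▷ T) (g' ▷ T' ≫ g) (parK (𝟙 _) (𝟙 _) p q) r := by
  rw [parK_eq_pl f', parK_pl_left]

/-- Coherence does not reorder morphisms acting on different tensor factors. This lemma and the next
five supply the instances of interchange required. -/
lemma tensorHom_comp_whiskerRight {S T U W X : C} (s : S ⟶ U) (t : T ⟶ W) (n : U ⟶ X) :
    (s ⊗ₘ t) ≫ n ▷ W = (s ≫ n) ▷ T ≫ X ◁ t := by
  rw [← whisker_exchange, MonoidalCategory.tensorHom_def']; monoidal

lemma tensorHom_comp_whiskerLeft {S T U W X : C} (s : S ⟶ U) (t : T ⟶ W) (n : W ⟶ X) :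
    (s ⊗ₘ t) ≫ U ◁ n = S ◁ (t ≫ n) ≫ s ▷ X := by
  rw [whisker_exchange, MonoidalCategory.tensorHom_def]; monoidal

lemma interchange_right {S T U W U₁ U₂ : C} (s : S ⟶ U) (t : T ⟶ W) (f : U ⟶ U₁ ⊗ U₂) :
    (s ⊗ₘ t) ≫ f ▷ W ≫ (α_ _ _ _).hom = (s ≫ f) ▷ T ≫ (α_ _ _ _).hom ≫ U₁ ◁ U₂ ◁ t := by
  trans ((s ≫ f) ▷ T ≫ (U₁ ⊗ U₂) ◁ t) ≫ (α_ _ _ _).hom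
  · rw [← whisker_exchange, MonoidalCategory.tensorHom_def']; monoidal
  · monoidal

lemma interchange_right' {S T U W U₁ U₂ : C} (s : U ⟶ S) (t : W ⟶ T) (f : U₁ ⊗ U₂ ⟶ U) :
    (α_ _ _ _).inv ≫ f ▷ W ≫ (s ⊗ₘ t) = U₁ ◁ U₂ ◁ t ≫ (α_ _ _ _).inv ≫ (f ≫ s) ▷ T := by
  trans (α_ _ _ _).inv ≫ ((U₁ ⊗ U₂) ◁ t ≫ (f ≫ s) ▷ T)
  · rw [whisker_exchange, MonoidalCategory.tensorHom_def]; monoidal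
  · monoidal

lemma interchange_left {S T U W W₁ W₂ : C} (s : S ⟶ U) (t : T ⟶ W) (f : W ⟶ W₁ ⊗ W₂) :
    (s ⊗ₘ t) ≫ U ◁ f ≫ (α_ _ _ _).inv = S ◁ (t ≫ f) ≫ (α_ _ _ _).inv ≫ s ▷ W₁ ▷ W₂ := by
  trans (S ◁ (t ≫ f) ≫ s ▷ (W₁ ⊗ W₂)) ≫ (α_ _ _ _).inv
  · rw [whisker_exchange, MonoidalCategory.tensorHom_def]; monoidal
  · monoidal

lemma interchange_left' {S T U W W₁ W₂ : C} (s : U ⟶ S) (t : W ⟶ T) (f : W₁ ⊗ W₂ ⟶ W) :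
    (α_ _ _ _).hom ≫ U ◁ f ≫ (s ⊗ₘ t) = s ▷ W₁ ▷ W₂ ≫ (α_ _ _ _).hom ≫ S ◁ (f ≫ t) := by
  trans (α_ _ _ _).hom ≫ (s ▷ (W₁ ⊗ W₂) ≫ S ◁ (f ≫ t))
  · rw [← whisker_exchange, MonoidalCategory.tensorHom_def']; monoidal
  · monoidal

variable (P Q R)

/-- Reassociation of a canonical element to the right. -/
def parAssocFun {A A' S S' T T' : C} (f : A ⟶ S ⊗ T) (g : S' ⊗ T' ⟶ A')
    (x : (conv (par C) P Q).obj (op ⟨S, S'⟩)) (r : R.obj (op ⟨T, T'⟩)) :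
    (conv (par C) P (conv (par C) Q R)).obj (op ⟨A, A'⟩) :=
  parLift (fun {_ _ U U'} f' g' p q => parK (f ≫ f' ▷ T ≫ (α_ _ _ _).hom)
      ((α_ _ _ _).inv ≫ g' ▷ T' ≫ g) p (parK (𝟙 (U ⊗ T)) (𝟙 (U' ⊗ T')) q r))
    (by
      intros
      rw [parK_pl_left, parK_pl_left, parK_nest_right]
      refine parK_congr ?_ ?_ _ _
      · simp only [MonoidalCategory.tensorHom_def]; monoidal
      · simp only [MonoidalCategory.tensorHom_def']; monoidal)
    (by
      intros
      rw [parK_slide, act_sL_parK, parK_nest_right]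
      refine parK_congr ?_ ?_ _ _ <;> monoidal) x

variable {P Q R}

lemma parAssocFun_parK {A A' S S' T T' U U' W W' : C} (f : A ⟶ S ⊗ T) (g : S' ⊗ T' ⟶ A')
    (f' : S ⟶ U ⊗ W) (g' : U' ⊗ W' ⟶ S') (p : P.obj (op ⟨U, U'⟩)) (q : Q.obj (op ⟨W, W'⟩))
    (r : R.obj (op ⟨T, T'⟩)) :
    parAssocFun P Q R f g (parK f' g' p q) r =
      parK (f ≫ f' ▷ T ≫ (α_ U W T).hom) ((α_ U' W' T').inv ≫ g' ▷ T' ≫ g) p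
        (parK (𝟙 (W ⊗ T)) (𝟙 (W' ⊗ T')) q r) :=
  parLift_parK _ _ _ _ _ _ _

variable (P Q R)

/-- The parallel associator at presheaf arguments. -/
def parAssoc : conv (par C) (conv (par C) P Q) R ⟶ conv (par C) P (conv (par C) Q R) :=
  homOfGenerators
    (fun A A' => parLift (fun f g x r => parAssocFun P Q R f g x r)
      (by
        intro S S' T T' U U' W W' f g s s' t t' x r
        obtain ⟨_, _, _, _, f', g', p, q, rfl⟩ := parK_surj x
        rw [act_pl_parK, parAssocFun_parK, parAssocFun_parK, parK_pl_right, parK_nest_right]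
        refine parK_congr ?_ ?_ _ _
        · simp only [Category.assoc, interchange_right]; monoidal
        · rw [reassoc_of% interchange_right']; monoidal)
      (by
        intro S S' T T' N f g x r
        obtain ⟨_, _, _, _, f', g', p, q, rfl⟩ := parK_surj x
        rw [act_sR_parK, parAssocFun_parK, parAssocFun_parK, parK_slide, parK_nest_right]
        refine parK_congr ?_ ?_ _ _ <;> monoidal))
    (by
      intro A A' B B' f g x
      obtain ⟨_, _, _, _, f, g, x, r, rfl⟩ := parK_surj x
      obtain ⟨_, _, _, _, f', g', p, q, rfl⟩ := parK_surj x
      rw [act_pl_parK, parLift_parK, parLift_parK, parAssocFun_parK, parAssocFun_parK, act_pl_parK]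
      refine parK_congr ?_ ?_ _ _ <;> monoidal)
    (by
      intro M A A' x
      obtain ⟨_, _, _, _, f, g, x, r, rfl⟩ := parK_surj x
      obtain ⟨_, _, _, _, f', g', p, q, rfl⟩ := parK_surj x
      rw [act_sL_parK, act_sL_parK, parLift_parK, parLift_parK, parAssocFun_parK, parAssocFun_parK,
        act_sL_parK]
      refine parK_congr ?_ ?_ _ _ <;> monoidal)
    (by
      intro A A' N x
      obtain ⟨_, _, _, _, f, g, x, r, rfl⟩ := parK_surj x
      obtain ⟨_, _, _, _, f', g', p, q, rfl⟩ := parK_surj x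
      rw [act_sR_parK, parLift_parK, parLift_parK, parAssocFun_parK, parAssocFun_parK,
        act_sR_parK, act_sR_parK]
      refine Eq.trans ?_ (parK_nest_right _ _ _ _ _ _ _).symm
      refine parK_congr ?_ ?_ _ _ <;> monoidal)

variable {P Q R}

lemma parAssoc_parK {A A' S S' T T' U U' W W' : C} (f : A ⟶ S ⊗ T) (g : S' ⊗ T' ⟶ A')
    (f' : S ⟶ U ⊗ W) (g' : U' ⊗ W' ⟶ S') (p : P.obj (op ⟨U, U'⟩)) (q : Q.obj (op ⟨W, W'⟩))
    (r : R.obj (op ⟨T, T'⟩)) :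
    (parAssoc P Q R).app _ (parK f g (parK f' g' p q) r) =
      parK (f ≫ f' ▷ T ≫ (α_ U W T).hom) ((α_ U' W' T').inv ≫ g' ▷ T' ≫ g) p
        (parK (𝟙 (W ⊗ T)) (𝟙 (W' ⊗ T')) q r) := by
  rw [parAssoc, homOfGenerators_app, parLift_parK, parAssocFun_parK]

variable (P Q R)

/-- Reassociation of a canonical element to the left. -/
def parAssocInvFun {A A' S S' T T' : C} (f : A ⟶ S ⊗ T) (g : S' ⊗ T' ⟶ A')
    (p : P.obj (op ⟨S, S'⟩)) (x : (conv (par C) Q R).obj (op ⟨T, T'⟩)) :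
    (conv (par C) (conv (par C) P Q) R).obj (op ⟨A, A'⟩) :=
  parLift (fun {U U' _ _} f' g' q r => parK (f ≫ S ◁ f' ≫ (α_ _ _ _).inv)
      ((α_ _ _ _).hom ≫ S' ◁ g' ≫ g) (parK (𝟙 (S ⊗ U)) (𝟙 (S' ⊗ U')) p q) r)
    (by
      intros
      rw [parK_pl_right, parK_pl_right, parK_nest_left]
      refine parK_congr ?_ ?_ _ _
      · simp only [MonoidalCategory.tensorHom_def']; monoidal
      · simp only [MonoidalCategory.tensorHom_def]; monoidal)
    (by
      intro V V' _ _ N _ _ q r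
      -- A side object on the right of `q` is also on the right of `p ⊗ q`, so it can be slid on to
      -- `r`.
      have e : parK (𝟙 (S ⊗ (V ⊗ N))) (𝟙 (S' ⊗ (V' ⊗ N))) p (act (sR _ _ N) q) =
          act (pl (α_ _ _ _).inv (α_ _ _ _).hom) (act (sR _ _ N) (parK (𝟙 _) (𝟙 _) p q)) := by
        rw [act_sR_parK, act_pl_parK]
        refine parK_congr ?_ ?_ _ _ <;> monoidal
      rw [e, parK_pl_left, parK_slide]
      refine parK_congr ?_ ?_ _ _ <;> monoidal) x

lemma parAssocInvFun_parK {A A' S S' T T' U U' W W' : C} (f : A ⟶ S ⊗ T) (g : S' ⊗ T' ⟶ A')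
    (f' : T ⟶ U ⊗ W) (g' : U' ⊗ W' ⟶ T') (p : P.obj (op ⟨S, S'⟩)) (q : Q.obj (op ⟨U, U'⟩))
    (r : R.obj (op ⟨W, W'⟩)) :
    parAssocInvFun P Q R f g p (parK f' g' q r) =
      parK (f ≫ S ◁ f' ≫ (α_ _ _ _).inv) ((α_ _ _ _).hom ≫ S' ◁ g' ≫ g)
        (parK (𝟙 (S ⊗ U)) (𝟙 (S' ⊗ U')) p q) r :=
  parLift_parK _ _ _ _ _ _ _

/-- The invertibility of the parallel associator. -/
def parAssocIso : conv (par C) (conv (par C) P Q) R ≅ conv (par C) P (conv (par C) Q R) :=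
  isoOfInverse (parAssoc P Q R)
    (fun A A' => parLift (fun f g p y => parAssocInvFun P Q R f g p y)
      (by
        intro S S' T T' U U' W W' f g s s' t t' p y
        obtain ⟨_, _, _, _, f', g', q, r, rfl⟩ := parK_surj y
        rw [act_pl_parK, parAssocInvFun_parK, parAssocInvFun_parK, parK_pl_left, parK_nest_left]
        refine parK_congr ?_ ?_ _ _
        · simp only [Category.assoc, interchange_left]; monoidal
        · rw [reassoc_of% interchange_left']; monoidal)
      (by
        intro S S' T T' N f g p y
        obtain ⟨_, _, _, _, f', g', q, r, rfl⟩ := parK_surj y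
        rw [act_sL_parK, parAssocInvFun_parK, parAssocInvFun_parK, parK_slide, parK_nest_left]
        refine parK_congr ?_ ?_ _ _ <;> monoidal))
    (by
      intro A A' x
      obtain ⟨_, _, _, _, f, g, x, r, rfl⟩ := parK_surj x
      obtain ⟨_, _, _, _, f', g', p, q, rfl⟩ := parK_surj x
      rw [parAssoc_parK, parLift_parK, parAssocInvFun_parK, parK_nest_left f g]
      refine parK_congr ?_ ?_ _ _ <;> monoidal)
    (by
      intro A A' x
      obtain ⟨_, _, _, _, f, g, p, y, rfl⟩ := parK_surj x
      obtain ⟨_, _, _, _, f', g', q, r, rfl⟩ := parK_surj y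
      rw [parLift_parK, parAssocInvFun_parK, parAssoc_parK, parK_nest_right f g]
      refine parK_congr ?_ ?_ _ _ <;> monoidal)

/-- The left unitor of the parallel structure. -/
def parLeft : conv (par C) (unit C) P ⟶ P :=
  homOfGenerators
    -- The morphism `n` is run before the hole, so the object kept beside the hole is its codomain
    -- `S'`. Dinaturality makes the choice immaterial.
    (fun A A' => parLift (fun {_ S' T T'} f g n p =>
        act (pl (f ≫ n.down ▷ T) g) (act (sL S' T T') p))
      (by
        intro S S' T T' U U' W W' f g s s' t t' n p
        obtain ⟨n, rfl⟩ := u_surj n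
        rw [act_pl_u, act_sL_pl, act_pl_pl]
        -- On one side `s'` runs before the hole of `p`, on the other after it.
        refine Eq.trans ?_ ((act_sL_dinat (f ≫ (s ⊗ₘ t) ≫ n ▷ W) s' (S' ◁ t' ≫ g) p).trans ?_)
        · refine act_pl_congr ?_ rfl _
          change (f ≫ (s ≫ n ≫ s') ▷ T) ≫ _ = _
          trans f ≫ ((s ≫ n ≫ s') ▷ T ≫ S' ◁ t)
          · monoidal
          · rw [← tensorHom_comp_whiskerRight]; monoidal
        · refine act_pl_congr ?_ ?_ _
          · change _ = (f ≫ (s ⊗ₘ t)) ≫ n ▷ W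
            monoidal
          · simp only [MonoidalCategory.tensorHom_def]; monoidal)
      (by
        intro S S' T T' N f g n p
        obtain ⟨n, rfl⟩ := u_surj n
        rw [act_sR_u, act_sL_sL, act_pl_pl]
        refine act_pl_congr ?_ ?_ _
        · change f ≫ n ▷ N ▷ T = ((f ≫ (α_ S N T).hom) ≫ n ▷ (N ⊗ T)) ≫ _
          monoidal
        · monoidal))
    (by
      intro A A' B B' f g x
      obtain ⟨_, _, _, _, f, g, n, p, rfl⟩ := parK_surj x
      rw [act_pl_parK, parLift_parK, parLift_parK, act_pl_pl]
      refine act_pl_congr ?_ ?_ _ <;> simp)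
    (by
      intro M A A' x
      obtain ⟨_, S', T, T', f, g, n, p, rfl⟩ := parK_surj x
      obtain ⟨n, rfl⟩ := u_surj n
      rw [act_sL_parK, act_sL_u, parLift_parK, parLift_parK, act_sL_pl, act_sL_sL, act_pl_pl]
      refine act_pl_congr ?_ ?_ _
      · change (M ◁ f ≫ (α_ _ _ _).inv) ≫ (M ◁ n) ▷ T = M ◁ (f ≫ n ▷ T) ≫ (α_ _ _ _).inv
        monoidal
      · rfl)
    (by
      intro A A' N x
      obtain ⟨_, S', T, T', f, g, n, p, rfl⟩ := parK_surj x
      obtain ⟨n, rfl⟩ := u_surj n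
      rw [act_sR_parK, parLift_parK, parLift_parK, act_sR_pl, act_sR_sL, act_pl_pl]
      refine act_pl_congr ?_ ?_ _
      · change (f ▷ N ≫ (α_ _ _ _).hom) ≫ n ▷ (T ⊗ N) = (f ≫ n ▷ T) ▷ N ≫ (α_ _ _ _).hom
        monoidal
      · rfl)

/-- The right unitor of the parallel structure. -/
def parRight : conv (par C) P (unit C) ⟶ P :=
  homOfGenerators
    (fun A A' => parLift (fun {S S' _ T'} f g p n =>
        act (pl (f ≫ S ◁ n.down) g) (act (sR S S' T') p))
      (by
        intro S S' T T' U U' W W' f g s s' t t' p n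
        obtain ⟨n, rfl⟩ := u_surj n
        rw [act_pl_u, act_sR_pl, act_pl_pl]
        refine Eq.trans ?_ ((act_sR_dinat (f ≫ (s ⊗ₘ t) ≫ U ◁ n) t' (s' ▷ T' ≫ g) p).trans ?_)
        · refine act_pl_congr ?_ rfl _
          change (f ≫ S ◁ (t ≫ n ≫ t')) ≫ _ = _
          trans f ≫ (S ◁ (t ≫ n ≫ t') ≫ s ▷ T')
          · monoidal
          · rw [← tensorHom_comp_whiskerLeft]; monoidal
        · refine act_pl_congr ?_ ?_ _
          · change _ = (f ≫ (s ⊗ₘ t)) ≫ U ◁ n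
            monoidal
          · simp only [MonoidalCategory.tensorHom_def']; monoidal)
      (by
        intro S S' T T' N f g p n
        obtain ⟨n, rfl⟩ := u_surj n
        rw [act_sL_u, act_sR_sR, act_pl_pl]
        refine act_pl_congr ?_ ?_ _
        · change (f ≫ (S ⊗ N) ◁ n) ≫ _ = (f ≫ (α_ S N T).hom) ≫ S ◁ (N ◁ n)
          monoidal
        · monoidal))
    (by
      intro A A' B B' f g x
      obtain ⟨_, _, _, _, f, g, p, n, rfl⟩ := parK_surj x
      rw [act_pl_parK, parLift_parK, parLift_parK, act_pl_pl]
      refine act_pl_congr ?_ ?_ _ <;> simp)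
    (by
      intro M A A' x
      obtain ⟨S, S', T, T', f, g, p, n, rfl⟩ := parK_surj x
      obtain ⟨n, rfl⟩ := u_surj n
      rw [act_sL_parK, parLift_parK, parLift_parK, act_sL_pl, act_sR_sL, act_pl_pl]
      refine act_pl_congr ?_ ?_ _
      · change ((M ◁ f ≫ (α_ _ _ _).inv) ≫ (M ⊗ S) ◁ n) ≫ _ = M ◁ (f ≫ S ◁ n)
        monoidal
      · monoidal)
    (by
      intro A A' N x
      obtain ⟨S, S', T, T', f, g, p, n, rfl⟩ := parK_surj x
      obtain ⟨n, rfl⟩ := u_surj n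
      rw [act_sR_parK, act_sR_u, parLift_parK, parLift_parK, act_sR_pl, act_sR_sR, act_pl_pl]
      refine act_pl_congr ?_ ?_ _
      · change (f ▷ N ≫ (α_ _ _ _).hom) ≫ S ◁ (n ▷ N) = (f ≫ S ◁ n) ▷ N ≫ (α_ _ _ _).hom
        monoidal
      · rfl)

variable {P}

lemma parLeft_parK {A A' S S' T T' : C} (f : A ⟶ S ⊗ T) (g : S' ⊗ T' ⟶ A') (n : S ⟶ S')
    (p : P.obj (op ⟨T, T'⟩)) :
    (parLeft P).app _ (parK f g (u n) p) = act (pl (f ≫ n ▷ T) g) (act (sL S' T T') p) := by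
  rw [parLeft, homOfGenerators_app, parLift_parK]
  rfl

lemma parRight_parK {A A' S S' T T' : C} (f : A ⟶ S ⊗ T) (g : S' ⊗ T' ⟶ A') (n : T ⟶ T')
    (p : P.obj (op ⟨S, S'⟩)) :
    (parRight P).app _ (parK f g p (u n)) = act (pl (f ≫ S ◁ n) g) (act (sR S S' T') p) := by
  rw [parRight, homOfGenerators_app, parLift_parK]
  rfl

variable (P)

/-- The invertibility of the left unitor. -/
def parLeftIso : conv (par C) (unit C) P ≅ P :=
  isoOfInverse (parLeft P) (fun A A' p => parK (λ_ A).inv (λ_ A').hom (u (𝟙 (𝟙_ C))) p)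
    (by
      intro A A' x
      obtain ⟨S, S', T, T', f, g, n, p, rfl⟩ := parK_surj x
      obtain ⟨n, rfl⟩ := u_surj n
      -- Up to a plain context, `u n` is the identity of the unit object whiskered by `S'`; the
      -- whiskering can therefore be slid onto `p`.
      have e : u n = act (pl (n ≫ (λ_ S').inv) (λ_ S').hom) (act (sR (𝟙_ C) (𝟙_ C) S')
          (u (𝟙 (𝟙_ C)))) := by
        rw [act_sR_u, act_pl_u]; congr 1; monoidal
      rw [parLeft_parK, parK_pl_right, e, parK_pl_left, parK_slide]
      refine parK_congr ?_ ?_ _ _ <;> monoidal)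
    (by
      intro A A' p
      rw [parLeft_parK, sL_unit, act_pl_pl]
      refine Eq.trans (act_pl_congr ?_ ?_ _) (act_pl_id _) <;> monoidal)

/-- The invertibility of the right unitor. -/
def parRightIso : conv (par C) P (unit C) ≅ P :=
  isoOfInverse (parRight P) (fun A A' p => parK (ρ_ A).inv (ρ_ A').hom p (u (𝟙 (𝟙_ C))))
    (by
      intro A A' x
      obtain ⟨S, S', T, T', f, g, p, n, rfl⟩ := parK_surj x
      obtain ⟨n, rfl⟩ := u_surj n
      have e : u n = act (pl (n ≫ (ρ_ T').inv) (ρ_ T').hom) (act (sL T' (𝟙_ C) (𝟙_ C))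
          (u (𝟙 (𝟙_ C)))) := by
        rw [act_sL_u, act_pl_u]; congr 1; monoidal
      rw [parRight_parK, parK_pl_left, e, parK_pl_right, parK_slide]
      refine parK_congr ?_ ?_ _ _ <;> monoidal)
    (by
      intro A A' p
      rw [parRight_parK, sR_unit, act_pl_pl]
      refine Eq.trans (act_pl_congr ?_ ?_ _) (act_pl_id _) <;> monoidal)

end Parallel

/-- The parallel structure at presheaf arguments. -/
def parVirtual (C : Type u) [Category.{v} C] [MonoidalCategory C] :
    VirtualData (par C) (unit C) where
  assoc := parAssocIso
  assoc_natural φ χ ω := by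
    refine hom_ext_parK fun A A' S S' T T' f g x r => ?_
    obtain ⟨_, _, _, _, f', g', p, q, rfl⟩ := parK_surj x
    change (parAssoc _ _ _).app _ (parK f g (parK f' g' _ _) _) =
      (convMap _ _ _).app _ ((parAssoc _ _ _).app _ (parK f g (parK f' g' p q) r))
    rw [parAssoc_parK, parAssoc_parK]
    rfl
  left := parLeftIso
  left_natural φ := by
    refine hom_ext_parK fun A A' S S' T T' f g n p => ?_
    obtain ⟨n, rfl⟩ := u_surj n
    change (parLeft _).app _ (parK f g (u n) _) = φ.app _ ((parLeft _).app _ _)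
    rw [parLeft_parK, parLeft_parK, app_act, app_act]
  right := parRightIso
  right_natural φ := by
    refine hom_ext_parK fun A A' S S' T T' f g p n => ?_
    obtain ⟨n, rfl⟩ := u_surj n
    change (parRight _).app _ (parK f g _ (u n)) = φ.app _ ((parRight _).app _ _)
    rw [parRight_parK, parRight_parK, app_act, app_act]

/-! ### The laxators -/

section Laxators

variable {P Q R S : Presheaf (MCtx C)}

lemma seqK_pl {A A' B X X' Y Y' : C} (f : A ⟶ X) (h : X' ⟶ B) (k : B ⟶ Y)
    (g : Y' ⟶ A') (p : P.obj (op ⟨X, X'⟩)) (q : Q.obj (op ⟨Y, Y'⟩)) :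
    seqK B (act (pl f h) p) (act (pl k g) q) =
      seqK X' (act (pl f (𝟙 X')) p) (act (pl (h ≫ k) g) q) := by
  have e := seqK_dinat h (act (pl f (𝟙 X')) p) (act (pl k g) q)
  simpa only [act_pl_pl, Category.id_comp, Category.comp_id] using e

/-- Normal form for two parallel layers: everything that happens between the layers is gathered at
the start of the second. -/
lemma seqK_parK {A A' B B' D D' E U U' W W' : C} (f : A ⟶ U ⊗ W) (h : B ⊗ D ⟶ E)
    (k : E ⟶ B' ⊗ D') (g : U' ⊗ W' ⟶ A') (p : P.obj (op ⟨U, B⟩)) (q : Q.obj (op ⟨B', U'⟩))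
    (r : R.obj (op ⟨W, D⟩)) (s : S.obj (op ⟨D', W'⟩)) :
    seqK E (parK f h p r) (parK k g q s) =
      seqK (B ⊗ D) (parK f (𝟙 _) p r) (parK (h ≫ k) g q s) := by
  have e := seqK_dinat h (parK f (𝟙 _) p r) (parK k g q s)
  simpa only [act_pl_parK, Category.id_comp, Category.comp_id] using e

lemma seqK_parK_of_comp_eq_id {A A' B D E U U' W W' : C} (f : A ⟶ U ⊗ W) (h : B ⊗ D ⟶ E)
    (k : E ⟶ B ⊗ D) (e : h ≫ k = 𝟙 _) (g : U' ⊗ W' ⟶ A') (p : P.obj (op ⟨U, B⟩))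
    (q : Q.obj (op ⟨B, U'⟩)) (r : R.obj (op ⟨W, D⟩)) (s : S.obj (op ⟨D, W'⟩)) :
    seqK E (parK f h p r) (parK k g q s) =
      seqK (B ⊗ D) (parK f (𝟙 _) p r) (parK (𝟙 _) g q s) := by
  rw [seqK_parK, e]

variable (P Q R S)

/-- The exchange of a parallel composite of canonical elements of sequential composites. -/
def psiFun {A A' U U' W W' : C} (f : A ⟶ U ⊗ W) (g : U' ⊗ W' ⟶ A')
    (x : (conv (seq C) P Q).obj (op ⟨U, U'⟩)) (y : (conv (seq C) R S).obj (op ⟨W, W'⟩)) :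
    (conv (seq C) (conv (par C) P R) (conv (par C) Q S)).obj (op ⟨A, A'⟩) :=
  seqLift (fun B p q => seqLift
      (fun D r s => seqK (B ⊗ D) (parK f (𝟙 _) p r) (parK (𝟙 _) g q s))
      (by
        intro D D' d r s
        rw [parK_pl_right, parK_pl_right, seqK_parK]
        simp) y)
    (by
      intro B B' b p q
      obtain ⟨D, r, s, rfl⟩ := seqK_surj y
      rw [seqLift_seqK, seqLift_seqK, parK_pl_left, parK_pl_left, seqK_parK]
      simp) x

variable {P Q R S}

lemma psiFun_seqK {A A' U U' W W' B D : C} (f : A ⟶ U ⊗ W) (g : U' ⊗ W' ⟶ A')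
    (p : P.obj (op ⟨U, B⟩)) (q : Q.obj (op ⟨B, U'⟩)) (r : R.obj (op ⟨W, D⟩))
    (s : S.obj (op ⟨D, W'⟩)) :
    psiFun P Q R S f g (seqK B p q) (seqK D r s) =
      seqK (B ⊗ D) (parK f (𝟙 _) p r) (parK (𝟙 _) g q s) := by
  rw [psiFun, seqLift_seqK, seqLift_seqK]

variable (P Q R S)

/-- The laxator `ψ₂` at presheaf arguments. -/
def psiHom : conv (par C) (conv (seq C) P Q) (conv (seq C) R S) ⟶
    conv (seq C) (conv (par C) P R) (conv (par C) Q S) :=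
  homOfGenerators
    (fun A A' => parLift (fun f g x y => psiFun P Q R S f g x y)
      (by
        intro S S' T T' U U' W W' f g s s' t t' x y
        obtain ⟨B, p, q, rfl⟩ := seqK_surj x
        obtain ⟨D, r, s, rfl⟩ := seqK_surj y
        rw [act_pl_seqK, act_pl_seqK, psiFun_seqK, psiFun_seqK, parK_pl, parK_pl]
        simp)
      (by
        intro S S' T T' N f g x y
        obtain ⟨B, p, q, rfl⟩ := seqK_surj x
        obtain ⟨D, r, s, rfl⟩ := seqK_surj y
        rw [act_sR_seqK, act_sL_seqK, psiFun_seqK, psiFun_seqK, parK_slide, parK_slide]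
        -- Sliding the side object in both layers leaves an associator and its inverse facing each
        -- other at the cut.
        exact seqK_parK_of_comp_eq_id _ _ _ (by simp) _ _ _ _ _))
    (by
      intro A A' B B' f g x
      obtain ⟨_, _, _, _, f, g, x, y, rfl⟩ := parK_surj x
      obtain ⟨B, p, q, rfl⟩ := seqK_surj x
      obtain ⟨D, r, s, rfl⟩ := seqK_surj y
      rw [act_pl_parK, parLift_parK, parLift_parK, psiFun_seqK, psiFun_seqK, act_pl_seqK,
        act_pl_parK, act_pl_parK]
      simp)
    (by
      intro M A A' x
      obtain ⟨_, _, _, _, f, g, x, y, rfl⟩ := parK_surj x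
      obtain ⟨B, p, q, rfl⟩ := seqK_surj x
      obtain ⟨D, r, s, rfl⟩ := seqK_surj y
      rw [act_sL_parK, act_sL_seqK, parLift_parK, parLift_parK, psiFun_seqK, psiFun_seqK,
        act_sL_seqK, act_sL_parK, act_sL_parK]
      exact (seqK_parK_of_comp_eq_id _ _ _ (by simp) _ _ _ _ _).symm)
    (by
      intro A A' N x
      obtain ⟨_, _, _, _, f, g, x, y, rfl⟩ := parK_surj x
      obtain ⟨B, p, q, rfl⟩ := seqK_surj x
      obtain ⟨D, r, s, rfl⟩ := seqK_surj y
      rw [act_sR_parK, act_sR_seqK, parLift_parK, parLift_parK, psiFun_seqK, psiFun_seqK,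
        act_sR_seqK, act_sR_parK, act_sR_parK]
      exact (seqK_parK_of_comp_eq_id _ _ _ (by simp) _ _ _ _ _).symm)

variable {P Q R S}

lemma psiHom_parK {A A' U U' W W' B D : C} (f : A ⟶ U ⊗ W) (g : U' ⊗ W' ⟶ A')
    (p : P.obj (op ⟨U, B⟩)) (q : Q.obj (op ⟨B, U'⟩)) (r : R.obj (op ⟨W, D⟩))
    (s : S.obj (op ⟨D, W'⟩)) :
    (psiHom P Q R S).app _ (parK f g (seqK B p q) (seqK D r s)) =
      seqK (B ⊗ D) (parK f (𝟙 _) p r) (parK (𝟙 _) g q s) := by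
  rw [psiHom, homOfGenerators_app, parLift_parK, psiFun_seqK]

end Laxators

/-- The laxator `ψ₂`. -/
def psiVirtual (C : Type u) [Category.{v} C] [MonoidalCategory C] :
    VirtualLaxator (par C) (seq C) where
  hom := psiHom
  natural φ χ ω σ := by
    refine hom_ext_parK fun A A' S S' T T' f g x y => ?_
    obtain ⟨B, p, q, rfl⟩ := seqK_surj x
    obtain ⟨D, r, s, rfl⟩ := seqK_surj y
    simp only [comp_app_apply, convMap_parK, convMap_seqK, psiHom_parK]

/-- The laxator `ψ₀`. -/
def psi₀Iso (C : Type u) [Category.{v} C] [MonoidalCategory C] :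
    unit C ≅ conv (seq C) (unit C) (unit C) := (seqLeftIso (unit C)).symm

/-- The laxator `φ₂`. -/
def phi₂Iso (C : Type u) [Category.{v} C] [MonoidalCategory C] :
    conv (par C) (unit C) (unit C) ≅ unit C := parLeftIso (unit C)

/-- The inverse of the left unitor cuts `n` at its source. -/
lemma psi₀Iso_u {A A' : C} (n : A ⟶ A') :
    (psi₀Iso C).hom.app _ (u n) = seqK A (u (𝟙 A)) (u n) := rfl

lemma phi₂Iso_parK {A A' S S' T T' : C} (f : A ⟶ S ⊗ T) (g : S' ⊗ T' ⟶ A') (n : S ⟶ S')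
    (m : T ⟶ T') : (phi₂Iso C).hom.app _ (parK f g (u n) (u m)) = u (f ≫ (n ⊗ₘ m) ≫ g) := by
  refine (parLeft_parK f g n (u m)).trans ?_
  rw [act_sL_u, act_pl_u, MonoidalCategory.tensorHom_def]
  simp

/-! ### Values of the structure maps on generators. -/

section Computation

variable {P Q R : Presheaf (MCtx C)}

lemma seqVirtual_assoc {A A' B D : C} (p : P.obj (op ⟨A, D⟩)) (q : Q.obj (op ⟨D, B⟩))
    (r : R.obj (op ⟨B, A'⟩)) :
    ((seqVirtual C).assoc P Q R).hom.app _ (seqK B (seqK D p q) r) = seqK D p (seqK B q r) :=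
  seqAssoc_seqK p q r

lemma seqVirtual_left {A A' B : C} (n : A ⟶ B) (p : P.obj (op ⟨B, A'⟩)) :
    ((seqVirtual C).left P).hom.app _ (seqK B (u n) p) = act (pl n (𝟙 A')) p :=
  seqLeft_seqK n p

lemma seqVirtual_right {A A' B : C} (p : P.obj (op ⟨A, B⟩)) (n : B ⟶ A') :
    ((seqVirtual C).right P).hom.app _ (seqK B p (u n)) = act (pl (𝟙 A) n) p :=
  seqRight_seqK p n

lemma parVirtual_assoc {A A' S S' T T' U U' W W' : C} (f : A ⟶ S ⊗ T) (g : S' ⊗ T' ⟶ A')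
    (f' : S ⟶ U ⊗ W) (g' : U' ⊗ W' ⟶ S') (p : P.obj (op ⟨U, U'⟩)) (q : Q.obj (op ⟨W, W'⟩))
    (r : R.obj (op ⟨T, T'⟩)) :
    ((parVirtual C).assoc P Q R).hom.app _ (parK f g (parK f' g' p q) r) =
      parK (f ≫ f' ▷ T ≫ (α_ U W T).hom) ((α_ U' W' T').inv ≫ g' ▷ T' ≫ g) p
        (parK (𝟙 (W ⊗ T)) (𝟙 (W' ⊗ T')) q r) :=
  parAssoc_parK f g f' g' p q r

lemma parVirtual_left {A A' S S' T T' : C} (f : A ⟶ S ⊗ T) (g : S' ⊗ T' ⟶ A') (n : S ⟶ S')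
    (p : P.obj (op ⟨T, T'⟩)) :
    ((parVirtual C).left P).hom.app _ (parK f g (u n) p) =
      act (pl (f ≫ n ▷ T) g) (act (sL S' T T') p) :=
  parLeft_parK f g n p

lemma parVirtual_right {A A' S S' T T' : C} (f : A ⟶ S ⊗ T) (g : S' ⊗ T' ⟶ A') (n : T ⟶ T')
    (p : P.obj (op ⟨S, S'⟩)) :
    ((parVirtual C).right P).hom.app _ (parK f g p (u n)) =
      act (pl (f ≫ S ◁ n) g) (act (sR S S' T') p) :=
  parRight_parK f g n p

end Computation

/-! ### Coherence of the two promonoidal structures. -/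

/-- The sequential promonoidal structure. -/
def seqPromonoidal (C : Type u) [Category.{v} C] [MonoidalCategory C] :
    Promonoidal (seq C) (unit C) where
  toPromonoidalData := (seqVirtual C).toData
  pentagon P Q R S := by
    simp only [VirtualData.assocConv_toData]
    refine hom_ext_seqK fun A A' B x s => ?_
    obtain ⟨D, x, r, rfl⟩ := seqK_surj x
    obtain ⟨E, p, q, rfl⟩ := seqK_surj x
    -- Both composites send `((p ; q) ; r) ; s` to `p ; (q ; (r ; s))`.
    simp only [comp_app_apply, id_app_apply, convMap_seqK, seqVirtual_assoc]
  triangle P Q := by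
    simp only [VirtualData.assocConv_toData, VirtualData.leftUnitorConv_toData,
      VirtualData.rightUnitorConv_toData]
    refine hom_ext_seqK fun A A' B x q => ?_
    obtain ⟨D, p, n, rfl⟩ := seqK_surj x
    obtain ⟨n, rfl⟩ := u_surj n
    simp only [comp_app_apply, id_app_apply, convMap_seqK, seqVirtual_assoc, seqVirtual_left,
      seqVirtual_right, seqK_dinat]

/-- The parallel promonoidal structure. -/
def parPromonoidal (C : Type u) [Category.{v} C] [MonoidalCategory C] :
    Promonoidal (par C) (unit C) where
  toPromonoidalData := (parVirtual C).toData
  pentagon P Q R S := by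
    simp only [VirtualData.assocConv_toData]
    refine hom_ext_parK fun A A' _ _ _ _ f g x s => ?_
    obtain ⟨_, _, _, _, f', g', x, r, rfl⟩ := parK_surj x
    obtain ⟨_, _, _, _, f'', g'', p, q, rfl⟩ := parK_surj x
    simp only [comp_app_apply, id_app_apply, convMap_parK, parVirtual_assoc]
    refine Eq.trans ?_ (parK_nest_right _ _ _ _ _ _ _).symm
    refine parK_congr ?_ ?_ _ _ <;> monoidal
  triangle P Q := by
    simp only [VirtualData.assocConv_toData, VirtualData.leftUnitorConv_toData,
      VirtualData.rightUnitorConv_toData]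
    refine hom_ext_parK fun A A' _ _ _ _ f g x q => ?_
    obtain ⟨_, _, _, _, f', g', p, n, rfl⟩ := parK_surj x
    obtain ⟨n, rfl⟩ := u_surj n
    simp only [comp_app_apply, id_app_apply, convMap_parK, parVirtual_assoc, parVirtual_left,
      parVirtual_right]
    -- The right unitor leaves a side object to the right of `p`, the left unitor one to the left of
    -- `q`; sliding identifies them.
    rw [parK_pl_left, parK_slide, parK_pl_right]
    refine parK_congr ?_ ?_ _ _ <;> monoidal

/-- The data of the produoidal structure of monoidal contexts. -/
def produoidalData (C : Type u) [Category.{v} C] [MonoidalCategory C] :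
    ProduoidalData (par C) (unit C) (seq C) (unit C) where
  par := parPromonoidal C
  seq := seqPromonoidal C
  psi₂ := (psiVirtual C).split
  psi₂_natural := (psiVirtual C).split_natural
  psi₀ := (psi₀Iso C).hom
  phi₂ := (phi₂Iso C).hom
  phi₀ := 𝟙 _

/-! ### Coherence between the two structures. -/

section Produoidal

variable (P Q R S : Presheaf (MCtx C))

/-- This equation and the following ones replace extended structure maps by those defined directly
at presheaf arguments, whose values on generators are known. -/
lemma produoidalData_psi₂Conv : (produoidalData C).psi₂Conv P Q R S = psiHom P Q R S :=
  (psiVirtual C).psi₂Conv_eq _ rfl P Q R S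

lemma produoidalData_par_assoc :
    (produoidalData C).par.assocConv P Q R = ((parVirtual C).assoc P Q R).hom :=
  (parVirtual C).assocConv_toData P Q R

lemma produoidalData_seq_assoc :
    (produoidalData C).seq.assocConv P Q R = ((seqVirtual C).assoc P Q R).hom :=
  (seqVirtual C).assocConv_toData P Q R

lemma produoidalData_par_left :
    (produoidalData C).par.leftUnitorConv P = ((parVirtual C).left P).hom :=
  (parVirtual C).leftUnitorConv_toData P

lemma produoidalData_par_right :
    (produoidalData C).par.rightUnitorConv P = ((parVirtual C).right P).hom :=
  (parVirtual C).rightUnitorConv_toData P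

lemma produoidalData_seq_left :
    (produoidalData C).seq.leftUnitorConv P = ((seqVirtual C).left P).hom :=
  (seqVirtual C).leftUnitorConv_toData P

lemma produoidalData_seq_right :
    (produoidalData C).seq.rightUnitorConv P = ((seqVirtual C).right P).hom :=
  (seqVirtual C).rightUnitorConv_toData P

end Produoidal

/-- The produoidal structure of monoidal contexts. -/
def produoidal (C : Type u) [Category.{v} C] [MonoidalCategory C] :
    ProduoidalStructure (par C) (unit C) (seq C) (unit C) where
  toProduoidalData := produoidalData C
  psi₂_assoc_par P Q R S T U := by
    simp only [produoidalData_psi₂Conv, produoidalData_par_assoc]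
    refine hom_ext_parK fun A A' _ _ _ _ f g x z => ?_
    obtain ⟨_, _, _, _, f', g', x, y, rfl⟩ := parK_surj x
    obtain ⟨B, p, q, rfl⟩ := seqK_surj x
    obtain ⟨D, r, s, rfl⟩ := seqK_surj y
    obtain ⟨E, t, w, rfl⟩ := seqK_surj z
    simp only [comp_app_apply, id_app_apply, convMap_parK, convMap_seqK, parVirtual_assoc,
      psiHom_parK]
    -- One side cuts at `B ⊗ (D ⊗ E)`, the other at `(B ⊗ D) ⊗ E`; the associator and its inverse
    -- meet at the cut and cancel.
    refine Eq.trans ?_ (seqK_parK_of_comp_eq_id _ _ _ (by simp) _ _ _ _ _).symm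
    simp
  psi₂_assoc_seq P Q R S T U := by
    simp only [produoidalData_psi₂Conv, produoidalData_seq_assoc]
    refine hom_ext_parK fun A A' _ _ _ _ f g x y => ?_
    obtain ⟨B, x, r, rfl⟩ := seqK_surj x
    obtain ⟨D, p, q, rfl⟩ := seqK_surj x
    obtain ⟨B', y, w, rfl⟩ := seqK_surj y
    obtain ⟨D', s, t, rfl⟩ := seqK_surj y
    simp only [comp_app_apply, id_app_apply, convMap_parK, convMap_seqK, seqVirtual_assoc,
      psiHom_parK]
  par_left_unit P Q := by
    simp only [produoidalData_psi₂Conv, produoidalData_par_left]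
    refine hom_ext_parK fun A A' _ _ _ _ f g n x => ?_
    obtain ⟨n, rfl⟩ := u_surj n
    obtain ⟨B, p, q, rfl⟩ := seqK_surj x
    simp only [comp_app_apply, id_app_apply, convMap_parK, convMap_seqK, produoidalData, psi₀Iso_u,
      psiHom_parK, parVirtual_left, act_sL_seqK, act_pl_seqK]
    simp only [MonoidalCategory.id_whiskerRight, Category.id_comp, Category.comp_id]
    -- Since `ψ₀` splits `n` as an identity followed by `n`, one side runs `n` in the second layer,
    -- while the other runs it before `p`. Dinaturality moves it past `p`, and `seqK_pl` across the
    -- cut.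
    rw [act_sL_dinat]
    refine Eq.trans ?_ (seqK_pl _ _ _ _ _ _).symm
    simp
  par_right_unit P Q := by
    simp only [produoidalData_psi₂Conv, produoidalData_par_right]
    refine hom_ext_parK fun A A' _ _ _ _ f g x n => ?_
    obtain ⟨n, rfl⟩ := u_surj n
    obtain ⟨B, p, q, rfl⟩ := seqK_surj x
    simp only [comp_app_apply, id_app_apply, convMap_parK, convMap_seqK, produoidalData, psi₀Iso_u,
      psiHom_parK, parVirtual_right, act_sR_seqK, act_pl_seqK]
    simp only [MonoidalCategory.whiskerLeft_id, Category.id_comp, Category.comp_id]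
    -- The mirror image of the previous argument.
    rw [act_sR_dinat]
    refine Eq.trans ?_ (seqK_pl _ _ _ _ _ _).symm
    simp
  seq_left_unit P Q := by
    simp only [produoidalData_psi₂Conv, produoidalData_seq_left]
    refine hom_ext_parK fun A A' _ _ _ _ f g x y => ?_
    obtain ⟨B, n, p, rfl⟩ := seqK_surj x
    obtain ⟨D, m, q, rfl⟩ := seqK_surj y
    obtain ⟨n, rfl⟩ := u_surj n
    obtain ⟨m, rfl⟩ := u_surj m
    simp only [comp_app_apply, id_app_apply, convMap_parK, convMap_seqK, produoidalData,
      psiHom_parK, phi₂Iso_parK, seqVirtual_left, parK_pl, act_pl_parK]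
    simp
  seq_right_unit P Q := by
    simp only [produoidalData_psi₂Conv, produoidalData_seq_right]
    refine hom_ext_parK fun A A' _ _ _ _ f g x y => ?_
    obtain ⟨B, p, n, rfl⟩ := seqK_surj x
    obtain ⟨D, q, m, rfl⟩ := seqK_surj y
    obtain ⟨n, rfl⟩ := u_surj n
    obtain ⟨m, rfl⟩ := u_surj m
    simp only [comp_app_apply, id_app_apply, convMap_parK, convMap_seqK, produoidalData,
      psiHom_parK, phi₂Iso_parK, seqVirtual_right, parK_pl, act_pl_parK]
    simp
  phi₂_assoc := by
    simp only [produoidalData_par_assoc]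
    refine hom_ext_parK fun A A' _ _ _ _ f g x k => ?_
    obtain ⟨_, _, _, _, f', g', n, m, rfl⟩ := parK_surj x
    obtain ⟨n, rfl⟩ := u_surj n
    obtain ⟨m, rfl⟩ := u_surj m
    obtain ⟨k, rfl⟩ := u_surj k
    simp only [comp_app_apply, id_app_apply, convMap_parK, produoidalData, parVirtual_assoc,
      phi₂Iso_parK]
    -- After reassociation `k` is run together with `m`, hence before `g'`; interchange puts the
    -- other side in this order.
    have e : (f' ≫ (n ⊗ₘ m) ≫ g') ⊗ₘ k = (f' ≫ (n ⊗ₘ m)) ▷ _ ≫ _ ◁ k ≫ g' ▷ _ := by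
      rw [whisker_exchange, MonoidalCategory.tensorHom_def]
      monoidal
    rw [e]
    congr 1
    simp only [MonoidalCategory.tensorHom_def]
    monoidal
  psi₀_coassoc := by
    simp only [produoidalData_seq_assoc]
    refine hom_ext_at fun A A' n => ?_
    obtain ⟨n, rfl⟩ := u_surj n
    simp only [comp_app_apply, id_app_apply, convMap_seqK, produoidalData, psi₀Iso_u,
      seqVirtual_assoc]
  phi_unit_left := by
    simp only [produoidalData_par_left]
    rw [show (produoidalData C).phi₀ = 𝟙 _ from rfl, convMap_id, Category.id_comp]
    rfl
  phi_unit_right := by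
    simp only [produoidalData_par_right]
    refine hom_ext_parK fun A A' _ _ _ _ f g n m => ?_
    obtain ⟨n, rfl⟩ := u_surj n
    obtain ⟨m, rfl⟩ := u_surj m
    simp only [comp_app_apply, id_app_apply, convMap_parK, produoidalData, phi₂Iso_parK,
      parVirtual_right, act_sR_u, act_pl_u, MonoidalCategory.tensorHom_def', Category.assoc]
  psi_counit_left := by
    simp only [produoidalData_seq_left]
    refine hom_ext_at fun A A' n => ?_
    obtain ⟨n, rfl⟩ := u_surj n
    simp only [comp_app_apply, id_app_apply, convMap_seqK, produoidalData, psi₀Iso_u,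
      seqVirtual_left, act_pl_id]
  psi_counit_right := by
    simp only [produoidalData_seq_right]
    refine hom_ext_at fun A A' n => ?_
    obtain ⟨n, rfl⟩ := u_surj n
    simp only [comp_app_apply, id_app_apply, convMap_seqK, produoidalData, psi₀Iso_u,
      seqVirtual_right, ← u_eq_pl_left]

/-! ### Classes of representatives -/

section Representatives

variable {A A' : C} {X Y Z W : MCtx C}

/-- A context as an element of a representable presheaf. -/
def hole {M N : C} (f : A ⟶ M ⊗ X.dom ⊗ N) (g : M ⊗ X.cod ⊗ N ⟶ A') : (yo X).obj (op ⟨A, A'⟩) :=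
  toYoneda (A := ⟨A, A'⟩) (ctx f g)

/-- The sequential split `f ⨾ (M ⊗ ■ ⊗ N) ⨾ g ⨾ (K ⊗ ■ ⊗ L) ⨾ h`. -/
def seqS {M N K L : C} (f : A ⟶ M ⊗ X.dom ⊗ N) (g : M ⊗ X.cod ⊗ N ⟶ K ⊗ Y.dom ⊗ L)
    (h : K ⊗ Y.cod ⊗ L ⟶ A') : (((seq C).obj X).obj Y).obj (op ⟨A, A'⟩) :=
  SeqRep.cls (A := ⟨A, A'⟩) ⟨f, g, h⟩

/-- The parallel split `f ⨾ (M ⊗ ■ ⊗ N ⊗ ■ ⊗ O) ⨾ g`. -/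
def parS {M N O : C} (f : A ⟶ M ⊗ X.dom ⊗ N ⊗ Y.dom ⊗ O) (g : M ⊗ X.cod ⊗ N ⊗ Y.cod ⊗ O ⟶ A') :
    (((par C).obj X).obj Y).obj (op ⟨A, A'⟩) :=
  ParRep.cls (A := ⟨A, A'⟩) ⟨f, g⟩

lemma hole_surj (x : (yo X).obj (op ⟨A, A'⟩)) :
    ∃ (M N : C) (f : A ⟶ M ⊗ X.dom ⊗ N) (g : M ⊗ X.cod ⊗ N ⟶ A'), x = hole f g := by
  obtain ⟨⟨r⟩⟩ := x
  exact ⟨_, _, r.f, r.g, rfl⟩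

lemma seqS_surj (x : (((seq C).obj X).obj Y).obj (op ⟨A, A'⟩)) :
    ∃ (M N K L : C) (f : A ⟶ M ⊗ X.dom ⊗ N) (g : M ⊗ X.cod ⊗ N ⟶ K ⊗ Y.dom ⊗ L)
      (h : K ⊗ Y.cod ⊗ L ⟶ A'), x = seqS f g h := by
  obtain ⟨r⟩ := x
  exact ⟨_, _, _, _, r.f, r.g, r.h, rfl⟩

lemma parS_surj (x : (((par C).obj X).obj Y).obj (op ⟨A, A'⟩)) :
    ∃ (M N O : C) (f : A ⟶ M ⊗ X.dom ⊗ N ⊗ Y.dom ⊗ O) (g : M ⊗ X.cod ⊗ N ⊗ Y.cod ⊗ O ⟶ A'),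
      x = parS f g := by
  obtain ⟨r⟩ := x
  exact ⟨_, _, _, r.f, r.g, rfl⟩

lemma hole_eq {M M' N N' : C} (m : M ⟶ M') (n : N ⟶ N') {f : A ⟶ M ⊗ X.dom ⊗ N}
    {f' : A ⟶ M' ⊗ X.dom ⊗ N'} {g : M ⊗ X.cod ⊗ N ⟶ A'} {g' : M' ⊗ X.cod ⊗ N' ⟶ A'}
    (hf : f' = f ≫ side m X.dom n) (hg : g = side m X.cod n ≫ g') : hole f' g' = hole f g :=
  congr_arg (toYoneda (A := ⟨A, A'⟩)) (ctx_eq m n hf hg)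

lemma hole_congr {M N : C} {f f' : A ⟶ M ⊗ X.dom ⊗ N} {g g' : M ⊗ X.cod ⊗ N ⟶ A'} (hf : f = f')
    (hg : g = g') : hole f g = hole f' g' := by rw [hf, hg]

lemma act_yoId {A : MCtx C} (c : A ⟶ X) : act c (yoId X) = toYoneda c :=
  congr_arg toYoneda (Category.comp_id c)

lemma act_pl_hole {D D' M N : C} (a : D ⟶ A) (b : A' ⟶ D') (f : A ⟶ M ⊗ X.dom ⊗ N)
    (g : M ⊗ X.cod ⊗ N ⟶ A') : act (pl a b) (hole f g) = hole (a ≫ f) (g ≫ b) :=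
  congr_arg (toYoneda (A := ⟨D, D'⟩)) (pl_comp_ctx (B := ⟨A, A'⟩) a b f g)

lemma act_ctx_hole {D : MCtx C} {K L M N : C} (a : D.dom ⟶ K ⊗ A ⊗ L) (b : K ⊗ A' ⊗ L ⟶ D.cod)
    (f : A ⟶ M ⊗ X.dom ⊗ N) (g : M ⊗ X.cod ⊗ N ⟶ A') :
    act (ctx (X := ⟨A, A'⟩) a b) (hole f g) =
      hole (M := K ⊗ M) (N := N ⊗ L) (a ≫ K ◁ f ▷ L ⊗≫ 𝟙 _) (𝟙 _ ⊗≫ K ◁ g ▷ L ≫ b) := rfl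

lemma act_sR_hole {K M N : C} (f : A ⟶ M ⊗ X.dom ⊗ N) (g : M ⊗ X.cod ⊗ N ⟶ A') :
    act (sR A A' K) (hole f g) =
      hole (M := M) (N := N ⊗ K) (f ▷ K ⊗≫ 𝟙 _) (𝟙 _ ⊗≫ g ▷ K) := by
  refine (congr_arg (toYoneda (A := ⟨A ⊗ K, A' ⊗ K⟩)) ?_ :
    toYoneda (sR A A' K ≫ ctx (A := ⟨A, A'⟩) f g) = _)
  refine ctx_eq (λ_ M).inv (𝟙 _) ?_ ?_ <;> simp only [side_eq, monoidalComp] <;> monoidal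

lemma act_pl_seqS {D D' M N K L : C} (a : D ⟶ A) (b : A' ⟶ D') (f : A ⟶ M ⊗ X.dom ⊗ N)
    (g : M ⊗ X.cod ⊗ N ⟶ K ⊗ Y.dom ⊗ L) (h : K ⊗ Y.cod ⊗ L ⟶ A') :
    act (pl a b) (seqS f g h) = seqS (a ≫ f) g (h ≫ b) := by
  refine (seqSplit_eq₁ (λ_ M).inv (ρ_ N).inv (g := g ≫ side (λ_ K).inv Y.dom (ρ_ L).inv)
    ?_ ?_).trans (seqSplit_eq₂ (λ_ K).inv (ρ_ L).inv ?_ ?_) <;>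
      simp only [side_eq, monoidalComp] <;> monoidal

lemma act_ctx_seqS {D : MCtx C} {E F M N K L : C} (a : D.dom ⟶ E ⊗ A ⊗ F)
    (b : E ⊗ A' ⊗ F ⟶ D.cod) (f : A ⟶ M ⊗ X.dom ⊗ N) (g : M ⊗ X.cod ⊗ N ⟶ K ⊗ Y.dom ⊗ L)
    (h : K ⊗ Y.cod ⊗ L ⟶ A') :
    act (ctx (X := ⟨A, A'⟩) a b) (seqS f g h) =
      seqS (M := E ⊗ M) (N := N ⊗ F) (K := E ⊗ K) (L := L ⊗ F) (a ≫ E ◁ f ▷ F ⊗≫ 𝟙 _)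
        (𝟙 _ ⊗≫ E ◁ g ▷ F ⊗≫ 𝟙 _) (𝟙 _ ⊗≫ E ◁ h ▷ F ≫ b) := rfl

lemma act_pl_parS {D D' M N O : C} (a : D ⟶ A) (b : A' ⟶ D') (f : A ⟶ M ⊗ X.dom ⊗ N ⊗ Y.dom ⊗ O)
    (g : M ⊗ X.cod ⊗ N ⊗ Y.cod ⊗ O ⟶ A') :
    act (pl a b) (parS f g) = parS (a ≫ f) (g ≫ b) := by
  refine parSplit_eq (λ_ M).inv (𝟙 N) (ρ_ O).inv ?_ ?_ <;>
    simp only [side₂_eq, monoidalComp] <;> monoidal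

lemma act_ctx_parS {D : MCtx C} {E F M N O : C} (a : D.dom ⟶ E ⊗ A ⊗ F)
    (b : E ⊗ A' ⊗ F ⟶ D.cod) (f : A ⟶ M ⊗ X.dom ⊗ N ⊗ Y.dom ⊗ O)
    (g : M ⊗ X.cod ⊗ N ⊗ Y.cod ⊗ O ⟶ A') :
    act (ctx (X := ⟨A, A'⟩) a b) (parS f g) =
      parS (M := E ⊗ M) (N := N) (O := O ⊗ F) (a ≫ E ◁ f ▷ F ⊗≫ 𝟙 _)
        (𝟙 _ ⊗≫ E ◁ g ▷ F ≫ b) := rfl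

lemma act_sL_parS {K M N O : C} (f : A ⟶ M ⊗ X.dom ⊗ N ⊗ Y.dom ⊗ O)
    (g : M ⊗ X.cod ⊗ N ⊗ Y.cod ⊗ O ⟶ A') :
    act (sL K A A') (parS f g) =
      parS (M := K ⊗ M) (N := N) (O := O) (K ◁ f ⊗≫ 𝟙 _) (𝟙 _ ⊗≫ K ◁ g) := by
  refine parSplit_eq (𝟙 _) (𝟙 N) (ρ_ O).inv ?_ ?_ <;>
    simp only [side₂_eq, monoidalComp] <;> monoidal

lemma act_sR_parS {K M N O : C} (f : A ⟶ M ⊗ X.dom ⊗ N ⊗ Y.dom ⊗ O)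
    (g : M ⊗ X.cod ⊗ N ⊗ Y.cod ⊗ O ⟶ A') :
    act (sR A A' K) (parS f g) =
      parS (M := M) (N := N) (O := O ⊗ K) (f ▷ K ⊗≫ 𝟙 _) (𝟙 _ ⊗≫ g ▷ K) := by
  refine parSplit_eq (λ_ M).inv (𝟙 N) (𝟙 _) ?_ ?_ <;>
    simp only [side₂_eq, monoidalComp] <;> monoidal

lemma splitIso_seqS {M N K L : C} (f : A ⟶ M ⊗ X.dom ⊗ N) (g : M ⊗ X.cod ⊗ N ⟶ K ⊗ Y.dom ⊗ L)
    (h : K ⊗ Y.cod ⊗ L ⟶ A') :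
    (splitIso (seq C) X Y).hom.app _ (seqS f g h) =
      seqK (M ⊗ X.cod ⊗ N) (hole f (𝟙 _)) (hole g h) := by
  refine (convMk_seqSplit f g h (yoId X) (yoId Y)).trans ?_
  rw [act_yoId, act_yoId]
  rfl

/-- Sliding `f'` across the cut leaves the first piece ending at its hole, the form in which the
Yoneda reduction presents a split. -/
lemma seqK_hole {M N K L B : C} (f : A ⟶ M ⊗ X.dom ⊗ N) (f' : M ⊗ X.cod ⊗ N ⟶ B)
    (g : B ⟶ K ⊗ Y.dom ⊗ L) (h : K ⊗ Y.cod ⊗ L ⟶ A') :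
    seqK B (hole f f') (hole g h) =
      (splitIso (seq C) X Y).hom.app _ (seqS f (f' ≫ g) h) := by
  have e := seqK_dinat f' (hole f (𝟙 _)) (hole g h)
  rw [act_pl_hole, act_pl_hole, Category.id_comp, Category.id_comp, Category.comp_id] at e
  rw [e, splitIso_seqS]

lemma splitIso_parS {M N O : C} (f : A ⟶ M ⊗ X.dom ⊗ N ⊗ Y.dom ⊗ O)
    (g : M ⊗ X.cod ⊗ N ⊗ Y.cod ⊗ O ⟶ A') :
    (splitIso (par C) X Y).hom.app _ (parS f g) =
      parK (S := M ⊗ X.dom ⊗ N) (T := Y.dom ⊗ O) (S' := M ⊗ X.cod ⊗ N) (T' := Y.cod ⊗ O)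
        (f ⊗≫ 𝟙 _) (𝟙 _ ⊗≫ g) (hole (𝟙 _) (𝟙 _)) (hole (λ_ _).inv (λ_ _).hom) := by
  refine (convMk_parSplit f g (yoId X) (yoId Y)).trans ?_
  rw [act_yoId, act_yoId]
  rfl

lemma parK_hole {S S' T T' M N K L : C} (f : A ⟶ S ⊗ T) (g : S' ⊗ T' ⟶ A')
    (h : S ⟶ M ⊗ X.dom ⊗ N) (h' : M ⊗ X.cod ⊗ N ⟶ S') (k : T ⟶ K ⊗ Y.dom ⊗ L)
    (k' : K ⊗ Y.cod ⊗ L ⟶ T') :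
    parK f g (hole h h') (hole k k') =
      (splitIso (par C) X Y).hom.app _
        (parS (M := M) (N := N ⊗ K) (O := L) (f ≫ (h ⊗ₘ k) ⊗≫ 𝟙 _)
          (𝟙 _ ⊗≫ (h' ⊗ₘ k') ≫ g)) := by
  have e₁ : hole h h' = act (pl h h') (act (st M X N) (yoId X)) := by
    rw [act_yoId]
    refine Eq.trans ?_ (act_pl_hole h h' (𝟙 _) (𝟙 _)).symm
    simp
  -- The side object `K` is split off as a left whiskering so that `slide_st` can join it to `N`.
  have e₂ : hole k k' = act (pl k k') (act (sL K _ _) (act (sR Y.dom Y.cod L) (yoId Y))) := by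
    rw [act_act, act_act, act_yoId]
    exact congr_arg (toYoneda (A := ⟨T, T'⟩)) ((ctx_eq_comp (A := ⟨T, T'⟩) k k').trans
      (Category.assoc _ _ _).symm)
  rw [e₁, e₂, parK_pl, slide_st parK parK_pl parK_slide]
  refine Eq.trans ?_ (convMk_parSplit _ _ (yoId X) (yoId Y)).symm
  refine parK_congr ?_ ?_ _ _ <;> simp only [monoidalComp] <;> monoidal

end Representatives

/-! ### Sequential splits into three -/

section SeqThree

variable {A A' : C} {X Y Z : MCtx C}

/-- The class of a representative. -/
def seqThree {M N K L P Q : C} (f : A ⟶ M ⊗ X.dom ⊗ N) (g : M ⊗ X.cod ⊗ N ⟶ K ⊗ Y.dom ⊗ L)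
    (h : K ⊗ Y.cod ⊗ L ⟶ P ⊗ Z.dom ⊗ Q) (k : P ⊗ Z.cod ⊗ Q ⟶ A') :
    SeqThree (⟨A, A'⟩ : MCtx C) X Y Z := Quot.mk _ ⟨f, g, h, k⟩

lemma seqThree_eq₁ {M M' N N' K L P Q : C} (m : M ⟶ M') (n : N ⟶ N') {f : A ⟶ M ⊗ X.dom ⊗ N}
    {g : M' ⊗ X.cod ⊗ N' ⟶ K ⊗ Y.dom ⊗ L} {h : K ⊗ Y.cod ⊗ L ⟶ P ⊗ Z.dom ⊗ Q}
    {k : P ⊗ Z.cod ⊗ Q ⟶ A'} :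
    seqThree (f ≫ side m X.dom n) g h k = seqThree f (side m X.cod n ≫ g) h k := by
  have e := Quot.sound (SeqThreeRel.dinat (A := ⟨A, A'⟩) m n (𝟙 K) (𝟙 L) (𝟙 P) (𝟙 Q) f g h k)
  simp only [side_id, Category.comp_id, Category.id_comp] at e
  exact e

lemma seqThree_eq₂₃ {M N K K' L L' P P' Q Q' : C} (i : K ⟶ K') (l : L ⟶ L') (p : P ⟶ P')
    (q : Q ⟶ Q') {f : A ⟶ M ⊗ X.dom ⊗ N}
    {g : M ⊗ X.cod ⊗ N ⟶ K ⊗ Y.dom ⊗ L} {h : K' ⊗ Y.cod ⊗ L' ⟶ P ⊗ Z.dom ⊗ Q}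
    {k : P' ⊗ Z.cod ⊗ Q' ⟶ A'} :
    seqThree f (g ≫ side i Y.dom l) (h ≫ side p Z.dom q) k =
      seqThree f g (side i Y.cod l ≫ h) (side p Z.cod q ≫ k) := by
  have e := Quot.sound (SeqThreeRel.dinat (A := ⟨A, A'⟩) (𝟙 M) (𝟙 N) i l p q f g h k)
  simp only [side_id, Category.comp_id, Category.id_comp] at e
  exact e

/-- Substitution of a sequential split after a context. -/
def seqThreeFun {B : C} (x : (yo X).obj (op ⟨A, B⟩))
    (t : (((seq C).obj Y).obj Z).obj (op ⟨B, A'⟩)) : SeqThree (⟨A, A'⟩ : MCtx C) X Y Z :=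
  Quot.lift₂ (fun (r : HomRep (⟨A, B⟩ : MCtx C) X) (s : SeqRep (⟨B, A'⟩ : MCtx C) Y Z) =>
      seqThree r.f (r.g ≫ s.f) s.g s.h)
    (by
      rintro r _ _ ⟨m, n, k, l, f, g, h⟩
      simpa only [Category.assoc] using seqThree_eq₂₃ m n k l (f := r.f) (g := r.g ≫ f) (h := g))
    (by
      rintro _ _ s ⟨m, n, f, g⟩
      simpa only [Category.assoc] using seqThree_eq₁ m n (f := f) (g := g ≫ s.f))
    (x.down : Ctx _ X) t

lemma seqThreeFun_hole {B M N K L P Q : C} (f : A ⟶ M ⊗ X.dom ⊗ N) (f' : M ⊗ X.cod ⊗ N ⟶ B)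
    (g : B ⟶ K ⊗ Y.dom ⊗ L) (h : K ⊗ Y.cod ⊗ L ⟶ P ⊗ Z.dom ⊗ Q) (k : P ⊗ Z.cod ⊗ Q ⟶ A') :
    seqThreeFun (hole f f') (seqS g h k) = seqThree f (f' ≫ g) h k := rfl

/-- The split into three given by an element of the virtual composite. -/
def toSeqThree : (conv (seq C) (yo X) (((seq C).obj Y).obj Z)).obj (op ⟨A, A'⟩) →
    SeqThree (⟨A, A'⟩ : MCtx C) X Y Z :=
  seqLift (fun _ x t => seqThreeFun x t) (by
    intro B B' b x t
    obtain ⟨_, _, f, f', rfl⟩ := hole_surj x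
    obtain ⟨_, _, _, _, g, h, k, rfl⟩ := seqS_surj t
    rw [act_pl_hole, act_pl_seqS, seqThreeFun_hole, seqThreeFun_hole]
    simp)

lemma toSeqThree_seqK {B M N K L P Q : C} (f : A ⟶ M ⊗ X.dom ⊗ N) (f' : M ⊗ X.cod ⊗ N ⟶ B)
    (g : B ⟶ K ⊗ Y.dom ⊗ L) (h : K ⊗ Y.cod ⊗ L ⟶ P ⊗ Z.dom ⊗ Q) (k : P ⊗ Z.cod ⊗ Q ⟶ A') :
    toSeqThree (seqK B (hole f f') (seqS g h k)) = seqThree f (f' ≫ g) h k := by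
  rw [toSeqThree, seqLift_seqK, seqThreeFun_hole]

/-- The element of the virtual composite given by a split into three. -/
def ofSeqThree : SeqThree (⟨A, A'⟩ : MCtx C) X Y Z →
    (conv (seq C) (yo X) (((seq C).obj Y).obj Z)).obj (op ⟨A, A'⟩) :=
  Quot.lift (fun r => seqK _ (hole r.f (𝟙 _)) (seqS r.g r.h r.k)) (by
    rintro _ _ ⟨m, n, i, l, p, q, f, g, h, k⟩
    have e₁ : seqS (g ≫ side i Y.dom l) (h ≫ side p Z.dom q) k =
        seqS g (side i Y.cod l ≫ h) (side p Z.cod q ≫ k) :=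
      Quot.sound (SeqRel.dinat (A := ⟨_, A'⟩) i l p q g h k)
    have e₂ : hole (f ≫ side m X.dom n) (𝟙 _) = act (pl (𝟙 A) (side m X.cod n)) (hole f (𝟙 _)) := by
      rw [act_pl_hole]
      exact hole_eq m n (by simp) (by simp)
    refine (congr_arg₂ (seqK _) e₂ e₁).trans ?_
    rw [seqK_dinat, act_pl_seqS, Category.comp_id])

/-- The two elements differ only in the side of the cut on which `f'` is placed. A one-sided inverse
is enough, since only injectivity of `toSeqThree` is used. -/
lemma ofSeqThree_toSeqThree (x : (conv (seq C) (yo X) (((seq C).obj Y).obj Z)).obj (op ⟨A, A'⟩)) :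
    ofSeqThree (toSeqThree x) = x := by
  obtain ⟨B, x, t, rfl⟩ := seqK_surj x
  obtain ⟨_, _, f, f', rfl⟩ := hole_surj x
  obtain ⟨_, _, _, _, g, h, k, rfl⟩ := seqS_surj t
  rw [toSeqThree_seqK]
  change seqK _ (hole f (𝟙 _)) (seqS (f' ≫ g) h k) = _
  have e := seqK_dinat f' (hole f (𝟙 _)) (seqS g h k)
  rw [act_pl_hole, act_pl_seqS, Category.id_comp, Category.id_comp, Category.comp_id] at e
  exact e.symm

lemma toSeqThree_injective : Function.Injective (toSeqThree (A := A) (A' := A') (X := X) (Y := Y)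
    (Z := Z)) := Function.LeftInverse.injective ofSeqThree_toSeqThree

end SeqThree

lemma convMap_id_injective (T : Protensor (MCtx C)) {P Q R : Presheaf (MCtx C)} (e : Q ≅ R)
    (A : (MCtx C)ᵒᵖ) : Function.Injective ((convMap T (𝟙 P) e.hom).app A) :=
  (Iso.toEquiv ((convIso T (Iso.refl P) e).app A)).injective

lemma seqK_app_right {P Q R : Presheaf (MCtx C)} (χ : Q ⟶ R) {A A' B : C}
    (p : P.obj (op ⟨A, B⟩)) (q : Q.obj (op ⟨B, A'⟩)) :
    seqK B p (χ.app _ q) = (convMap (seq C) (𝟙 P) χ).app _ (seqK B p q) := rfl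

/-- Both nested elements are carried, by injective maps, to splits with three holes; reassociation
only changes the bracketing, so the results are the two substitutions. -/
theorem seq_assoc_iff {A U U' X Y Z : MCtx C} (s : SeqRep A U Z) (t : SeqRep U X Y)
    (s' : SeqRep A X U') (t' : SeqRep U' Y Z) :
    ((produoidal C).seq.assoc X Y Z).hom.app (op A) (nestLMk (seq C) s.cls t.cls) =
      nestRMk (seq C) s'.cls t'.cls ↔ s.substLeft t = s'.substRight t' := by
  obtain ⟨A, A'⟩ := A
  refine ((seqVirtual C).assocIso_app_eq_iff _ _).trans ?_
  change (seqAssoc _ _ _).app _ (convMk (seq C) (seqSplit s.f s.g s.h)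
    ((splitIso (seq C) X Y).hom.app _ t.cls) (yoId Z)) = (convMap (seq C) (𝟙 _) _).app _
      (convMk (seq C) (seqSplit s'.f s'.g s'.h) (yoId X) t'.cls) ↔ _
  have e₁ := splitIso_seqS t.f t.g t.h
  change (splitIso (seq C) X Y).hom.app _ t.cls = _ at e₁
  rw [e₁, convMk_seqSplit, convMk_seqSplit, act_ctx_seqK, act_yoId, act_yoId]
  change (seqAssoc _ _ _).app _ (seqK _ (seqK _ (act (ctx _ _) (hole _ _))
    (act (ctx _ _) (hole _ _))) (hole _ _)) = (convMap (seq C) (𝟙 _) _).app _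
      (seqK _ (hole _ _) (act (ctx _ _) (seqS t'.f t'.g t'.h))) ↔ _
  rw [seqAssoc_seqK, act_ctx_hole, act_ctx_hole, seqK_hole]
  -- First the Yoneda reduction on the second factor is cancelled, then the remaining equality is
  -- tested in the coend of three-hole splits.
  rw [seqK_app_right (splitIso (seq C) Y Z).hom, (convMap_id_injective _ _ _).eq_iff, ← toSeqThree_injective.eq_iff, act_ctx_seqS,
    toSeqThree_seqK, toSeqThree_seqK]
  refine Eq.congr ?_ ?_
  · refine congr_arg (Quot.mk _) ?_
    congr 1 <;> simp only [monoidalComp] <;> monoidal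
  · refine congr_arg (Quot.mk _) ?_
    congr 1
    simp

/-! ### The units -/

section Units

lemma act_ctx_u {A B B' M N : C} {A' : C} (f : A ⟶ M ⊗ B ⊗ N) (g : M ⊗ B' ⊗ N ⟶ A')
    (n : B ⟶ B') :
    act (ctx (A := ⟨A, A'⟩) (X := ⟨B, B'⟩) f g) (u n) = u (f ≫ M ◁ n ▷ N ≫ g) := rfl

theorem seq_leftUnitor_app {A U X : MCtx C} (s : SeqRep A U X) (n : U.dom ⟶ U.cod) :
    ((produoidal C).seq.leftUnitor X).hom.app (op A) (nestLMk (seq C) s.cls (toUnit n)) =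
      toYoneda (ctx (s.f ≫ s.M ◁ n ▷ s.N ≫ s.g) s.h) := by
  obtain ⟨A, A'⟩ := A
  change (seqLeft _).app _ (convMk (seq C) (seqSplit s.f s.g s.h) (u n) (yoId X)) = _
  rw [convMk_seqSplit, act_yoId, act_ctx_u, seqLeft_seqK]
  refine (act_pl_hole _ _ _ _).trans (hole_congr ?_ ?_) <;> simp

theorem seq_rightUnitor_app {A U X : MCtx C} (s : SeqRep A X U) (n : U.dom ⟶ U.cod) :
    ((produoidal C).seq.rightUnitor X).hom.app (op A) (nestRMk (seq C) s.cls (toUnit n)) =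
      toYoneda (ctx s.f (s.g ≫ s.K ◁ n ▷ s.L ≫ s.h)) := by
  obtain ⟨A, A'⟩ := A
  change (seqRight _).app _ (convMk (seq C) (seqSplit s.f s.g s.h) (yoId X) (u n)) = _
  rw [convMk_seqSplit, act_yoId, act_ctx_u, seqRight_seqK]
  refine (act_pl_hole _ _ _ _).trans (hole_congr ?_ ?_) <;> simp

theorem par_leftUnitor_app {A U X : MCtx C} (s : ParRep A U X) (n : U.dom ⟶ U.cod) :
    ((produoidal C).par.leftUnitor X).hom.app (op A) (nestLMk (par C) s.cls (toUnit n)) =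
      toYoneda (ctx (M := s.M ⊗ U.cod ⊗ s.N) (N := s.O)
        (s.f ≫ s.M ◁ n ▷ (s.N ⊗ X.dom ⊗ s.O) ⊗≫ 𝟙 _) (𝟙 _ ⊗≫ s.g)) := by
  obtain ⟨A, A'⟩ := A
  change (parLeft _).app _ (convMk (par C) (parSplit s.f s.g) (u n) (yoId X)) = _
  rw [convMk_parSplit, act_ctx_u, parLeft_parK, act_act, act_act, Category.assoc, act_yoId]
  refine congr_arg toYoneda ((ctx_eq_comp (A := ⟨A, A'⟩) _ _).symm.trans ?_)
  congr 1
  simp only [monoidalComp]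
  monoidal

theorem par_rightUnitor_app {A U X : MCtx C} (s : ParRep A X U) (n : U.dom ⟶ U.cod) :
    ((produoidal C).par.rightUnitor X).hom.app (op A) (nestRMk (par C) s.cls (toUnit n)) =
      toYoneda (ctx (M := s.M) (N := s.N ⊗ U.cod ⊗ s.O)
        (s.f ≫ s.M ◁ X.dom ◁ s.N ◁ n ▷ s.O) s.g) := by
  obtain ⟨A, A'⟩ := A
  change (parRight _).app _ (convMk (par C) (parSplit s.f s.g) (yoId X) (u n)) = _
  rw [convMk_parSplit, act_sR_u, parRight_parK, act_yoId]
  refine (congr_arg (act _) (act_sR_hole (𝟙 _) (𝟙 _))).trans ?_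
  refine (act_pl_hole _ _ _ _).trans (hole_congr ?_ ?_) <;> simp only [monoidalComp] <;> monoidal

/-- The left unitor at the unit is injective and composes the pieces of a cut, so equality of splits
becomes equality of composites in `C`. -/
theorem psi₀_app_eq_iff {A U V : MCtx C} (f : A.dom ⟶ A.cod) (s : SeqRep A U V)
    (g : U.dom ⟶ U.cod) (h : V.dom ⟶ V.cod) :
    (produoidal C).psi₀.app (op A) (toUnit f) = convMk (seq C) s.cls (toUnit g) (toUnit h) ↔
      f = s.f ≫ s.M ◁ g ▷ s.N ≫ s.g ≫ s.K ◁ h ▷ s.L ≫ s.h := by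
  obtain ⟨A, A'⟩ := A
  change seqK A (u (𝟙 A)) (u f) = convMk (seq C) (seqSplit s.f s.g s.h) (u g) (u h) ↔ _
  have inj : Function.Injective ((seqLeft (unit C)).app (op ⟨A, A'⟩)) :=
    (Iso.toEquiv ((seqLeftIso (unit C)).app _)).injective
  rw [convMk_seqSplit, act_ctx_u, act_ctx_u, ← inj.eq_iff, seqLeft_seqK, seqLeft_seqK, act_pl_u,
    act_pl_u]
  refine (ULift.up_inj (α := A ⟶ A')).trans ?_
  simp

theorem phi₂_app {A U V : MCtx C} (s : ParRep A U V) (g : U.dom ⟶ U.cod) (h : V.dom ⟶ V.cod) :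
    (produoidal C).phi₂.app (op A) (convMk (par C) s.cls (toUnit g) (toUnit h)) =
      toUnit (s.f ≫ (𝟙 s.M ⊗ₘ g ⊗ₘ 𝟙 s.N ⊗ₘ h ⊗ₘ 𝟙 s.O) ≫ s.g) := by
  obtain ⟨A, A'⟩ := A
  change (phi₂Iso C).hom.app _ (convMk (par C) (parSplit s.f s.g) (u g) (u h)) = u _
  rw [convMk_parSplit, act_ctx_u, act_sR_u, phi₂Iso_parK]
  congr 1
  simp only [monoidalComp, MonoidalCategory.tensorHom_def]
  monoidal

end Units

/-! ### Parallel splits into three -/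

section ParThree

variable {A A' : C} {X Y Z : MCtx C}

/-- The class of a representative. -/
def parThree {M N O P : C} (f : A ⟶ M ⊗ X.dom ⊗ N ⊗ Y.dom ⊗ O ⊗ Z.dom ⊗ P)
    (g : M ⊗ X.cod ⊗ N ⊗ Y.cod ⊗ O ⊗ Z.cod ⊗ P ⟶ A') :
    ParThree (⟨A, A'⟩ : MCtx C) X Y Z := Quot.mk _ ⟨f, g⟩

lemma side₃_eq {M M' N N' O O' P P' : C} (m : M ⟶ M') (X : C) (n : N ⟶ N') (Y : C) (o : O ⟶ O')
    (Z : C) (p : P ⟶ P') :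
    side₃ m X n Y o Z p =
      m ▷ _ ≫ M' ◁ X ◁ (n ▷ _ ≫ N' ◁ Y ◁ (o ▷ _ ≫ O' ◁ Z ◁ p)) := by
  simp [side₃, MonoidalCategory.tensorHom_def, -whiskerRight_tensor]

lemma parThree_eq {M M' N N' O O' P P' : C} (m : M ⟶ M') (n : N ⟶ N') (o : O ⟶ O') (p : P ⟶ P')
    {f : A ⟶ M ⊗ X.dom ⊗ N ⊗ Y.dom ⊗ O ⊗ Z.dom ⊗ P}
    {f' : A ⟶ M' ⊗ X.dom ⊗ N' ⊗ Y.dom ⊗ O' ⊗ Z.dom ⊗ P'}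
    {g : M ⊗ X.cod ⊗ N ⊗ Y.cod ⊗ O ⊗ Z.cod ⊗ P ⟶ A'}
    {g' : M' ⊗ X.cod ⊗ N' ⊗ Y.cod ⊗ O' ⊗ Z.cod ⊗ P' ⟶ A'}
    (hf : f' = f ≫ side₃ m X.dom n Y.dom o Z.dom p)
    (hg : g = side₃ m X.cod n Y.cod o Z.cod p ≫ g') : parThree f' g' = parThree f g := by
  subst hf hg
  exact Quot.sound (ParThreeRel.dinat (A := ⟨A, A'⟩) m n o p f g')

/-- Substitution of a context and a parallel split, in parallel. -/
def parThreeFun {S S' T T' : C} (f : A ⟶ S ⊗ T) (g : S' ⊗ T' ⟶ A')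
    (x : (yo X).obj (op ⟨S, S'⟩)) (t : (((par C).obj Y).obj Z).obj (op ⟨T, T'⟩)) :
    ParThree (⟨A, A'⟩ : MCtx C) X Y Z :=
  Quot.lift₂ (fun (r : HomRep (⟨S, S'⟩ : MCtx C) X) (s : ParRep (⟨T, T'⟩ : MCtx C) Y Z) =>
      parThree (M := r.M) (N := r.N ⊗ s.M) (O := s.N) (P := s.O)
        (f ≫ (r.f ⊗ₘ s.f) ⊗≫ 𝟙 _) (𝟙 _ ⊗≫ (r.g ⊗ₘ s.g) ≫ g))
    (by
      rintro r _ _ ⟨m, n, o, h, k⟩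
      refine parThree_eq (𝟙 _) (r.N ◁ m) n o ?_ ?_
      · simp only [side₂_eq, side₃_eq, monoidalComp, MonoidalCategory.tensorHom_def]; monoidal
      · simp only [side₂_eq, side₃_eq, monoidalComp, MonoidalCategory.tensorHom_def']; monoidal)
    (by
      rintro _ _ s ⟨m, n, h, k⟩
      refine parThree_eq m (n ▷ s.M) (𝟙 _) (𝟙 _) ?_ ?_
      · simp only [side_eq, side₃_eq, monoidalComp, MonoidalCategory.tensorHom_def']; monoidal
      · simp only [side_eq, side₃_eq, monoidalComp, MonoidalCategory.tensorHom_def]; monoidal)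
    (x.down : Ctx _ X) t

lemma parThreeFun_hole {S S' T T' M N K L O : C} (f : A ⟶ S ⊗ T) (g : S' ⊗ T' ⟶ A')
    (h : S ⟶ M ⊗ X.dom ⊗ N) (h' : M ⊗ X.cod ⊗ N ⟶ S') (k : T ⟶ K ⊗ Y.dom ⊗ L ⊗ Z.dom ⊗ O)
    (k' : K ⊗ Y.cod ⊗ L ⊗ Z.cod ⊗ O ⟶ T') :
    parThreeFun f g (hole h h') (parS k k') =
      parThree (M := M) (N := N ⊗ K) (O := L) (P := O)
        (f ≫ (h ⊗ₘ k) ⊗≫ 𝟙 _) (𝟙 _ ⊗≫ (h' ⊗ₘ k') ≫ g) := rfl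

/-- The split into three given by an element of the virtual composite. -/
def toParThree : (conv (par C) (yo X) (((par C).obj Y).obj Z)).obj (op ⟨A, A'⟩) →
    ParThree (⟨A, A'⟩ : MCtx C) X Y Z :=
  parLift (fun f g x t => parThreeFun f g x t)
    (by
      intro S S' T T' U U' W W' f g s s' t t' x y
      obtain ⟨_, _, h, h', rfl⟩ := hole_surj x
      obtain ⟨_, _, _, k, k', rfl⟩ := parS_surj y
      rw [act_pl_hole, act_pl_parS, parThreeFun_hole, parThreeFun_hole]
      simp only [← MonoidalCategory.tensorHom_comp_tensorHom, monoidalComp, Category.assoc])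
    (by
      intro S S' T T' K f g x y
      obtain ⟨_, _, h, h', rfl⟩ := hole_surj x
      obtain ⟨_, _, _, k, k', rfl⟩ := parS_surj y
      rw [act_sR_hole, act_sL_parS, parThreeFun_hole, parThreeFun_hole]
      refine parThree_eq (𝟙 _) (α_ _ _ _).inv (𝟙 _) (𝟙 _) ?_ ?_ <;>
        simp only [side₃_eq, monoidalComp, MonoidalCategory.tensorHom_def] <;> monoidal)

lemma toParThree_parK {S S' T T' M N K L O : C} (f : A ⟶ S ⊗ T) (g : S' ⊗ T' ⟶ A')
    (h : S ⟶ M ⊗ X.dom ⊗ N) (h' : M ⊗ X.cod ⊗ N ⟶ S') (k : T ⟶ K ⊗ Y.dom ⊗ L ⊗ Z.dom ⊗ O)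
    (k' : K ⊗ Y.cod ⊗ L ⊗ Z.cod ⊗ O ⟶ T') :
    toParThree (parK f g (hole h h') (parS k k')) =
      parThree (M := M) (N := N ⊗ K) (O := L) (P := O)
        (f ≫ (h ⊗ₘ k) ⊗≫ 𝟙 _) (𝟙 _ ⊗≫ (h' ⊗ₘ k') ≫ g) := by
  rw [toParThree, parLift_parK, parThreeFun_hole]

/-- The context `M ⊗ ■`. -/
def holeL (M : C) (X : MCtx C) : (yo X).obj (op ⟨M ⊗ X.dom, M ⊗ X.cod⟩) :=
  hole (M ◁ (ρ_ _).inv) (M ◁ (ρ_ _).hom)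

/-- The parallel split `M ⊗ ■ ⊗ N ⊗ ■ ⊗ O`. -/
def parId (M : C) (X : MCtx C) (N : C) (Y : MCtx C) (O : C) :
    (((par C).obj X).obj Y).obj (op ⟨M ⊗ X.dom ⊗ N ⊗ Y.dom ⊗ O, M ⊗ X.cod ⊗ N ⊗ Y.cod ⊗ O⟩) :=
  parS (𝟙 _) (𝟙 _)

lemma parS_eq {M M' N N' O O' : C} (m : M ⟶ M') (n : N ⟶ N') (o : O ⟶ O')
    {f : A ⟶ M ⊗ X.dom ⊗ N ⊗ Y.dom ⊗ O} {f' : A ⟶ M' ⊗ X.dom ⊗ N' ⊗ Y.dom ⊗ O'}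
    {g : M ⊗ X.cod ⊗ N ⊗ Y.cod ⊗ O ⟶ A'} {g' : M' ⊗ X.cod ⊗ N' ⊗ Y.cod ⊗ O' ⟶ A'}
    (hf : f' = f ≫ side₂ m X.dom n Y.dom o) (hg : g = side₂ m X.cod n Y.cod o ≫ g') :
    parS f' g' = parS f g := parSplit_eq (A := ⟨A, A'⟩) m n o hf hg

lemma parS_eq_pl {M N O : C} (f : A ⟶ M ⊗ X.dom ⊗ N ⊗ Y.dom ⊗ O)
    (g : M ⊗ X.cod ⊗ N ⊗ Y.cod ⊗ O ⟶ A') : parS f g = act (pl f g) (parId M X N Y O) := by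
  rw [parId, act_pl_parS, Category.comp_id, Category.id_comp]

/-- The element of the virtual composite given by a split into three. -/
def ofParThree : ParThree (⟨A, A'⟩ : MCtx C) X Y Z →
    (conv (par C) (yo X) (((par C).obj Y).obj Z)).obj (op ⟨A, A'⟩) :=
  Quot.lift (fun r => parK (r.f ≫ (α_ _ _ _).inv) ((α_ _ _ _).hom ≫ r.g) (holeL r.M X)
      (parId r.N Y r.O Z r.P)) (by
    rintro _ _ ⟨m, n, o, p, f, g⟩
    rename_i M M' N N' O O' P P'
    have e₁ : act (pl (m ▷ X.dom) (𝟙 _)) (holeL M' X) =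
        act (pl (𝟙 _) (m ▷ X.cod)) (holeL M X) := by
      rw [holeL, holeL, act_pl_hole, act_pl_hole]
      refine hole_eq m (𝟙 _) ?_ ?_ <;> simp only [side_eq] <;> monoidal
    have e₂ : act (pl (side₂ n Y.dom o Z.dom p) (𝟙 _)) (parId N' Y O' Z P') =
        act (pl (𝟙 _) (side₂ n Y.cod o Z.cod p)) (parId N Y O Z P) := by
      rw [parId, parId, act_pl_parS, act_pl_parS]
      exact parS_eq n o p (by simp) (by simp)
    have e := parK_pl (f ≫ (α_ _ _ _).inv) ((α_ _ _ _).hom ≫ g) (m ▷ X.dom) (𝟙 _)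
      (side₂ n Y.dom o Z.dom p) (𝟙 _) (holeL M' X) (parId N' Y O' Z P')
    rw [e₁, e₂, parK_pl] at e
    refine Eq.trans ?_ (e.symm.trans ?_) <;> refine parK_congr ?_ ?_ _ _ <;>
      simp only [side₃_eq, side₂_eq, MonoidalCategory.tensorHom_def] <;> monoidal)

/-- The normal form keeps nothing to the right of the first hole: `N` is slid into the split of `Y`
and `Z`, where it merges with `K`. -/
lemma ofParThree_toParThree (x : (conv (par C) (yo X) (((par C).obj Y).obj Z)).obj (op ⟨A, A'⟩)) :
    ofParThree (toParThree x) = x := by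
  obtain ⟨S, S', T, T', f, g, x, t, rfl⟩ := parK_surj x
  obtain ⟨M, N, h, h', rfl⟩ := hole_surj x
  obtain ⟨K, L, O, k, k', rfl⟩ := parS_surj t
  have e₁ : hole h h' = act (pl (h ≫ (α_ M X.dom N).inv) ((α_ M X.cod N).hom ≫ h'))
      (act (sR _ _ N) (holeL M X)) := by
    rw [holeL, act_sR_hole, act_pl_hole]
    refine hole_eq (𝟙 _) (λ_ N).hom ?_ ?_ <;> simp only [side_eq, monoidalComp] <;> monoidal
  have e₂ : act (sL N _ _) (parId K Y L Z O) =
      act (pl (α_ _ _ _).inv (α_ _ _ _).hom) (parId (N ⊗ K) Y L Z O) := by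
    rw [parId, act_sL_parS, ← parS_eq_pl]
    refine parS_eq (𝟙 _) (𝟙 _) (𝟙 _) ?_ ?_ <;> simp only [side₂_eq, monoidalComp] <;> monoidal
  rw [toParThree_parK, e₁, parS_eq_pl k, parK_pl, parK_slide, e₂, parK_pl_right]
  refine parK_congr ?_ ?_ _ _
  · simp only [monoidalComp, MonoidalCategory.tensorHom_def]; monoidal
  · simp only [monoidalComp, MonoidalCategory.tensorHom_def]; monoidal

lemma toParThree_injective : Function.Injective (toParThree (A := A) (A' := A') (X := X) (Y := Y)
    (Z := Z)) := Function.LeftInverse.injective ofParThree_toParThree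

end ParThree

lemma parK_app_right {P Q R : Presheaf (MCtx C)} (χ : Q ⟶ R) {A A' S S' T T' : C}
    (f : A ⟶ S ⊗ T) (g : S' ⊗ T' ⟶ A') (p : P.obj (op ⟨S, S'⟩)) (q : Q.obj (op ⟨T, T'⟩)) :
    parK f g p (χ.app _ q) = (convMap (par C) (𝟙 P) χ).app _ (parK f g p q) := rfl

theorem par_assoc_iff {A U U' X Y Z : MCtx C} (s : ParRep A U Z) (t : ParRep U X Y)
    (s' : ParRep A X U') (t' : ParRep U' Y Z) :
    ((produoidal C).par.assoc X Y Z).hom.app (op A) (nestLMk (par C) s.cls t.cls) =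
      nestRMk (par C) s'.cls t'.cls ↔ s.substLeft t = s'.substRight t' := by
  obtain ⟨A, A'⟩ := A
  refine ((parVirtual C).assocIso_app_eq_iff _ _).trans ?_
  change (parAssoc _ _ _).app _ (convMk (par C) (parSplit s.f s.g)
    ((splitIso (par C) X Y).hom.app _ (parS t.f t.g)) (yoId Z)) = (convMap (par C) (𝟙 _) _).app _
      (convMk (par C) (parSplit s'.f s'.g) (yoId X) (parS t'.f t'.g)) ↔ _
  rw [convMk_parSplit, convMk_parSplit, ← app_act, act_yoId, act_yoId]
  change (parAssoc _ _ _).app _ (parK _ _ ((splitIso (par C) X Y).hom.app _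
    (act (ctx _ _) (parS t.f t.g))) (hole _ _)) = (convMap (par C) (𝟙 _) _).app _
      (parK _ _ (hole _ _) (act (sR _ _ _) (parS t'.f t'.g))) ↔ _
  rw [act_ctx_parS, act_sR_parS, splitIso_parS, parAssoc_parK, parK_hole,
    parK_app_right (splitIso (par C) Y Z).hom, (convMap_id_injective _ _ _).eq_iff,
    ← toParThree_injective.eq_iff, toParThree_parK, toParThree_parK]
  refine Eq.congr ?_ ?_
  -- The second and third holes come from factors whose left side object is `𝟙_ C`, so the two
  -- middle side objects carry a superfluous unit on the right.
  · refine parThree_eq (𝟙 _) (ρ_ _).inv (ρ_ _).inv (𝟙 _) ?_ ?_ <;>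
      simp only [side₃_eq, monoidalComp, MonoidalCategory.tensorHom_def] <;> monoidal
  · refine congr_arg (Quot.mk _) ?_
    congr 1 <;> simp only [monoidalComp, MonoidalCategory.tensorHom_def] <;> monoidal

/-! ### Sequential splits into two parallel layers -/

section SeqPar

variable {A A' : C} {X Y Z W : MCtx C}

/-- The class of a representative. -/
def seqPar {M N O K L R : C} (f : A ⟶ M ⊗ X.dom ⊗ N ⊗ Z.dom ⊗ O)
    (g : M ⊗ X.cod ⊗ N ⊗ Z.cod ⊗ O ⟶ K ⊗ Y.dom ⊗ L ⊗ W.dom ⊗ R)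
    (h : K ⊗ Y.cod ⊗ L ⊗ W.cod ⊗ R ⟶ A') :
    SeqPar (⟨A, A'⟩ : MCtx C) X Y Z W := Quot.mk _ ⟨f, g, h⟩

lemma seqPar_eq {M M' N N' O O' K K' L L' R R' : C} (m : M ⟶ M') (n : N ⟶ N') (o : O ⟶ O')
    (k : K ⟶ K') (l : L ⟶ L') (r : R ⟶ R')
    {f : A ⟶ M ⊗ X.dom ⊗ N ⊗ Z.dom ⊗ O} {f' : A ⟶ M' ⊗ X.dom ⊗ N' ⊗ Z.dom ⊗ O'}
    (g : M' ⊗ X.cod ⊗ N' ⊗ Z.cod ⊗ O' ⟶ K ⊗ Y.dom ⊗ L ⊗ W.dom ⊗ R)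
    {g₁ : M' ⊗ X.cod ⊗ N' ⊗ Z.cod ⊗ O' ⟶ K' ⊗ Y.dom ⊗ L' ⊗ W.dom ⊗ R'}
    {g₂ : M ⊗ X.cod ⊗ N ⊗ Z.cod ⊗ O ⟶ K ⊗ Y.dom ⊗ L ⊗ W.dom ⊗ R}
    {h : K ⊗ Y.cod ⊗ L ⊗ W.cod ⊗ R ⟶ A'} {h' : K' ⊗ Y.cod ⊗ L' ⊗ W.cod ⊗ R' ⟶ A'}
    (hf : f' = f ≫ side₂ m X.dom n Z.dom o) (hg₁ : g₁ = g ≫ side₂ k Y.dom l W.dom r)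
    (hg₂ : g₂ = side₂ m X.cod n Z.cod o ≫ g) (hh : h = side₂ k Y.cod l W.cod r ≫ h') :
    seqPar f' g₁ h' = seqPar f g₂ h := by
  subst hf hg₁ hg₂ hh
  exact Quot.sound (SeqParRel.dinat (A := ⟨A, A'⟩) m n o k l r f g h')

lemma side₂_id {M X N Y O : C} : side₂ (𝟙 M) X (𝟙 N) Y (𝟙 O) = 𝟙 _ := by simp [side₂]

/-- Composition of two parallel splits. -/
def seqParFun {B : C} (x : (((par C).obj X).obj Z).obj (op ⟨A, B⟩))
    (y : (((par C).obj Y).obj W).obj (op ⟨B, A'⟩)) : SeqPar (⟨A, A'⟩ : MCtx C) X Y Z W :=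
  Quot.lift₂ (fun (r : ParRep (⟨A, B⟩ : MCtx C) X Z) (s : ParRep (⟨B, A'⟩ : MCtx C) Y W) =>
      seqPar r.f (r.g ≫ s.f) s.g)
    (by
      rintro r _ _ ⟨m, n, o, f, g⟩
      exact seqPar_eq (𝟙 _) (𝟙 _) (𝟙 _) m n o (r.g ≫ f) (by rw [side₂_id, Category.comp_id])
        (Category.assoc _ _ _).symm (by rw [side₂_id, Category.id_comp]) rfl)
    (by
      rintro _ _ s ⟨m, n, o, f, g⟩
      exact seqPar_eq m n o (𝟙 _) (𝟙 _) (𝟙 _) (g ≫ s.f) rfl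
        (by rw [side₂_id, Category.comp_id]) (Category.assoc _ _ _)
        (by rw [side₂_id, Category.id_comp]))
    x y

lemma seqParFun_parS {B M N O K L R : C} (f : A ⟶ M ⊗ X.dom ⊗ N ⊗ Z.dom ⊗ O)
    (f' : M ⊗ X.cod ⊗ N ⊗ Z.cod ⊗ O ⟶ B) (g : B ⟶ K ⊗ Y.dom ⊗ L ⊗ W.dom ⊗ R)
    (g' : K ⊗ Y.cod ⊗ L ⊗ W.cod ⊗ R ⟶ A') :
    seqParFun (parS f f') (parS g g') = seqPar f (f' ≫ g) g' := rfl

/-- The split into two layers given by an element of the virtual composite. -/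
def toSeqPar : (conv (seq C) (((par C).obj X).obj Z) (((par C).obj Y).obj W)).obj (op ⟨A, A'⟩) →
    SeqPar (⟨A, A'⟩ : MCtx C) X Y Z W :=
  seqLift (fun _ x y => seqParFun x y) (by
    intro B B' b x y
    obtain ⟨_, _, _, f, f', rfl⟩ := parS_surj x
    obtain ⟨_, _, _, g, g', rfl⟩ := parS_surj y
    rw [act_pl_parS, act_pl_parS, seqParFun_parS, seqParFun_parS]
    simp)

lemma toSeqPar_seqK {B M N O K L R : C} (f : A ⟶ M ⊗ X.dom ⊗ N ⊗ Z.dom ⊗ O)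
    (f' : M ⊗ X.cod ⊗ N ⊗ Z.cod ⊗ O ⟶ B) (g : B ⟶ K ⊗ Y.dom ⊗ L ⊗ W.dom ⊗ R)
    (g' : K ⊗ Y.cod ⊗ L ⊗ W.cod ⊗ R ⟶ A') :
    toSeqPar (seqK B (parS f f') (parS g g')) = seqPar f (f' ≫ g) g' := by
  rw [toSeqPar, seqLift_seqK, seqParFun_parS]

/-- The element of the virtual composite given by a split into two layers. -/
def ofSeqPar : SeqPar (⟨A, A'⟩ : MCtx C) X Y Z W →
    (conv (seq C) (((par C).obj X).obj Z) (((par C).obj Y).obj W)).obj (op ⟨A, A'⟩) :=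
  Quot.lift (fun r => seqK _ (parS r.f (𝟙 _)) (parS r.g r.h)) (by
    rintro _ _ ⟨m, n, o, k, l, r, f, g, h⟩
    have e₁ : parS (f ≫ side₂ m X.dom n Z.dom o) (𝟙 _) =
        act (pl (𝟙 A) (side₂ m X.cod n Z.cod o)) (parS f (𝟙 _)) := by
      rw [act_pl_parS]
      exact parS_eq m n o (by simp) (by simp)
    have e₂ : parS (g ≫ side₂ k Y.dom l W.dom r) h = parS g (side₂ k Y.cod l W.cod r ≫ h) :=
      parS_eq k l r rfl rfl
    refine (congr_arg₂ (seqK _) e₁ e₂).trans ?_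
    rw [seqK_dinat, act_pl_parS, Category.comp_id])

lemma ofSeqPar_toSeqPar
    (x : (conv (seq C) (((par C).obj X).obj Z) (((par C).obj Y).obj W)).obj (op ⟨A, A'⟩)) :
    ofSeqPar (toSeqPar x) = x := by
  obtain ⟨B, x, y, rfl⟩ := seqK_surj x
  obtain ⟨_, _, _, f, f', rfl⟩ := parS_surj x
  obtain ⟨_, _, _, g, g', rfl⟩ := parS_surj y
  rw [toSeqPar_seqK]
  change seqK _ (parS f (𝟙 _)) (parS (f' ≫ g) g') = _
  have e := seqK_dinat f' (parS f (𝟙 _)) (parS g g')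
  rw [act_pl_parS, act_pl_parS, Category.id_comp, Category.id_comp, Category.comp_id] at e
  exact e.symm

lemma toSeqPar_injective : Function.Injective (toSeqPar (A := A) (A' := A') (X := X) (Y := Y)
    (Z := Z) (W := W)) := Function.LeftInverse.injective ofSeqPar_toSeqPar

end SeqPar

/-- Interchange turns a parallel composite of cuts into a cut between two parallel composites. Each
of these is a parallel split of objects, and the two layers embed in the coend of two-layer splits.
-/
theorem psi₂_app_eq_iff {A U V U' V' X Y Z W : MCtx C} (r : ParRep A U V) (s : SeqRep U X Y)
    (t : SeqRep V Z W) (s' : SeqRep A U' V') (p : ParRep U' X Z) (q : ParRep V' Y W) :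
    ((produoidal C).psi₂ X Y Z W).app (op A) (convMk (par C) r.cls s.cls t.cls) =
      convMk (seq C) s'.cls p.cls q.cls ↔ r.substSeq s t = s'.substPar p q := by
  obtain ⟨A, A'⟩ := A
  refine ((psiVirtual C).split_app_eq_iff _ _).trans ?_
  change (psiHom _ _ _ _).app _ (convMk (par C) (parSplit r.f r.g)
    ((splitIso (seq C) X Y).hom.app _ (seqS s.f s.g s.h))
      ((splitIso (seq C) Z W).hom.app _ (seqS t.f t.g t.h))) =
    (convMap (seq C) _ _).app _
      (convMk (seq C) (seqSplit s'.f s'.g s'.h) (parS p.f p.g) (parS q.f q.g)) ↔ _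
  rw [splitIso_seqS, splitIso_seqS, convMk_parSplit, convMk_seqSplit]
  rw [act_ctx_seqK, act_sR_seqK, psiHom_parK]
  change seqK _ (parK _ _ (act (ctx _ _) (hole _ _)) (act (sR _ _ _) (hole _ _)))
    (parK _ _ (act (ctx _ _) (hole _ _)) (act (sR _ _ _) (hole _ _))) = (convMap (seq C) _ _).app _
      (seqK _ (act (ctx _ _) (parS p.f p.g)) (act (ctx _ _) (parS q.f q.g))) ↔ _
  simp only [act_ctx_hole, act_sR_hole, parK_hole, act_ctx_parS]
  rw [← convMap_seqK]
  have inj : Function.Injective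
      ((convMap (seq C) (splitIso (par C) X Z).hom (splitIso (par C) Y W).hom).app (op ⟨A, A'⟩)) :=
    (Iso.toEquiv ((convIso (seq C) (splitIso (par C) X Z) (splitIso (par C) Y W)).app _)).injective
  rw [inj.eq_iff, ← toSeqPar_injective.eq_iff, toSeqPar_seqK, toSeqPar_seqK]
  refine Eq.congr ?_ ?_
  -- The computation brackets the middle side objects to the left, `substSeq` to the right.
  · refine seqPar_eq (𝟙 _) (α_ _ _ _).inv (𝟙 _) (𝟙 _) (α_ _ _ _).inv (𝟙 _)
      (𝟙 _ ⊗≫ (𝟙 r.M ⊗ₘ s.g ⊗ₘ 𝟙 r.N ⊗ₘ t.g ⊗ₘ 𝟙 r.O) ⊗≫ 𝟙 _) ?_ ?_ ?_ ?_ <;>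
      simp only [side₂_eq, monoidalComp, MonoidalCategory.tensorHom_def] <;> monoidal
  · refine congr_arg (Quot.mk _) ?_
    congr 1
    simp only [monoidalComp]
    monoidal

end MCtx

/-! ### The normal produoidal category of monoidal contexts. -/

theorem mainTheorem3 {C : Type u} [Category.{v} C] [MonoidalCategory C] :
    ∃ S : ProduoidalStructure (par C) (unit C) (seq C) (unit C),
      S.IsNormal ∧
      -- the sequential associator
      (∀ {A U U' X Y Z : MCtx C} (s : SeqRep A U Z) (t : SeqRep U X Y)
        (s' : SeqRep A X U') (t' : SeqRep U' Y Z),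
        (S.seq.assoc X Y Z).hom.app (op A) (nestLMk (seq C) s.cls t.cls) =
            nestRMk (seq C) s'.cls t'.cls ↔
          s.substLeft t = s'.substRight t') ∧
      -- the sequential unitors
      (∀ {A U X : MCtx C} (s : SeqRep A U X) (n : U.dom ⟶ U.cod),
        (S.seq.leftUnitor X).hom.app (op A) (nestLMk (seq C) s.cls (toUnit n)) =
          toYoneda (ctx (s.f ≫ s.M ◁ n ▷ s.N ≫ s.g) s.h)) ∧
      (∀ {A U X : MCtx C} (s : SeqRep A X U) (n : U.dom ⟶ U.cod),
        (S.seq.rightUnitor X).hom.app (op A) (nestRMk (seq C) s.cls (toUnit n)) =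
          toYoneda (ctx s.f (s.g ≫ s.K ◁ n ▷ s.L ≫ s.h))) ∧
      -- the parallel associator
      (∀ {A U U' X Y Z : MCtx C} (s : ParRep A U Z) (t : ParRep U X Y)
        (s' : ParRep A X U') (t' : ParRep U' Y Z),
        (S.par.assoc X Y Z).hom.app (op A) (nestLMk (par C) s.cls t.cls) =
            nestRMk (par C) s'.cls t'.cls ↔
          s.substLeft t = s'.substRight t') ∧
      -- the parallel unitors
      (∀ {A U X : MCtx C} (s : ParRep A U X) (n : U.dom ⟶ U.cod),
        (S.par.leftUnitor X).hom.app (op A) (nestLMk (par C) s.cls (toUnit n)) =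
          toYoneda (ctx (M := s.M ⊗ U.cod ⊗ s.N) (N := s.O)
            (s.f ≫ s.M ◁ n ▷ (s.N ⊗ X.dom ⊗ s.O) ⊗≫ 𝟙 _) (𝟙 _ ⊗≫ s.g))) ∧
      (∀ {A U X : MCtx C} (s : ParRep A X U) (n : U.dom ⟶ U.cod),
        (S.par.rightUnitor X).hom.app (op A) (nestRMk (par C) s.cls (toUnit n)) =
          toYoneda (ctx (M := s.M) (N := s.N ⊗ U.cod ⊗ s.O)
            (s.f ≫ s.M ◁ X.dom ◁ s.N ◁ n ▷ s.O) s.g)) ∧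
      -- the laxators
      (∀ {A U V U' V' X Y Z W : MCtx C} (r : ParRep A U V) (s : SeqRep U X Y) (t : SeqRep V Z W)
        (s' : SeqRep A U' V') (p : ParRep U' X Z) (q : ParRep V' Y W),
        (S.psi₂ X Y Z W).app (op A) (convMk (par C) r.cls s.cls t.cls) =
            convMk (seq C) s'.cls p.cls q.cls ↔
          r.substSeq s t = s'.substPar p q) ∧
      (∀ {A U V : MCtx C} (f : A.dom ⟶ A.cod) (s : SeqRep A U V) (g : U.dom ⟶ U.cod)
        (h : V.dom ⟶ V.cod),
        S.psi₀.app (op A) (toUnit f) = convMk (seq C) s.cls (toUnit g) (toUnit h) ↔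
          f = s.f ≫ s.M ◁ g ▷ s.N ≫ s.g ≫ s.K ◁ h ▷ s.L ≫ s.h) ∧
      (∀ {A U V : MCtx C} (s : ParRep A U V) (g : U.dom ⟶ U.cod) (h : V.dom ⟶ V.cod),
        S.phi₂.app (op A) (convMk (par C) s.cls (toUnit g) (toUnit h)) =
          toUnit (s.f ≫ (𝟙 s.M ⊗ₘ g ⊗ₘ 𝟙 s.N ⊗ₘ h ⊗ₘ 𝟙 s.O) ≫ s.g)) ∧
      S.phi₀ = 𝟙 (unit C) ∧
      IsIso S.psi₀ ∧ IsIso S.phi₂ := by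
  refine ⟨produoidal C, ?_, seq_assoc_iff, seq_leftUnitor_app, seq_rightUnitor_app, par_assoc_iff,
    par_leftUnitor_app, par_rightUnitor_app, psi₂_app_eq_iff, psi₀_app_eq_iff, phi₂_app, rfl,
    ?_, ?_⟩
  · exact inferInstanceAs (IsIso (𝟙 (unit C)))
  · exact inferInstanceAs (IsIso (psi₀Iso C).hom)
  · exact inferInstanceAs (IsIso (phi₂Iso C).hom)
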